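/- Let $n\ge 1$, $s\in(0,1)$, let $K\subset\mathbb R^n$ be a convex body (a compact convex set with nonempty interior) and let $L\subset\mathbb R^n$ be an origin-symmetric convex body. Write $h_K(v)=\max_{x\in K} v\cdot x$ for the support function, $\rho_{K,z}(u)=\max\{t\ge 0: z+tu\in K\}$ for the radial function of $K$ with respect to $z\in K$, $\rho_L=\rho_{L,0}$, and $\|\cdot\|_L$ for the norm with closed unit ball $L$. For a bounded Borel set $E\subset\mathbb R^n$ let $$P_s(E,L)=\int_E\int_{E^c}\frac{dx\,dy}{\|x-y\|_L^{n+s}} .$$ For $z\in\partial K$ let $$\tilde V_{n+s}(K,L,z)=\frac1n\int_{\{u\in\mathbb S^{n-1}:\ \rho_{K,z}(u)>0\}}\rho_{K,z}(u)^{-s}\rho_L(u)^{n+s}\,du ,$$ where $du$ is the surface measure on $\mathbb S^{n-1}$, and for Borel $\eta\subset\mathbb S^{n-1}$ let $$\mathcal A_s(K,L,\eta)=\frac ns\int_{\nu_K^{-1}(\eta)}\tilde V_{n+s}(K,L,z)\,d\mathcal H^{n-1}(z),\qquad \nu_K^{-1}(\eta)=\{z\in\partial K:\ v\cdot z=h_K(v)\text{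 for some }v\in\eta\}.$$ Then $\mathcal A_s(K,L,\cdot)$ is a finite Borel measure on $\mathbb S^{n-1}$. Moreover, let $f:\mathbb S^{n-1}\to\mathbb R$ be continuous and, for $t\in\mathbb R$, let $$K_t=\{x\in\mathbb R^n:\ x\cdot v\le h_K(v)+t f(v)\text{ for all }v\in\mathbb S^{n-1}\}$$ be the Wulff shape of $h_K+tf$. Then $P_s(K_t,L)$ is finite for all $t$ in a neighbourhood of $0$, and $t\mapsto P_s(K_t,L)$ is (two-sidedly) differentiable at $t=0$ with $$\frac{d}{dt}\Big|_{t=0}P_s(K_t,L)=2\int_{\mathbb S^{n-1}} f(v)\,d\mathcal A_s(K,L,v).$$ -/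

import Mathlib

open MeasureTheory Metric Set Filter
open scoped ENNReal RealInnerProductSpace Topology

noncomputable section

namespace AnisoPerimeter

/-- Euclidean space `ℝⁿ`. -/
abbrev Euc (n : ℕ) : Type := EuclideanSpace ℝ (Fin n)

/-- The unit sphere `𝕊ⁿ⁻¹` of `ℝⁿ`. -/
abbrev Sph (n : ℕ) : Type := sphere (0 : Euc n) 1

variable {n : ℕ}

/-- A convex body: a compact convex set with nonempty interior. -/
structure IsConvexBody (K : Set (Euc n)) : Prop where
  isCompact : IsCompact K
  convex : Convex ℝ K
  interior_nonempty : (interior K).Nonempty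

/-- An origin-symmetric convex body. -/
structure IsSymmConvexBody (L : Set (Euc n)) : Prop extends IsConvexBody L where
  neg_mem : ∀ x ∈ L, -x ∈ L

/-- The support function `h_K(v) = max {v · x : x ∈ K}` on the sphere. -/
def supportFun (K : Set (Euc n)) (v : Sph n) : ℝ :=
  sSup ((fun x : Euc n => ⟪(v : Euc n), x⟫) '' K)

/-- The Wulff shape `{x : v · x ≤ h(v) for all v ∈ 𝕊ⁿ⁻¹}` generated by `h`. -/
def wulffShape (h : Sph n → ℝ) : Set (Euc n) :=
  {x | ∀ v : Sph n, ⟪(v : Euc n), x⟫ ≤ h v}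

/-- The radial function `ρ_{K,z}(u) = max {t ≥ 0 : z + t u ∈ K}` of `K` with respect to `z`. -/
def radialFun (K : Set (Euc n)) (z : Euc n) (u : Sph n) : ℝ :=
  sSup {t : ℝ | 0 ≤ t ∧ z + t • (u : Euc n) ∈ K}

/-- The anisotropic fractional perimeter
`P_s(E, L) = ∫_E ∫_{Eᶜ} ‖x - y‖_L ^ (-(n + s))`, as an extended nonnegative number. Here
`‖x‖_L = gauge L x` is the norm with closed unit ball `L`. -/
def fracPerimeter (s : ℝ) (E L : Set (Euc n)) : ℝ≥0∞ :=
  ∫⁻ y in E, ∫⁻ x in Eᶜ, ENNReal.ofReal (1 / gauge L (x - y) ^ ((n : ℝ) + s))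

/-- The dual mixed volume
`Ṽ_p(K, L, z) = (1/n) ∫_{ρ_{K,z}(u) > 0} ρ_{K,z}(u) ^ (n - p) * ρ_L(u) ^ p du`,
where `du` is the surface measure of the sphere; its value may be `∞` when `p > n`. -/
def dualMixedVolume (p : ℝ) (K L : Set (Euc n)) (z : Euc n) : ℝ≥0∞ :=
  ENNReal.ofReal (1 / (n : ℝ)) *
    ∫⁻ u in {u : Sph n | 0 < radialFun K z u},
      ENNReal.ofReal (radialFun K z u ^ ((n : ℝ) - p) * radialFun L 0 u ^ p)
        ∂((volume : Measure (Euc n)).toSphere)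

/-- The inverse Gauss image `ν_K⁻¹(η)`: the boundary points of `K` at which some `v ∈ η` is a
unit outer normal. -/
def inverseGauss (K : Set (Euc n)) (η : Set (Sph n)) : Set (Euc n) :=
  {z | z ∈ frontier K ∧ ∃ v ∈ η, ⟪(v : Euc n), z⟫ = supportFun K v}

/-- The set function
`η ↦ (n/s) ∫_{ν_K⁻¹(η)} Ṽ_{n+s}(K, L, z) dℋⁿ⁻¹(z)`, where `μHE[n - 1]` is the
`(n-1)`-dimensional Hausdorff measure normalized to agree with Lebesgue measure. -/
def fracAreaSetFun (s : ℝ) (K L : Set (Euc n)) (η : Set (Sph n)) : ℝ≥0∞ :=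
  ENNReal.ofReal ((n : ℝ) / s) *
    ∫⁻ z in inverseGauss K η, dualMixedVolume ((n : ℝ) + s) K L z ∂μHE[n - 1]

/-- `A` is the anisotropic `s`-fractional area measure `𝒜_s(K, L, ·)`: the Borel measure on the
sphere whose value on each Borel set is given by `fracAreaSetFun`. There is at most one such
measure. -/
def IsFracAreaMeasure (s : ℝ) (K L : Set (Euc n)) (A : Measure (Sph n)) : Prop :=
  ∀ η : Set (Sph n), MeasurableSet η → A η = fracAreaSetFun s K L η

end AnisoPerimeter

end

open MeasureTheory Metric Set Filter
open scoped ENNReal RealInnerProductSpace Topology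

noncomputable section

namespace AnisoPerimeter

variable {n : ℕ}

/-! Everything is reduced to chords. In polar coordinates around `y` the kernel of `P_s` becomes
`ρ_L(u)^(n+s) r^(-1-s)`. Grouping the points by lines of direction `u` then gives `P_s(K, L) =
(s(1-s))⁻¹ J(K)`, where the chord energy `J(K)` integrates (chord length)^(1-s) over all lines
(`fracPerimeter_eq`, `chordEnergy`). A line is weighted through `slab u`, in which it has length
one.

For almost every line meeting `K`, both endpoints of the chord have a unique normal
(`ae_regularLine`). There an endpoint moves with speed `f(ν)/⟨ν,u⟩` (`hasDerivAt_topLine_wulffVar`).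
Projecting `∂K` along `u` multiplies area by the cosine `⟨ν,u⟩` (`topMeasure_eq`), which cancels
this denominator. Integrating the formal derivative of `J` therefore produces `2 s(1-s) ∫ f d𝒜`
(`lintegral_chordRate`).

Interchanging limit and integral is the difficulty, since the rates are singular at grazing lines
and no dominating function is at hand. Fatou's lemma only gives a lower bound for the growth of
`J(K_g) - J(K_f)` when `f ≤ g` (`lintegral_le_liminf_chordEnergy_sub`). The bound is an equality for
dilations `f = c h_K`, where `J` is homogeneous of degree `n - s`. Indeed `2 s(1-s) ∫ h_K d𝒜 = (n-s)
J(K)` (`lintegral_supportFun_fracAreaMeasure`): one inequality is Fatou, the other combines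
concavity of `x^(1-s)` with the fact that the lines meeting `(1+t)K` but not `K` contribute `o(t)`
(`mul_chordEnergy_le`). This identity also shows that `𝒜` is finite. Finally a continuous `f` is
squeezed as `-C h_K ≤ f ≤ C h_K`. Fatou for the two gaps and the known derivatives at both ends
determine the derivative for `f` (`eventually_abs_chordEnergy_sub_le`). -/

/-! ### Integration along parallel lines -/

/-- The closed region between two parallel hyperplanes orthogonal to `v`. -/
def band (v : Euc n) (a b : ℝ) : Set (Euc n) := {y | ⟪v, y⟫ ∈ Icc a b}

/-- The symmetric band of width one orthogonal to `u`. It meets each line of direction `u` in a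
segment of length one. -/
def slab (u : Sph n) : Set (Euc n) := band (u : Euc n) (-(1 / 2)) (1 / 2)

theorem isClosed_band (v : Euc n) (a b : ℝ) : IsClosed (band v a b) :=
  isClosed_Icc.preimage (by fun_prop)

theorem measurableSet_band (v : Euc n) (a b : ℝ) : MeasurableSet (band v a b) :=
  (isClosed_band v a b).measurableSet

theorem measurableSet_slab (u : Sph n) : MeasurableSet (slab u) := measurableSet_band _ _ _

theorem slab_neg (u : Sph n) : slab (-u) = slab u := by
  ext y
  simp only [slab, band, mem_ofPred_eq, mem_Icc, coe_neg_sphere, inner_neg_left]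
  constructor <;> rintro ⟨h1, h2⟩ <;> constructor <;> linarith

theorem inner_self_sphere (u : Sph n) : ⟪(u : Euc n), (u : Euc n)⟫ = 1 := by
  rw [real_inner_self_eq_norm_sq, norm_eq_of_mem_sphere u]; norm_num

/-- By Tonelli and the substitutions `y ↦ y + τu`, `τ ↦ -τ`, both sides integrate the product of `φ`
and `κ` over pairs of points on a common line. Choosing indicators for one factor changes the way in
which lines are weighted. -/
theorem lintegral_mul_lintegral_line (u : Euc n) {φ κ : Euc n → ℝ≥0∞} (hφ : Measurable φ)
    (hκ : Measurable κ) :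
    ∫⁻ y, φ y * ∫⁻ τ : ℝ, κ (y + τ • u) = ∫⁻ y, κ y * ∫⁻ τ : ℝ, φ (y + τ • u) := by
  have e1 : ∀ {φ κ : Euc n → ℝ≥0∞}, Measurable φ → Measurable κ →
      ∫⁻ y, φ y * ∫⁻ τ : ℝ, κ (y + τ • u) = ∫⁻ τ : ℝ, ∫⁻ y, φ y * κ (y + τ • u) := by
    intro φ κ hφ hκ
    have : ∀ y, φ y * ∫⁻ τ : ℝ, κ (y + τ • u) = ∫⁻ τ : ℝ, φ y * κ (y + τ • u) := fun y =>
      (lintegral_const_mul _ (hκ.comp (by fun_prop))).symm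
    simp_rw [this]
    refine lintegral_lintegral_swap (Measurable.aemeasurable ?_)
    exact (hφ.comp measurable_fst).mul (hκ.comp (by fun_prop))
  rw [e1 hφ hκ, e1 hκ hφ, ← lintegral_neg_eq_self]
  refine lintegral_congr fun τ => ?_
  rw [← lintegral_add_right_eq_self _ (τ • u)]
  refine lintegral_congr fun y => ?_
  simp [mul_comm]

theorem lintegral_band_line {v u : Euc n} (h : ⟪v, u⟫ ≠ 0) {a b : ℝ} (y : Euc n) :
    ∫⁻ τ : ℝ, (band v a b).indicator 1 (y + τ • u) = ENNReal.ofReal ((b - a) / |⟪v, u⟫|) := by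
  have e : (fun τ : ℝ => (band v a b).indicator (1 : Euc n → ℝ≥0∞) (y + τ • u)) =
      ((fun τ : ℝ => ⟪v, u⟫ * τ) ⁻¹' ((fun x => ⟪v, y⟫ + x) ⁻¹' Icc a b)).indicator 1 := by
    ext τ
    simp only [indicator, band, mem_ofPred_eq, mem_preimage, inner_add_right, inner_smul_right,
      mul_comm τ, Pi.one_apply]
  rw [e, lintegral_indicator_one (by measurability), Real.volume_preimage_mul_left h,
    measure_preimage_add, Real.volume_Icc, ← ENNReal.ofReal_mul (abs_nonneg _), abs_inv,
    div_eq_inv_mul]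

theorem lintegral_slab_line (u : Sph n) (y : Euc n) :
    ∫⁻ τ : ℝ, (slab u).indicator 1 (y + τ • (u : Euc n)) = 1 := by
  rw [slab, lintegral_band_line (by rw [inner_self_sphere]; norm_num), inner_self_sphere]
  norm_num

theorem setLIntegral_slab_lintegral_line (u : Sph n) {φ : Euc n → ℝ≥0∞} (hφ : Measurable φ) :
    ∫⁻ y in slab u, ∫⁻ τ : ℝ, φ (y + τ • (u : Euc n)) = ∫⁻ y, φ y := by
  have := lintegral_mul_lintegral_line (u : Euc n) hφ
    (measurable_one.indicator (measurableSet_slab u))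
  simp_rw [lintegral_slab_line, mul_one] at this
  rw [this, ← lintegral_indicator (measurableSet_slab u)]
  refine lintegral_congr fun y => ?_
  by_cases hy : y ∈ slab u <;> simp [hy]

/-- A line of direction `u` has length `(b - a)/|⟨v,u⟩|` in the band and length one in the slab. A
function constant along these lines only sees this ratio. -/
theorem setLIntegral_band_of_line_invariant (u : Sph n) {v : Euc n} (hv : ⟪v, (u : Euc n)⟫ ≠ 0)
    {a b : ℝ} {φ : Euc n → ℝ≥0∞} (hφ : Measurable φ)
    (hinv : ∀ y (τ : ℝ), φ (y + τ • (u : Euc n)) = φ y) :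
    ∫⁻ y in band v a b, φ y =
      ENNReal.ofReal ((b - a) / |⟪v, (u : Euc n)⟫|) * ∫⁻ y in slab u, φ y := by
  have h := lintegral_mul_lintegral_line (u : Euc n)
    (hφ.mul (measurable_one.indicator (measurableSet_slab u)))
    (measurable_one.indicator (measurableSet_band v a b))
  simp_rw [lintegral_band_line hv, Pi.mul_apply, hinv] at h
  have e : ∀ y : Euc n, ∫⁻ τ : ℝ, φ y * (slab u).indicator 1 (y + τ • (u : Euc n)) = φ y := by
    intro y
    have hm : Measurable fun τ : ℝ => (slab u).indicator (1 : Euc n → ℝ≥0∞) (y + τ • (u : Euc n)) :=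
      (measurable_one.indicator (measurableSet_slab u)).comp (by fun_prop)
    rw [lintegral_const_mul _ hm, lintegral_slab_line, mul_one]
  simp_rw [e] at h
  have hm : Measurable fun y => φ y * (slab u).indicator (1 : Euc n → ℝ≥0∞) y :=
    hφ.mul (measurable_one.indicator (measurableSet_slab u))
  rw [lintegral_mul_const _ hm] at h
  rw [← lintegral_indicator (measurableSet_slab u), ← lintegral_indicator (measurableSet_band v a b),
    mul_comm]
  have i1 : ∀ y, (band v a b).indicator φ y = (band v a b).indicator 1 y * φ y := fun y => by
    by_cases hy : y ∈ band v a b <;> simp [hy]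
  have i2 : ∀ y, (slab u).indicator φ y = φ y * (slab u).indicator 1 y := fun y => by
    by_cases hy : y ∈ slab u <;> simp [hy]
  simp_rw [i1, i2]
  exact h.symm

/-! ### Oblique projections and polar coordinates -/

/-- The projection along `u` onto the hyperplane through the origin orthogonal to `v`. -/
def obliqueProj (u v : Euc n) (y : Euc n) : Euc n := y - (⟪v, y⟫ / ⟪v, u⟫) • u

theorem continuous_obliqueProj (u v : Euc n) : Continuous (obliqueProj u v) := by
  unfold obliqueProj; fun_prop

theorem inner_obliqueProj {u v : Euc n} (h : ⟪v, u⟫ ≠ 0) (y : Euc n) :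
    ⟪v, obliqueProj u v y⟫ = 0 := by
  rw [obliqueProj, inner_sub_right, inner_smul_right, div_mul_cancel₀ _ h, sub_self]

theorem obliqueProj_add_smul {u v : Euc n} (h : ⟪v, u⟫ ≠ 0) (y : Euc n) (τ : ℝ) :
    obliqueProj u v (y + τ • u) = obliqueProj u v y := by
  rw [obliqueProj, obliqueProj, inner_add_right, inner_smul_right, add_div,
    mul_div_cancel_right₀ _ h, add_smul]
  abel

/-- The set is a sheared cylinder: its sections orthogonal to `v` are translates, along `u`, of one
base. Its volume is height times base area. -/
theorem volume_band_inter_preimage_obliqueProj {u : Euc n} {v : Sph n}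
    (h : ⟪(v : Euc n), u⟫ ≠ 0) {S : Set (Euc n)} (hS : MeasurableSet S) (a b : ℝ) :
    volume (band (v : Euc n) a b ∩ obliqueProj u v ⁻¹' S) =
      ENNReal.ofReal (b - a) * μHE[n - 1] (S ∩ {y | ⟪(v : Euc n), y⟫ = 0}) := by
  have hv0 : (v : Euc n) ≠ 0 := ne_zero_of_mem_unit_sphere v
  have hm : MeasurableSet (band (v : Euc n) a b ∩ obliqueProj u v ⁻¹' S) :=
    (measurableSet_band _ _ _).inter (hS.preimage (continuous_obliqueProj u v).measurable)
  have hE := EuclideanGeometry.euclideanHausdorffMeasure_eq_lintegral (0 : Euc n) hv0 hm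
  rw [InnerProductSpace.euclideanHausdorffMeasure_eq_volume, finrank_euclideanSpace_fin] at hE
  rw [hE, enorm_eq_nnnorm, show ‖(v : Euc n)‖₊ = 1 by ext; simp, ENNReal.coe_one, one_mul]
  have e : ∀ x : ℝ, μHE[n - 1] (band (v : Euc n) a b ∩ obliqueProj u v ⁻¹' S ∩
      (AffineSubspace.mk' (x • (v : Euc n) +ᵥ (0 : Euc n)) (Submodule.span ℝ {(v : Euc n)})ᗮ)) =
      (Icc a b).indicator (fun _ => μHE[n - 1] (S ∩ {y | ⟪(v : Euc n), y⟫ = 0})) x := by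
    intro x
    have hmem : ∀ y : Euc n, y ∈ (AffineSubspace.mk' (x • (v : Euc n) +ᵥ (0 : Euc n))
        (Submodule.span ℝ {(v : Euc n)})ᗮ) ↔ ⟪(v : Euc n), y⟫ = x := by
      intro y
      rw [AffineSubspace.mem_mk', Submodule.mem_orthogonal_singleton_iff_inner_right]
      simp only [vadd_eq_add, add_zero, vsub_eq_sub, inner_sub_right, inner_smul_right,
        inner_self_sphere, mul_one, sub_eq_zero]
    by_cases hx : x ∈ Icc a b
    · rw [indicator_of_mem hx]
      have : band (v : Euc n) a b ∩ obliqueProj u v ⁻¹' S ∩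
          (AffineSubspace.mk' (x • (v : Euc n) +ᵥ (0 : Euc n)) (Submodule.span ℝ {(v : Euc n)})ᗮ)
          = (fun y => (x / ⟪(v : Euc n), u⟫) • u + y) '' (S ∩ {y | ⟪(v : Euc n), y⟫ = 0}) := by
        ext y
        simp only [mem_inter_iff, SetLike.mem_coe, hmem, mem_preimage, image_add_left,
          mem_ofPred_eq, inner_add_right, inner_neg_right, inner_smul_right, div_mul_cancel₀ _ h]
        have hb : ⟪(v : Euc n), y⟫ = x → y ∈ band (v : Euc n) a b := fun hy => by
          simpa [band, hy] using hx
        have hq : ⟪(v : Euc n), y⟫ = x →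
            obliqueProj u v y = -((x / ⟪(v : Euc n), u⟫) • u) + y := fun hy => by
          rw [obliqueProj, hy]; abel
        constructor
        · rintro ⟨⟨_, h2⟩, h3⟩
          exact ⟨hq h3 ▸ h2, by rw [h3]; ring⟩
        · rintro ⟨h2, h3⟩
          have h3' : ⟪(v : Euc n), y⟫ = x := by linarith
          exact ⟨⟨hb h3', (hq h3').symm ▸ h2⟩, h3'⟩
      rw [this]
      exact (isometry_add_left _).euclideanHausdorffMeasure_image _
    · rw [indicator_of_notMem hx]
      convert measure_empty (μ := (μHE[n - 1] : Measure (Euc n)))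
      ext y
      simp only [mem_inter_iff, SetLike.mem_coe, hmem, mem_empty_iff_false, iff_false]
      rintro ⟨⟨h1, _⟩, rfl⟩
      exact hx h1
  simp_rw [e]
  rw [lintegral_indicator measurableSet_Icc, setLIntegral_const, Real.volume_Icc, mul_comm]

theorem volume_slab_inter_preimage_obliqueProj {u v : Sph n}
    (h : ⟪(v : Euc n), (u : Euc n)⟫ ≠ 0) {S : Set (Euc n)} (hS : MeasurableSet S) :
    volume (slab u ∩ obliqueProj u v ⁻¹' S) =
      ENNReal.ofReal |⟪(v : Euc n), (u : Euc n)⟫| *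
        μHE[n - 1] (S ∩ {y | ⟪(v : Euc n), y⟫ = 0}) := by
  set c := |⟪(v : Euc n), (u : Euc n)⟫|
  have hc : 0 < c := abs_pos.2 h
  have hm := hS.preimage (continuous_obliqueProj (u : Euc n) v).measurable
  -- The width `c` is the one for which the band, like the slab, cuts length one from every line of
  -- direction `u`. This is where the cosine factor originates.
  have h1 := setLIntegral_band_of_line_invariant u h (a := 0) (b := c)
    (measurable_one.indicator hm) (fun y τ => by
      have e : y + τ • (u : Euc n) ∈ obliqueProj (u : Euc n) v ⁻¹' S ↔
          y ∈ obliqueProj (u : Euc n) v ⁻¹' S := by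
        rw [mem_preimage, mem_preimage, obliqueProj_add_smul h]
      by_cases hy : y ∈ obliqueProj (u : Euc n) v ⁻¹' S
      · rw [indicator_of_mem hy, indicator_of_mem (e.2 hy)]; rfl
      · rw [indicator_of_notMem hy, indicator_of_notMem (mt e.1 hy)])
  rw [lintegral_indicator_one hm, lintegral_indicator_one hm, sub_zero, div_self hc.ne',
    ENNReal.ofReal_one, one_mul, Measure.restrict_apply hm, Measure.restrict_apply hm,
    inter_comm, volume_band_inter_preimage_obliqueProj h hS, sub_zero, inter_comm _ (slab u)] at h1
  exact h1.symm

theorem lintegral_polar (hn : 1 ≤ n) {F : Euc n → ℝ≥0∞} (hF : Measurable F) :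
    ∫⁻ x, F x = ∫⁻ u : Sph n, (∫⁻ r in Ioi (0 : ℝ),
      F (r • (u : Euc n)) * ENNReal.ofReal (r ^ (n - 1)))
        ∂((volume : Measure (Euc n)).toSphere) := by
  have : Nonempty (Fin n) := ⟨⟨0, hn⟩⟩
  have h0 : ∫⁻ x, F x = ∫⁻ x in ({0}ᶜ : Set (Euc n)), F x := by
    rw [← lintegral_add_compl F (measurableSet_singleton (0 : Euc n)),
      setLIntegral_measure_zero _ _ (measure_singleton _), zero_add]
  have hmp := (volume : Measure (Euc n)).measurePreserving_homeomorphUnitSphereProd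
  have hG : Measurable fun p : Sph n × Ioi (0 : ℝ) => F ((p.2 : ℝ) • (p.1 : Euc n)) :=
    hF.comp (by fun_prop)
  have h1 := hmp.lintegral_comp hG
  have h2 : ∀ x : ({0}ᶜ : Set (Euc n)), F ((((homeomorphUnitSphereProd (Euc n) x).2 : ℝ)) •
      ((homeomorphUnitSphereProd (Euc n) x).1 : Euc n)) = F x := by
    intro x
    have hx : ‖(x : Euc n)‖ ≠ 0 := norm_ne_zero_iff.2 x.2
    simp [smul_smul, hx]
  simp_rw [h2] at h1
  rw [h0, ← lintegral_subtype_comap (measurableSet_singleton (0 : Euc n)).compl, h1,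
    lintegral_prod _ hG.aemeasurable, finrank_euclideanSpace_fin]
  refine lintegral_congr fun u => ?_
  have hm : Measurable fun r : Ioi (0 : ℝ) => F ((r : ℝ) • (u : Euc n)) := hF.comp (by fun_prop)
  rw [Measure.volumeIoiPow, lintegral_withDensity_eq_lintegral_mul _ (by fun_prop) hm]
  rw [← lintegral_subtype_comap measurableSet_Ioi]
  refine lintegral_congr fun r => ?_
  simp [mul_comm]

/-! ### Chords of a compact set -/

/-- The largest parameter `τ` for which `y + τ u` lies in `K`; it is `0` if there is none. -/
def topLine (K : Set (Euc n)) (u : Sph n) (y : Euc n) : ℝ :=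
  sSup {τ : ℝ | y + τ • (u : Euc n) ∈ K}

/-- The length of the chord which the line through `y` of direction `u` cuts out of `K`; it is `0`
if the line misses `K`. -/
def chordLen (K : Set (Euc n)) (u : Sph n) (y : Euc n) : ℝ := topLine K u y + topLine K (-u) y

/-- The line through `y` of direction `u` meets `K`. -/
def Hits (K : Set (Euc n)) (u : Sph n) (y : Euc n) : Prop := ∃ τ : ℝ, y + τ • (u : Euc n) ∈ K

theorem add_smul_neg_sphere (u : Sph n) (y : Euc n) (τ : ℝ) :
    y + τ • ((-u : Sph n) : Euc n) = y + (-τ) • (u : Euc n) := by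
  rw [coe_neg_sphere, smul_neg, neg_smul]

theorem hits_neg {K : Set (Euc n)} {u : Sph n} {y : Euc n} : Hits K (-u) y ↔ Hits K u y := by
  constructor <;> rintro ⟨τ, h⟩ <;> refine ⟨-τ, ?_⟩
  · rwa [add_smul_neg_sphere] at h
  · rwa [add_smul_neg_sphere, neg_neg]

theorem hits_add_smul {K : Set (Euc n)} {u : Sph n} {y : Euc n} (σ : ℝ) :
    Hits K u (y + σ • (u : Euc n)) ↔ Hits K u y := by
  constructor
  · rintro ⟨τ, h⟩
    exact ⟨σ + τ, by rwa [add_smul, ← add_assoc]⟩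
  · rintro ⟨τ, h⟩
    refine ⟨τ - σ, ?_⟩
    rwa [add_assoc, ← add_smul, add_sub_cancel]

theorem hits_of_mem {K : Set (Euc n)} {u : Sph n} {y : Euc n} (h : y ∈ K) : Hits K u y :=
  ⟨0, by simpa using h⟩

theorem Hits.mono {K K' : Set (Euc n)} {u : Sph n} {y : Euc n} (h : Hits K u y) (hK : K ⊆ K') :
    Hits K' u y := h.imp fun _ hτ => hK hτ

theorem bddAbove_line {K : Set (Euc n)} (hK : IsCompact K) (u : Sph n) (y : Euc n) :
    BddAbove {τ : ℝ | y + τ • (u : Euc n) ∈ K} := by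
  obtain ⟨R, hR⟩ := hK.isBounded.exists_norm_le
  refine ⟨R + ‖y‖, fun τ hτ => ?_⟩
  have h1 := hR _ hτ
  have h2 : ‖τ • (u : Euc n)‖ = |τ| := by
    rw [norm_smul, norm_eq_of_mem_sphere u, mul_one, Real.norm_eq_abs]
  have h3 : ‖τ • (u : Euc n)‖ ≤ ‖y + τ • (u : Euc n)‖ + ‖y‖ := by
    simpa using norm_sub_le (y + τ • (u : Euc n)) y
  linarith [le_abs_self τ]

theorem isClosed_line {K : Set (Euc n)} (hK : IsClosed K) (u : Sph n) (y : Euc n) :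
    IsClosed {τ : ℝ | y + τ • (u : Euc n) ∈ K} := hK.preimage (by fun_prop)

theorem topLine_mem {K : Set (Euc n)} (hK : IsCompact K) {u : Sph n} {y : Euc n}
    (h : Hits K u y) : y + topLine K u y • (u : Euc n) ∈ K :=
  (isClosed_line hK.isClosed u y).csSup_mem h (bddAbove_line hK u y)

theorem le_topLine {K : Set (Euc n)} (hK : IsCompact K) {u : Sph n} {y : Euc n} {τ : ℝ}
    (h : y + τ • (u : Euc n) ∈ K) : τ ≤ topLine K u y :=
  le_csSup (bddAbove_line hK u y) h

/-- Reversing the direction exchanges the two ends of a chord, so the lower end has parameter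
`-topLine K (-u) y`; no separate notion of bottom is needed. -/
theorem neg_topLine_neg_le {K : Set (Euc n)} (hK : IsCompact K) {u : Sph n} {y : Euc n} {τ : ℝ}
    (h : y + τ • (u : Euc n) ∈ K) : -topLine K (-u) y ≤ τ := by
  have : -τ ≤ topLine K (-u) y := le_topLine hK (by rwa [add_smul_neg_sphere, neg_neg])
  linarith

theorem line_eq_Icc {K : Set (Euc n)} (hK : IsCompact K) (hc : Convex ℝ K) {u : Sph n} {y : Euc n}
    (h : Hits K u y) :
    {τ : ℝ | y + τ • (u : Euc n) ∈ K} = Icc (-topLine K (-u) y) (topLine K u y) := by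
  refine Subset.antisymm (fun τ hτ => ⟨neg_topLine_neg_le hK hτ, le_topLine hK hτ⟩) ?_
  have hconv : Convex ℝ {τ : ℝ | y + τ • (u : Euc n) ∈ K} :=
    hc.affine_preimage ((AffineMap.const ℝ ℝ y) +
      ((LinearMap.toSpanSingleton ℝ (Euc n) (u : Euc n)).toAffineMap))
  refine hconv.ordConnected.out ?_ (topLine_mem hK h)
  have := topLine_mem hK (hits_neg.2 h)
  rwa [add_smul_neg_sphere] at this

theorem topLine_of_not_hits {K : Set (Euc n)} {u : Sph n} {y : Euc n} (h : ¬ Hits K u y) :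
    topLine K u y = 0 := by
  have : {τ : ℝ | y + τ • (u : Euc n) ∈ K} = ∅ := by
    ext τ; simp only [mem_ofPred_eq, mem_empty_iff_false, iff_false]; exact fun hτ => h ⟨τ, hτ⟩
  rw [topLine, this, Real.sSup_empty]

theorem chordLen_of_not_hits {K : Set (Euc n)} {u : Sph n} {y : Euc n} (h : ¬ Hits K u y) :
    chordLen K u y = 0 := by
  rw [chordLen, topLine_of_not_hits h, topLine_of_not_hits (mt hits_neg.1 h), add_zero]

theorem chordLen_nonneg {K : Set (Euc n)} (hK : IsCompact K) (u : Sph n) (y : Euc n) :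
    0 ≤ chordLen K u y := by
  by_cases h : Hits K u y
  · have := neg_topLine_neg_le hK (topLine_mem hK h)
    rw [chordLen]; linarith
  · rw [chordLen_of_not_hits h]

theorem chordLen_neg (K : Set (Euc n)) (u : Sph n) (y : Euc n) :
    chordLen K (-u) y = chordLen K u y := by
  rw [chordLen, chordLen, neg_neg, add_comm]

theorem topLine_add_smul {K : Set (Euc n)} (hK : IsCompact K) {u : Sph n} {y : Euc n}
    (h : Hits K u y) (σ : ℝ) :
    topLine K u (y + σ • (u : Euc n)) = topLine K u y - σ := by
  refine le_antisymm ?_ ?_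
  · have := topLine_mem hK ((hits_add_smul σ).2 h)
    rw [add_assoc, ← add_smul] at this
    linarith [le_topLine hK this]
  · refine le_topLine hK ?_
    rw [add_assoc, ← add_smul, add_sub_cancel]
    exact topLine_mem hK h

theorem volume_line {K : Set (Euc n)} (hK : IsCompact K) (hc : Convex ℝ K) (u : Sph n) (y : Euc n) :
    volume {τ : ℝ | y + τ • (u : Euc n) ∈ K} = ENNReal.ofReal (chordLen K u y) := by
  by_cases h : Hits K u y
  · rw [line_eq_Icc hK hc h, Real.volume_Icc, chordLen, sub_neg_eq_add]
  · rw [chordLen_of_not_hits h, ENNReal.ofReal_zero]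
    convert measure_empty (μ := (volume : Measure ℝ))
    ext τ; simp only [mem_ofPred_eq, mem_empty_iff_false, iff_false]; exact fun hτ => h ⟨τ, hτ⟩

theorem chordLen_mono {K K' : Set (Euc n)} (hK : IsCompact K) (hK' : IsCompact K')
    (hKK : K ⊆ K') (u : Sph n) (y : Euc n) : chordLen K u y ≤ chordLen K' u y := by
  by_cases h : Hits K u y
  · exact add_le_add (le_topLine hK' (hKK (topLine_mem hK h)))
      (le_topLine hK' (hKK (topLine_mem hK (hits_neg.2 h))))
  · rw [chordLen_of_not_hits h]; exact chordLen_nonneg hK' u y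

theorem radialFun_eq_topLine {K : Set (Euc n)} (hK : IsCompact K) {z : Euc n} (hz : z ∈ K)
    (u : Sph n) : radialFun K z u = topLine K u z := by
  have h0 : 0 ≤ topLine K u z := le_topLine hK (by simpa using hz)
  refine le_antisymm (csSup_le ⟨0, le_rfl, by simpa using hz⟩ fun t ht => le_topLine hK ht.2) ?_
  exact le_csSup ((bddAbove_line hK u z).mono fun t ht => ht.2) ⟨h0, topLine_mem hK ⟨0, by simpa⟩⟩

/-- Projection along a compact factor is a closed map. This yields Borel measurability of chord data
jointly in direction and base point. -/
theorem isClosed_exists_mem {X : Type*} [TopologicalSpace X] {K : Set (Euc n)} (hK : IsCompact K)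
    {F : Set (X × Euc n)} (hF : IsClosed F) : IsClosed {x | ∃ k ∈ K, (x, k) ∈ F} := by
  have : CompactSpace K := isCompact_iff_compactSpace.1 hK
  have hc := isClosedMap_fst_of_compactSpace (X := X) (Y := K) _
    (hF.preimage (f := fun p : X × K => (p.1, (p.2 : Euc n))) (by fun_prop))
  convert hc using 1
  ext x
  constructor
  · rintro ⟨k, hk, h⟩; exact ⟨(x, ⟨k, hk⟩), h, rfl⟩
  · rintro ⟨⟨x', k⟩, h, rfl⟩; exact ⟨k, k.2, h⟩

theorem isClosed_exists_ge_line {K : Set (Euc n)} (hK : IsCompact K) (a : ℝ) :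
    IsClosed {p : Sph n × Euc n | ∃ τ : ℝ, a ≤ τ ∧ p.2 + τ • (p.1 : Euc n) ∈ K} := by
  -- The parameter `τ` ranges over a noncompact line, so it is eliminated in favour of the point `k
  -- ∈ K` through `τ = ⟨u, k - y⟩`.
  have hF : IsClosed {q : (Sph n × Euc n) × Euc n | a ≤ ⟪(q.1.1 : Euc n), q.2 - q.1.2⟫ ∧
      q.1.2 + ⟪(q.1.1 : Euc n), q.2 - q.1.2⟫ • (q.1.1 : Euc n) = q.2} := by
    have h1 : IsClosed {q : (Sph n × Euc n) × Euc n | a ≤ ⟪(q.1.1 : Euc n), q.2 - q.1.2⟫} :=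
      isClosed_le continuous_const (by fun_prop)
    have h2 : IsClosed {q : (Sph n × Euc n) × Euc n |
        q.1.2 + ⟪(q.1.1 : Euc n), q.2 - q.1.2⟫ • (q.1.1 : Euc n) = q.2} :=
      isClosed_eq (by fun_prop) (by fun_prop)
    exact h1.inter h2
  convert isClosed_exists_mem hK hF using 1
  ext ⟨u, y⟩
  constructor
  · rintro ⟨τ, h1, h2⟩
    have : ⟪(u : Euc n), y + τ • (u : Euc n) - y⟫ = τ := by
      rw [add_sub_cancel_left, inner_smul_right, inner_self_sphere, mul_one]
    exact ⟨_, h2, by simpa only [mem_ofPred_eq, this] using ⟨h1, trivial⟩⟩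
  · rintro ⟨k, hk, h1, h2⟩
    exact ⟨_, h1, h2.symm ▸ hk⟩

theorem isClosed_hits {K : Set (Euc n)} (hK : IsCompact K) :
    IsClosed {p : Sph n × Euc n | Hits K p.1 p.2} := by
  have hF : IsClosed {q : (Sph n × Euc n) × Euc n |
      q.1.2 + ⟪(q.1.1 : Euc n), q.2 - q.1.2⟫ • (q.1.1 : Euc n) = q.2} :=
    isClosed_eq (by fun_prop) (by fun_prop)
  convert isClosed_exists_mem hK hF using 1
  ext ⟨u, y⟩
  constructor
  · rintro ⟨τ, h2⟩
    have : ⟪(u : Euc n), y + τ • (u : Euc n) - y⟫ = τ := by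
      rw [add_sub_cancel_left, inner_smul_right, inner_self_sphere, mul_one]
    exact ⟨_, h2, by simp only [mem_ofPred_eq, this]⟩
  · rintro ⟨k, hk, h2⟩
    exact ⟨⟪(u : Euc n), k - y⟫, h2.symm ▸ hk⟩

theorem isOpen_hits {U : Set (Euc n)} (hU : IsOpen U) :
    IsOpen {p : Sph n × Euc n | Hits U p.1 p.2} := by
  have : {p : Sph n × Euc n | Hits U p.1 p.2} =
      ⋃ τ : ℝ, {p : Sph n × Euc n | p.2 + τ • (p.1 : Euc n) ∈ U} := by
    ext p; simp [Hits]
  rw [this]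
  exact isOpen_iUnion fun τ => hU.preimage (by fun_prop)

theorem measurable_topLine {K : Set (Euc n)} (hK : IsCompact K) :
    Measurable fun p : Sph n × Euc n => topLine K p.1 p.2 := by
  refine measurable_of_Ici fun a => ?_
  -- The second piece accounts for lines missing `K`, on which `topLine` has the default value `0`.
  have : (fun p : Sph n × Euc n => topLine K p.1 p.2) ⁻¹' Ici a =
      {p : Sph n × Euc n | ∃ τ : ℝ, a ≤ τ ∧ p.2 + τ • (p.1 : Euc n) ∈ K} ∪
        ({p : Sph n × Euc n | Hits K p.1 p.2}ᶜ ∩ {_p | a ≤ 0}) := by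
    ext ⟨u, y⟩
    simp only [mem_preimage, mem_Ici, mem_union, mem_ofPred_eq, mem_inter_iff, mem_compl_iff]
    by_cases h : Hits K u y
    · simp only [h, not_true_eq_false, false_and, or_false]
      exact ⟨fun ha => ⟨_, ha, topLine_mem hK h⟩, fun ⟨τ, h1, h2⟩ => h1.trans (le_topLine hK h2)⟩
    · simp only [h, not_false_eq_true, true_and, topLine_of_not_hits h]
      exact ⟨Or.inr, fun h' => h'.elim (fun ⟨τ, h1, h2⟩ => (h ⟨τ, h2⟩).elim) id⟩
  rw [this]
  exact (isClosed_exists_ge_line hK a).measurableSet.union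
    ((isClosed_hits hK).measurableSet.compl.inter (MeasurableSet.const _))

theorem measurable_chordLen {K : Set (Euc n)} (hK : IsCompact K) :
    Measurable fun p : Sph n × Euc n => chordLen K p.1 p.2 :=
  (measurable_topLine hK).add ((measurable_topLine hK).comp
    (f := fun p : Sph n × Euc n => (-p.1, p.2))
    ((continuous_neg.comp continuous_fst).prodMk continuous_snd).measurable)

/-! ### The gauge and the radial function of `L` -/

theorem zero_mem_interior_of_symm {L : Set (Euc n)} (hL : IsSymmConvexBody L) :
    (0 : Euc n) ∈ interior L := by
  obtain ⟨x, hx⟩ := hL.interior_nonempty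
  have hx' : -x ∈ interior L := by
    have : -interior L ⊆ interior L := by
      refine interior_maximal (fun y hy => ?_) isOpen_interior.neg
      simpa using hL.neg_mem _ (interior_subset (Set.mem_neg.1 hy))
    exact this (by simpa using hx)
  have := hL.convex.interior hx hx' (a := 1 / 2) (b := 1 / 2) (by norm_num) (by norm_num)
    (by norm_num)
  simpa using this

theorem gauge_le_one_iff {K : Set (Euc n)} (hK : IsCompact K) (hc : Convex ℝ K)
    (h0 : (0 : Euc n) ∈ interior K) {x : Euc n} : gauge K x ≤ 1 ↔ x ∈ K := by
  rw [gauge_le_one_iff_mem_closure hc (mem_interior_iff_mem_nhds.1 h0), hK.isClosed.closure_eq]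

theorem gauge_pos_of_ne {K : Set (Euc n)} (hK : IsCompact K) (h0 : (0 : Euc n) ∈ interior K)
    {x : Euc n} (hx : x ≠ 0) : 0 < gauge K x :=
  (gauge_pos (absorbent_nhds_zero (mem_interior_iff_mem_nhds.1 h0))
    (NormedSpace.isVonNBounded_iff ℝ |>.2 hK.isBounded)).2 hx

theorem continuous_gauge' {K : Set (Euc n)} (hc : Convex ℝ K) (h0 : (0 : Euc n) ∈ interior K) :
    Continuous (gauge K) := continuous_gauge hc (mem_interior_iff_mem_nhds.1 h0)

theorem radialFun_zero_eq {L : Set (Euc n)} (hL : IsSymmConvexBody L) (u : Sph n) :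
    radialFun L 0 u = (gauge L (u : Euc n))⁻¹ := by
  have h0 := zero_mem_interior_of_symm hL
  have hg : 0 < gauge L (u : Euc n) :=
    gauge_pos_of_ne hL.isCompact h0 (ne_zero_of_mem_unit_sphere u)
  have : {t : ℝ | 0 ≤ t ∧ (0 : Euc n) + t • (u : Euc n) ∈ L} = Icc 0 (gauge L (u : Euc n))⁻¹ := by
    ext t
    simp only [mem_ofPred_eq, mem_Icc, zero_add, and_congr_right_iff]
    intro ht
    rw [← gauge_le_one_iff hL.isCompact hL.convex h0, gauge_smul_of_nonneg ht, smul_eq_mul,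
      ← le_div_iff₀ hg, one_div]
  rw [radialFun, this, csSup_Icc (inv_nonneg.2 hg.le)]

/-- The density `ρ_L ^ (n + s)` on the sphere. -/
def radialWeight (s : ℝ) (L : Set (Euc n)) (u : Sph n) : ℝ≥0∞ :=
  ENNReal.ofReal (radialFun L 0 u ^ ((n : ℝ) + s))

theorem continuous_radialFun_zero {L : Set (Euc n)} (hL : IsSymmConvexBody L) :
    Continuous (radialFun L 0) := by
  have h0 := zero_mem_interior_of_symm hL
  rw [funext (radialFun_zero_eq hL)]
  exact ((continuous_gauge' hL.convex h0).comp continuous_subtype_val).inv₀ fun u =>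
    (gauge_pos_of_ne hL.isCompact h0 (ne_zero_of_mem_unit_sphere u)).ne'

theorem measurable_radialWeight (s : ℝ) {L : Set (Euc n)} (hL : IsSymmConvexBody L) :
    Measurable (radialWeight s L) :=
  ((continuous_radialFun_zero hL).measurable.pow_const _).ennreal_ofReal

theorem exists_radialWeight_le {s : ℝ} (hs : 0 < s) {L : Set (Euc n)} (hL : IsSymmConvexBody L) :
    ∃ C : ℝ, ∀ u, radialWeight s L u ≤ ENNReal.ofReal C := by
  have hc : Continuous fun u => radialFun L 0 u ^ ((n : ℝ) + s) :=
    (continuous_radialFun_zero hL).rpow_const fun u => Or.inr (by positivity)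
  obtain ⟨C, hC⟩ := (isCompact_range hc).bddAbove
  exact ⟨C, fun u => ENNReal.ofReal_le_ofReal (hC (mem_range_self u))⟩

/-! ### The perimeter as an integral over lines -/

theorem lintegral_Ioi_rpow {s : ℝ} (hs : 0 < s) {c : ℝ} (hc : 0 < c) :
    ∫⁻ r in Ioi c, ENNReal.ofReal (r ^ (-1 - s)) = ENNReal.ofReal (c ^ (-s) / s) := by
  rw [← ofReal_integral_eq_lintegral_ofReal (integrableOn_Ioi_rpow_of_lt (by linarith) hc),
    integral_Ioi_rpow_of_lt (by linarith) hc]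
  · congr 1
    rw [show -1 - s + 1 = -s by ring, div_neg, neg_div, neg_neg]
  · filter_upwards [ae_restrict_mem measurableSet_Ioi] with r hr
    exact Real.rpow_nonneg (hc.trans hr).le _

theorem lintegral_Icc_rpow {s : ℝ} (hs : 0 < s) (hs1 : s < 1) {a b : ℝ} (hab : a ≤ b) :
    ∫⁻ τ in Icc a b, ENNReal.ofReal ((b - τ) ^ (-s) / s) =
      ENNReal.ofReal ((b - a) ^ (1 - s) / (s * (1 - s))) := by
  have hi : IntervalIntegrable (fun τ => (b - τ) ^ (-s) / s) volume a b := by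
    have h := (intervalIntegral.intervalIntegrable_rpow' (a := b - a) (b := 0)
      (show -1 < -s by linarith)).comp_sub_left b
    simp only [sub_sub_cancel, sub_zero] at h
    exact h.div_const _
  rw [Measure.restrict_congr_set Ioc_ae_eq_Icc.symm,
    ← ofReal_integral_eq_lintegral_ofReal ((intervalIntegrable_iff_integrableOn_Ioc_of_le hab).1 hi)]
  · rw [← intervalIntegral.integral_of_le hab, intervalIntegral.integral_div,
      intervalIntegral.integral_comp_sub_left (fun x => x ^ (-s)), integral_rpow (Or.inl (by linarith)),
      sub_self, Real.zero_rpow (by linarith)]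
    congr 1
    rw [show -s + 1 = 1 - s by ring]
    field_simp
    ring
  · filter_upwards [ae_restrict_mem measurableSet_Ioc] with r hr
    exact div_nonneg (Real.rpow_nonneg (by linarith [hr.2]) _) hs.le

/-- The measure on the space of pairs `(u, y)`, thought of as lines through `y` with direction `u`,
in which every line is represented by the segment it spends in `slab u`. -/
def lineMeasure (s : ℝ) (L : Set (Euc n)) : Measure (Sph n × Euc n) :=
  ((((volume : Measure (Euc n)).toSphere).withDensity (radialWeight s L)).prod volume).restrict
    {p | p.2 ∈ slab p.1}

theorem measurableSet_slab_prod : MeasurableSet {p : Sph n × Euc n | p.2 ∈ slab p.1} := by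
  have : IsClosed {p : Sph n × Euc n | p.2 ∈ slab p.1} :=
    isClosed_Icc.preimage (f := fun p : Sph n × Euc n => ⟪(p.1 : Euc n), p.2⟫) (by fun_prop)
  exact this.measurableSet

theorem lintegral_lineMeasure (s : ℝ) {L : Set (Euc n)} (hL : IsSymmConvexBody L)
    {F : Sph n × Euc n → ℝ≥0∞} (hF : Measurable F) :
    ∫⁻ p, F p ∂(lineMeasure s L) =
      ∫⁻ u, radialWeight s L u * (∫⁻ y in slab u, F (u, y))
        ∂((volume : Measure (Euc n)).toSphere) := by
  have hm : Measurable ({p : Sph n × Euc n | p.2 ∈ slab p.1}.indicator F) :=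
    hF.indicator measurableSet_slab_prod
  rw [lineMeasure, ← lintegral_indicator measurableSet_slab_prod, lintegral_prod _ hm.aemeasurable,
    lintegral_withDensity_eq_lintegral_mul _ (measurable_radialWeight s hL)
      hm.lintegral_prod_right']
  refine lintegral_congr fun u => ?_
  rw [Pi.mul_apply, ← lintegral_indicator (measurableSet_slab u)]
  rfl

/-- On a chord with parameters `[a, b]` the point at `τ` leaves `K` for good at distance `b - τ`, by
convexity. The inner integral is thus `(b - τ)^(-s)/s`, and integrating over the chord gives `(b -
a)^(1-s)/(s(1-s))`. -/
theorem lintegral_lintegral_chord {s : ℝ} (hs : 0 < s) (hs1 : s < 1) {K : Set (Euc n)}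
    (hK : IsCompact K) (hc : Convex ℝ K) (u : Sph n) (y : Euc n) :
    ∫⁻ τ : ℝ, K.indicator (fun x => ∫⁻ r in Ioi (0 : ℝ), Kᶜ.indicator
        (fun _ => ENNReal.ofReal (r ^ (-1 - s))) (x + r • (u : Euc n))) (y + τ • (u : Euc n)) =
      ENNReal.ofReal (1 / (s * (1 - s))) * ENNReal.ofReal (chordLen K u y ^ (1 - s)) := by
  by_cases h : Hits K u y
  swap
  · have : ∀ τ : ℝ, y + τ • (u : Euc n) ∉ K := fun τ hτ => h ⟨τ, hτ⟩
    simp [this, chordLen_of_not_hits h, Real.zero_rpow (show 1 - s ≠ 0 by linarith)]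
  have hl := line_eq_Icc hK hc h
  have hab : -topLine K (-u) y ≤ topLine K u y := neg_topLine_neg_le hK (topLine_mem hK h)
  have hmem : ∀ τ : ℝ, y + τ • (u : Euc n) ∈ K ↔ τ ∈ Icc (-topLine K (-u) y) (topLine K u y) :=
    fun τ => by rw [← hl]; rfl
  have e : ∀ τ : ℝ, K.indicator (fun x => ∫⁻ r in Ioi (0 : ℝ), Kᶜ.indicator
        (fun _ => ENNReal.ofReal (r ^ (-1 - s))) (x + r • (u : Euc n))) (y + τ • (u : Euc n)) =
      (Icc (-topLine K (-u) y) (topLine K u y)).indicator (fun τ => ∫⁻ r in Ioi (topLine K u y - τ),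
        ENNReal.ofReal (r ^ (-1 - s))) τ := by
    intro τ
    by_cases hτ : τ ∈ Icc (-topLine K (-u) y) (topLine K u y)
    · rw [indicator_of_mem hτ, indicator_of_mem ((hmem τ).2 hτ),
        ← lintegral_indicator measurableSet_Ioi, ← lintegral_indicator measurableSet_Ioi]
      refine lintegral_congr fun r => ?_
      have h2 : y + τ • (u : Euc n) + r • (u : Euc n) = y + (τ + r) • (u : Euc n) := by
        rw [add_smul, add_assoc]
      by_cases hr : r ∈ Ioi (topLine K u y - τ)
      · have hr0 : r ∈ Ioi (0 : ℝ) := lt_of_le_of_lt (sub_nonneg.2 hτ.2) hr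
        have : y + τ • (u : Euc n) + r • (u : Euc n) ∈ Kᶜ := by
          rw [mem_compl_iff, h2, hmem]
          intro h3
          linarith [h3.2, mem_Ioi.1 hr]
        rw [indicator_of_mem hr, indicator_of_mem hr0, indicator_of_mem this]
      · rw [indicator_of_notMem hr]
        by_cases hr0 : r ∈ Ioi (0 : ℝ)
        · have : y + τ • (u : Euc n) + r • (u : Euc n) ∉ Kᶜ := by
            rw [notMem_compl_iff, h2, hmem]
            exact ⟨by linarith [hτ.1, mem_Ioi.1 hr0], by linarith [notMem_Ioi.1 hr]⟩
          rw [indicator_of_mem hr0, indicator_of_notMem this]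
        · rw [indicator_of_notMem hr0]
    · rw [indicator_of_notMem hτ, indicator_of_notMem (mt (hmem τ).1 hτ)]
  simp_rw [e]
  -- The endpoint `τ = b` is dropped, since there the inner integral would start at `0`, outside the
  -- scope of `lintegral_Ioi_rpow`.
  rw [lintegral_indicator measurableSet_Icc, Measure.restrict_congr_set Ico_ae_eq_Icc.symm,
    setLIntegral_congr_fun (g := fun τ => ENNReal.ofReal ((topLine K u y - τ) ^ (-s) / s))
      measurableSet_Ico (fun τ hτ => lintegral_Ioi_rpow hs (by linarith [hτ.2])),
    Measure.restrict_congr_set Ico_ae_eq_Icc, lintegral_Icc_rpow hs hs1 hab,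
    ← ENNReal.ofReal_mul (by have : 0 < 1 - s := by linarith
                             positivity), chordLen, sub_neg_eq_add]
  congr 1
  ring

/-- Polar coordinates turn the kernel times `r^(n-1)` into `ρ_L(u)^(n+s) r^(-1-s)`. After Tonelli,
the points `y` are collected along lines of direction `u` and each line contributes its chord
integral. -/
theorem fracPerimeter_eq (hn : 1 ≤ n) {s : ℝ} (hs : 0 < s) (hs1 : s < 1) {K L : Set (Euc n)}
    (hK : IsCompact K) (hc : Convex ℝ K) (hL : IsSymmConvexBody L) :
    fracPerimeter s K L = ENNReal.ofReal (1 / (s * (1 - s))) *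
      ∫⁻ p, ENNReal.ofReal (chordLen K p.1 p.2 ^ (1 - s)) ∂(lineMeasure s L) := by
  have h0 := zero_mem_interior_of_symm hL
  have hKm : MeasurableSet K := hK.isClosed.measurableSet
  have hk : Measurable fun x : Euc n => ENNReal.ofReal (1 / gauge L x ^ ((n : ℝ) + s)) :=
    (((continuous_gauge' hL.convex h0).measurable.pow_const _).const_div 1).ennreal_ofReal
  have hgl : Measurable (gauge L) := (continuous_gauge' hL.convex h0).measurable
  set W := radialWeight s L
  -- the inner integral in polar coordinates
  have e1 : ∀ y, ∫⁻ x in Kᶜ, ENNReal.ofReal (1 / gauge L (x - y) ^ ((n : ℝ) + s)) =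
      ∫⁻ u : Sph n, W u * (∫⁻ r in Ioi (0 : ℝ), Kᶜ.indicator
        (fun _ => ENNReal.ofReal (r ^ (-1 - s))) (y + r • (u : Euc n)))
          ∂((volume : Measure (Euc n)).toSphere) := by
    intro y
    rw [← lintegral_indicator hKm.compl, ← lintegral_add_left_eq_self _ y, lintegral_polar hn]
    · refine lintegral_congr fun u => ?_
      have hg : 0 < gauge L (u : Euc n) :=
        gauge_pos_of_ne hL.isCompact h0 (ne_zero_of_mem_unit_sphere u)
      rw [← lintegral_const_mul]
      · refine setLIntegral_congr_fun measurableSet_Ioi fun r hr => ?_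
        have hr : 0 < r := hr
        by_cases hy : y + r • (u : Euc n) ∈ Kᶜ
        · simp only [indicator_of_mem hy, add_sub_cancel_left]
          rw [← ENNReal.ofReal_mul (by rw [gauge_smul_of_nonneg hr.le, smul_eq_mul]; positivity),
            show W u = ENNReal.ofReal (radialFun L 0 u ^ ((n : ℝ) + s)) from rfl,
            radialFun_zero_eq hL, ← ENNReal.ofReal_mul (by positivity), gauge_smul_of_nonneg hr.le,
            smul_eq_mul]
          congr 1
          rw [Real.mul_rpow hr.le hg.le, Real.inv_rpow hg.le, one_div, mul_inv, ← Real.rpow_neg hr.le,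
            mul_right_comm, mul_comm, ← Real.rpow_natCast, ← Real.rpow_add hr]
          congr 2
          rw [Nat.cast_sub hn]; push_cast; ring
        · simp only [indicator_of_notMem hy, zero_mul, mul_zero]
      · exact Measurable.indicator (f := fun r : ℝ => ENNReal.ofReal (r ^ (-1 - s))) (by fun_prop)
          (hKm.compl.preimage (f := fun r : ℝ => y + r • (u : Euc n)) (by fun_prop))
    · exact (Measurable.indicator (hk.comp (measurable_id.sub_const y)) hKm.compl).comp
        (measurable_const_add y)
  have hψ : Measurable fun p : (Sph n × Euc n) × ℝ => Kᶜ.indicator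
        (fun _ => ENNReal.ofReal (p.2 ^ (-1 - s))) (p.1.2 + p.2 • (p.1.1 : Euc n)) :=
    Measurable.indicator (f := fun p : (Sph n × Euc n) × ℝ => ENNReal.ofReal (p.2 ^ (-1 - s)))
      (by fun_prop) (hKm.compl.preimage
        (f := fun p : (Sph n × Euc n) × ℝ => p.1.2 + p.2 • (p.1.1 : Euc n)) (by fun_prop))
  have hφ : Measurable fun p : Sph n × Euc n => ∫⁻ r in Ioi (0 : ℝ), Kᶜ.indicator
        (fun _ => ENNReal.ofReal (r ^ (-1 - s))) (p.2 + r • (p.1 : Euc n)) :=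
    hψ.lintegral_prod_right'
  have hWm : Measurable W := measurable_radialWeight s hL
  rw [fracPerimeter]
  simp_rw [e1]
  rw [lintegral_lintegral_swap (((hWm.comp measurable_snd).mul
    (hφ.comp (f := fun p : Euc n × Sph n => (p.2, p.1)) (by fun_prop))).aemeasurable)]
  rw [← lintegral_const_mul, lintegral_lineMeasure s hL]
  rotate_left
  · exact (((measurable_chordLen hK).pow_const _).ennreal_ofReal).const_mul _
  · exact ((measurable_chordLen hK).pow_const _).ennreal_ofReal
  refine lintegral_congr fun u => ?_
  have hφu : Measurable fun y : Euc n => ∫⁻ r in Ioi (0 : ℝ), Kᶜ.indicator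
        (fun _ => ENNReal.ofReal (r ^ (-1 - s))) (y + r • (u : Euc n)) :=
    hφ.comp measurable_prodMk_left
  rw [lintegral_const_mul _ hφu, ← lintegral_indicator hKm,
    ← setLIntegral_slab_lintegral_line u (hφu.indicator hKm)]
  simp_rw [lintegral_lintegral_chord hs hs1 hK hc]
  rfl

/-! ### Support functions and outer normals -/

theorem isClosed_exists_of_compactSpace {X Y : Type*} [TopologicalSpace X] [TopologicalSpace Y]
    [CompactSpace Y] {F : Set (X × Y)} (hF : IsClosed F) : IsClosed {x | ∃ y, (x, y) ∈ F} := by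
  convert isClosedMap_fst_of_compactSpace _ hF using 1
  ext x
  simp

theorem bddAbove_inner_image {K : Set (Euc n)} (hK : IsCompact K) (v : Euc n) :
    BddAbove ((fun x : Euc n => ⟪v, x⟫) '' K) :=
  (hK.image (by fun_prop)).bddAbove

theorem inner_le_supportFun {K : Set (Euc n)} (hK : IsCompact K) (v : Sph n) {x : Euc n}
    (hx : x ∈ K) : ⟪(v : Euc n), x⟫ ≤ supportFun K v :=
  le_csSup (bddAbove_inner_image hK v) ⟨x, hx, rfl⟩

theorem supportFun_le {K : Set (Euc n)} (hK : K.Nonempty) (v : Sph n) {c : ℝ}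
    (h : ∀ x ∈ K, ⟪(v : Euc n), x⟫ ≤ c) : supportFun K v ≤ c :=
  csSup_le (hK.image _) (by rintro _ ⟨x, hx, rfl⟩; exact h x hx)

theorem continuous_supportFun {K : Set (Euc n)} (hK : IsCompact K) :
    Continuous (supportFun K) :=
  hK.continuous_sSup (f := fun (v : Sph n) (x : Euc n) => ⟪(v : Euc n), x⟫)
    (by simp only [Function.HasUncurry.uncurry]; fun_prop)

/-- `v` is an outer unit normal of `K` at `z`. -/
def IsNormal (K : Set (Euc n)) (v : Sph n) (z : Euc n) : Prop := ⟪(v : Euc n), z⟫ = supportFun K v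

theorem isClosed_isNormal {K : Set (Euc n)} (hK : IsCompact K) :
    IsClosed {p : Euc n × Sph n | IsNormal K p.2 p.1} := by
  have := continuous_supportFun hK
  exact isClosed_eq (by fun_prop) (by fun_prop)

theorem inner_lt_supportFun_of_mem_interior {K : Set (Euc n)} (hK : IsCompact K) (v : Sph n)
    {x : Euc n} (hx : x ∈ interior K) : ⟪(v : Euc n), x⟫ < supportFun K v := by
  have hc : Continuous fun τ : ℝ => x + τ • (v : Euc n) := by fun_prop
  have h : ∀ᶠ τ : ℝ in 𝓝 0, x + τ • (v : Euc n) ∈ interior K :=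
    hc.continuousAt.eventually_mem (isOpen_interior.mem_nhds (by simpa using hx))
  obtain ⟨ε, hε, h⟩ := Metric.eventually_nhds_iff.1 h
  have h1 : x + (ε / 2) • (v : Euc n) ∈ interior K :=
    h (by rw [Real.dist_eq, sub_zero, abs_of_pos (by linarith)]; linarith)
  have h2 := inner_le_supportFun hK v (interior_subset h1)
  rw [inner_add_right, inner_smul_right, inner_self_sphere] at h2
  linarith

theorem frontier_subset_of_isCompact {K : Set (Euc n)} (hK : IsCompact K) : frontier K ⊆ K :=
  hK.isClosed.frontier_subset

theorem IsNormal.inner_pos {K : Set (Euc n)} (hK : IsCompact K) {v : Sph n} {z w : Euc n}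
    (h : IsNormal K v z) {τ : ℝ} (hτ : 0 < τ) (hi : z - τ • w ∈ interior K) :
    0 < ⟪(v : Euc n), w⟫ := by
  have h1 := inner_lt_supportFun_of_mem_interior hK v hi
  rw [← h, inner_sub_right, inner_smul_right] at h1
  by_contra! h2
  nlinarith

/-- Normalise the Riesz representative of `f`. Strictness on the nonempty interior makes it nonzero,
and the inequality passes to `K` by density of the interior. The positive factor is kept so that
signs of `f` can be read as signs of `⟨v,·⟩`. -/
theorem exists_normal_of_functional {K : Set (Euc n)} (hK : IsConvexBody K) {z : Euc n}
    (hz : z ∈ K) {f : Euc n →L[ℝ] ℝ} (hf : ∀ x ∈ interior K, f x < f z) :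
    ∃ (v : Sph n) (c : ℝ), 0 < c ∧ IsNormal K v z ∧ ∀ x, f x = c * ⟪(v : Euc n), x⟫ := by
  set a := (InnerProductSpace.toDual ℝ (Euc n)).symm f
  have ha : ∀ x, f x = ⟪a, x⟫ := fun x => (InnerProductSpace.toDual_symm_apply).symm
  have ha0 : a ≠ 0 := by
    intro h0
    obtain ⟨x, hx⟩ := hK.interior_nonempty
    have := hf x hx
    simp [ha, h0] at this
  have hna : 0 < ‖a‖ := norm_pos_iff.2 ha0
  let v : Sph n := ⟨‖a‖⁻¹ • a, by simp [norm_smul, hna.ne']⟩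
  have hv : ∀ x, f x = ‖a‖ * ⟪(v : Euc n), x⟫ := by
    intro x
    simp only [v, inner_smul_left, ha]
    simp [hna.ne']
  refine ⟨v, ‖a‖, hna, ?_, hv⟩
  refine le_antisymm (inner_le_supportFun hK.isCompact v hz) (supportFun_le ⟨z, hz⟩ v ?_)
  intro x hx
  have hcl : x ∈ closure (interior K) := by
    rw [hK.convex.closure_interior_eq_closure_of_nonempty_interior hK.interior_nonempty]
    exact subset_closure hx
  have : f x ≤ f z := by
    have hsub : closure (interior K) ⊆ {x | f x ≤ f z} :=
      closure_minimal (fun y hy => (hf y hy).le) (isClosed_le f.continuous continuous_const)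
    exact hsub hcl
  rw [hv, hv] at this
  exact le_of_mul_le_mul_left this hna

/-- If the ray from `z ∈ K` with direction `w` misses the interior of `K`, then some normal at `z`
makes an acute angle with `w`. -/
theorem exists_normal_of_ray {K : Set (Euc n)} (hK : IsConvexBody K) {z : Euc n} (hz : z ∈ K)
    (w : Euc n) (h : ∀ τ : ℝ, 0 ≤ τ → z + τ • w ∉ interior K) :
    ∃ v : Sph n, IsNormal K v z ∧ 0 ≤ ⟪(v : Euc n), w⟫ := by
  have hray : Convex ℝ ((fun τ : ℝ => z + τ • w) '' Ici 0) := by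
    have := (convex_Ici (0 : ℝ)).affine_image ((AffineMap.const ℝ ℝ z) +
      ((LinearMap.toSpanSingleton ℝ (Euc n) w).toAffineMap))
    exact this
  have hdis : Disjoint (interior K) ((fun τ : ℝ => z + τ • w) '' Ici 0) := by
    rw [Set.disjoint_right]
    rintro _ ⟨τ, hτ, rfl⟩
    exact h τ hτ
  -- Separate the interior from the ray. As `z` is on the ray and in the closure of the interior,
  -- the separating constant is `f z`, so `f` cannot decrease along the ray.
  obtain ⟨f, c, h1, h2⟩ := geometric_hahn_banach_open hK.convex.interior isOpen_interior hray hdis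
  have hz2 : c ≤ f z := by simpa using h2 _ ⟨0, mem_Ici.2 le_rfl, rfl⟩
  obtain ⟨v, d, hd, hv, hf⟩ := exists_normal_of_functional hK hz
    (f := f) (fun x hx => (h1 x hx).trans_le hz2)
  refine ⟨v, hv, ?_⟩
  by_contra! hneg
  have hz1 : f z ≤ c := by
    have hsub : closure (interior K) ⊆ {x | f x ≤ c} :=
      closure_minimal (fun y hy => (h1 y hy).le) (isClosed_le f.continuous continuous_const)
    rw [hK.convex.closure_interior_eq_closure_of_nonempty_interior hK.interior_nonempty] at hsub
    exact hsub (subset_closure hz)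
  have h3 := h2 _ ⟨1, mem_Ici.2 zero_le_one, rfl⟩
  simp only [one_smul, map_add, hf w] at h3
  nlinarith

theorem exists_normal {K : Set (Euc n)} (hK : IsConvexBody K) {z : Euc n} (hz : z ∈ frontier K) :
    ∃ v : Sph n, IsNormal K v z := by
  obtain ⟨v, hv, _⟩ := exists_normal_of_ray hK (frontier_subset_of_isCompact hK.isCompact hz) 0
    (by simpa using fun _ _ => hz.2)
  exact ⟨v, hv⟩

/-! ### Regular and singular boundary points -/

/-- The regular boundary points: those with exactly one outer unit normal. -/
def regularPoints (K : Set (Euc n)) : Set (Euc n) := {z | z ∈ frontier K ∧ ∃! v : Sph n, IsNormal K v z}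

/-- The singular boundary points: those with at least two outer unit normals. -/
def singularPoints (K : Set (Euc n)) : Set (Euc n) :=
  {z | z ∈ frontier K ∧ ∃ v w : Sph n, IsNormal K v z ∧ IsNormal K w z ∧ v ≠ w}

theorem frontier_diff_singularPoints {K : Set (Euc n)} (hK : IsConvexBody K) :
    frontier K \ singularPoints K = regularPoints K := by
  ext z
  constructor
  · rintro ⟨hz, h⟩
    obtain ⟨v, hv⟩ := exists_normal hK hz
    refine ⟨hz, v, hv, fun w hw => ?_⟩
    by_contra hne
    exact h ⟨hz, w, v, hw, hv, hne⟩
  · rintro ⟨hz, v, hv, huniq⟩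
    refine ⟨hz, ?_⟩
    rintro ⟨_, w, w', hw, hw', hne⟩
    exact hne ((huniq w hw).trans (huniq w' hw').symm)

theorem isClosed_exists_isNormal {K : Set (Euc n)} (hK : IsCompact K) {C : Set (Sph n)}
    (hC : IsClosed C) : IsClosed {z | z ∈ frontier K ∧ ∃ v ∈ C, IsNormal K v z} := by
  have h := isClosed_exists_of_compactSpace ((isClosed_isNormal hK).inter
    (hC.preimage (continuous_snd (X := Euc n) (Y := Sph n))))
  convert (isClosed_frontier (s := K)).inter h using 1
  ext z
  simp [and_comm]

theorem isClosed_exists_isNormal_pair {K : Set (Euc n)} (hK : IsCompact K) {C : Set (Sph n × Sph n)}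
    (hC : IsClosed C) :
    IsClosed {z | z ∈ frontier K ∧ ∃ p ∈ C, IsNormal K p.1 z ∧ IsNormal K p.2 z} := by
  have h1 : IsClosed {q : Euc n × (Sph n × Sph n) | IsNormal K q.2.1 q.1} :=
    (isClosed_isNormal hK).preimage
      (f := fun q : Euc n × (Sph n × Sph n) => (q.1, q.2.1)) (by fun_prop)
  have h2 : IsClosed {q : Euc n × (Sph n × Sph n) | IsNormal K q.2.2 q.1} :=
    (isClosed_isNormal hK).preimage
      (f := fun q : Euc n × (Sph n × Sph n) => (q.1, q.2.2)) (by fun_prop)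
  have h := isClosed_exists_of_compactSpace ((hC.preimage
    (continuous_snd (X := Euc n) (Y := Sph n × Sph n))).inter (h1.inter h2))
  exact (isClosed_frontier (s := K)).inter h

theorem measurableSet_singularPoints {K : Set (Euc n)} (hK : IsCompact K) :
    MeasurableSet (singularPoints K) := by
  -- Distinct normals are at distance at least `1/(k+1)` for some `k`, and this is a closed
  -- condition, unlike `v ≠ w`.
  have : singularPoints K = ⋃ k : ℕ, {z | z ∈ frontier K ∧
      ∃ p ∈ {p : Sph n × Sph n | 1 / ((k : ℝ) + 1) ≤ dist p.1 p.2},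
        IsNormal K p.1 z ∧ IsNormal K p.2 z} := by
    ext z
    simp only [mem_iUnion]
    constructor
    · rintro ⟨hz, v, w, hv, hw, hne⟩
      obtain ⟨k, hk⟩ := exists_nat_one_div_lt (dist_pos.2 hne)
      exact ⟨k, hz, (v, w), hk.le, hv, hw⟩
    · rintro ⟨k, hz, p, hp, hv, hw⟩
      refine ⟨hz, p.1, p.2, hv, hw, fun he => ?_⟩
      have hp : 1 / ((k : ℝ) + 1) ≤ dist p.1 p.2 := hp
      rw [he, dist_self] at hp
      exact absurd hp (not_le.2 Nat.one_div_pos_of_nat)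
  rw [this]
  exact MeasurableSet.iUnion fun k => (isClosed_exists_isNormal_pair hK
    (isClosed_le continuous_const (by fun_prop))).measurableSet

theorem measurableSet_regularPoints {K : Set (Euc n)} (hK : IsConvexBody K) :
    MeasurableSet (regularPoints K) := by
  rw [← frontier_diff_singularPoints hK]
  exact isClosed_frontier.measurableSet.diff (measurableSet_singularPoints hK.isCompact)

open Classical in
/-- The outer unit normal at a regular boundary point (a fixed vector at all other points). -/
def outerNormal [Nonempty (Sph n)] (K : Set (Euc n)) (z : Euc n) : Sph n :=
  if h : z ∈ regularPoints K then h.2.choose else Classical.arbitrary _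

theorem isNormal_outerNormal [Nonempty (Sph n)] {K : Set (Euc n)} {z : Euc n}
    (h : z ∈ regularPoints K) : IsNormal K (outerNormal K z) z := by
  rw [outerNormal, dif_pos h]
  exact h.2.choose_spec.1

theorem IsNormal.eq_outerNormal [Nonempty (Sph n)] {K : Set (Euc n)} {z : Euc n} {v : Sph n}
    (hv : IsNormal K v z) (h : z ∈ regularPoints K) : v = outerNormal K z :=
  h.2.unique hv (isNormal_outerNormal h)

theorem measurable_outerNormal [Nonempty (Sph n)] {K : Set (Euc n)} (hK : IsConvexBody K) :
    Measurable (outerNormal K) := by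
  refine measurable_of_isClosed fun C hC => ?_
  have : outerNormal K ⁻¹' C =
      (regularPoints K ∩ {z | z ∈ frontier K ∧ ∃ v ∈ C, IsNormal K v z}) ∪
        ((regularPoints K)ᶜ ∩ {_z | Classical.arbitrary (Sph n) ∈ C}) := by
    ext z
    by_cases h : z ∈ regularPoints K
    · simp only [mem_preimage, mem_union, mem_inter_iff, h, true_and, mem_compl_iff,
        not_true_eq_false, false_and, or_false]
      constructor
      · exact fun hz => ⟨h.1, _, hz, isNormal_outerNormal h⟩
      · rintro ⟨_, v, hv, hn⟩
        exact hn.eq_outerNormal h ▸ hv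
    · simp only [mem_preimage, mem_union, mem_inter_iff, h, false_and, mem_compl_iff,
        not_false_eq_true, true_and, false_or]
      rw [outerNormal, dif_neg h]; rfl
  rw [this]
  exact ((measurableSet_regularPoints hK).inter
    (isClosed_exists_isNormal hK.isCompact hC).measurableSet).union
      ((measurableSet_regularPoints hK).compl.inter (MeasurableSet.const _))

/-! ### Boundary area against projected volume -/

/-- Here `⟨v, z - z'⟩ ≥ 0 ≥ ⟨v', z - z'⟩`, and replacing `v` or `v'` by `v₀` costs at most `ε |z -
z'|`. A piece of boundary with normals near `v₀` is nearly flat. -/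
theorem abs_inner_sub_le_of_isNormal {K : Set (Euc n)} (hK : IsCompact K) {z z' : Euc n}
    (hz : z ∈ K) (hz' : z' ∈ K) {v v' v₀ : Sph n} (hv : IsNormal K v z) (hv' : IsNormal K v' z')
    {ε : ℝ} (h : dist v v₀ ≤ ε) (h' : dist v' v₀ ≤ ε) :
    |⟪(v₀ : Euc n), z - z'⟫| ≤ ε * dist z z' := by
  have key : ∀ {z z' : Euc n} {v : Sph n}, z' ∈ K → IsNormal K v z → dist v v₀ ≤ ε →
      -(ε * dist z z') ≤ ⟪(v₀ : Euc n), z - z'⟫ := by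
    intro z z' v hz' hv h
    have h1 : 0 ≤ ⟪(v : Euc n), z - z'⟫ := by
      rw [inner_sub_right, hv]; linarith [inner_le_supportFun hK v hz']
    have h2 : ⟪(v : Euc n) - v₀, z - z'⟫ ≤ ε * dist z z' := by
      refine (real_inner_le_norm _ _).trans ?_
      rw [dist_eq_norm z z', ← dist_eq_norm (v : Euc n) v₀]
      exact mul_le_mul_of_nonneg_right h (norm_nonneg _)
    rw [inner_sub_left] at h2
    linarith
  rw [abs_le]
  refine ⟨key hz' hv h, ?_⟩
  have := key hz hv' h'
  rw [dist_comm, ← neg_sub z z', inner_neg_right] at this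
  linarith

/-- The projection changes `z - z'` by `⟨v, z - z'⟩/⟨v,u⟩` times a unit vector, so flatness makes it
almost isometric. -/
theorem dist_obliqueProj {u v : Sph n} (z z' : Euc n) {ε : ℝ}
    (h : |⟪(v : Euc n), z - z'⟫| ≤ ε * dist z z') :
    |dist (obliqueProj (u : Euc n) v z) (obliqueProj (u : Euc n) v z') - dist z z'| ≤
      ε / |⟪(v : Euc n), (u : Euc n)⟫| * dist z z' := by
  have e : obliqueProj (u : Euc n) v z - obliqueProj (u : Euc n) v z' =
      (z - z') - (⟪(v : Euc n), z - z'⟫ / ⟪(v : Euc n), (u : Euc n)⟫) • (u : Euc n) := by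
    simp only [obliqueProj, inner_sub_right, sub_div, sub_smul]; abel
  rw [dist_eq_norm, dist_eq_norm, e]
  refine (abs_norm_sub_norm_le _ _).trans ?_
  rw [sub_sub_cancel_left, norm_neg, norm_smul, norm_eq_of_mem_sphere u, mul_one, Real.norm_eq_abs,
    abs_div, div_mul_eq_mul_div, ← dist_eq_norm]
  exact div_le_div_of_nonneg_right h (abs_nonneg _)

theorem euclideanHausdorffMeasure_image_le {d : ℕ} {A : Set (Euc n)} {Q : Euc n → Euc n} {c : ℝ}
    (hc : 0 ≤ c) (h : ∀ x ∈ A, ∀ y ∈ A, dist (Q x) (Q y) ≤ c * dist x y) :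
    μHE[d] (Q '' A) ≤ ENNReal.ofReal (c ^ d) * μHE[d] A := by
  lift c to NNReal using hc
  have hl : LipschitzOnWith c Q A := LipschitzOnWith.of_dist_le_mul h
  have := hl.hausdorffMeasure_image_le (d := d) (by positivity)
  rw [ENNReal.rpow_natCast] at this
  rw [Measure.euclideanHausdorffMeasure_def, Measure.smul_apply, Measure.smul_apply,
    ENNReal.ofReal_pow (NNReal.coe_nonneg c), mul_smul_comm, ENNReal.ofReal_coe_nnreal]
  exact smul_le_smul_of_nonneg_left this (zero_le)

theorem le_euclideanHausdorffMeasure_image {d : ℕ} {A : Set (Euc n)} {Q : Euc n → Euc n} {c : ℝ}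
    (hc : 0 ≤ c) (h : ∀ x ∈ A, ∀ y ∈ A, dist x y ≤ c * dist (Q x) (Q y)) :
    μHE[d] A ≤ ENNReal.ofReal (c ^ d) * μHE[d] (Q '' A) := by
  have hinj : InjOn Q A := fun x hx y hy hxy => by
    have := h x hx y hy
    rw [hxy, dist_self, mul_zero] at this
    exact dist_le_zero.1 this
  rcases A.eq_empty_or_nonempty with rfl | ⟨a, -⟩
  · simp
  have : Nonempty (Euc n) := ⟨a⟩
  have e : A = Function.invFunOn Q A '' (Q '' A) := by
    rw [hinj.invFunOn_image Subset.rfl]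
  conv_lhs => rw [e]
  refine euclideanHausdorffMeasure_image_le hc ?_
  rintro _ ⟨x, hx, rfl⟩ _ ⟨y, hy, rfl⟩
  rw [hinj.leftInvOn_invFunOn hx, hinj.leftInvOn_invFunOn hy]
  exact h x hx y hy

/-- The last point of `K` on the line through `y` of direction `u`. -/
def topPoint (K : Set (Euc n)) (u : Sph n) (y : Euc n) : Euc n := y + topLine K u y • (u : Euc n)

theorem measurable_topPoint {K : Set (Euc n)} (hK : IsCompact K) :
    Measurable fun p : Sph n × Euc n => topPoint K p.1 p.2 :=
  measurable_snd.add ((measurable_topLine hK).smul (measurable_subtype_coe.comp measurable_fst))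

theorem measurable_topPoint_right {K : Set (Euc n)} (hK : IsCompact K) (u : Sph n) :
    Measurable (topPoint K u) := (measurable_topPoint hK).comp measurable_prodMk_left

theorem measurableSet_hits {K : Set (Euc n)} (hK : IsCompact K) (u : Sph n) :
    MeasurableSet {y | Hits K u y} := ((isClosed_hits hK).preimage
      (f := fun y : Euc n => (u, y)) (by fun_prop)).measurableSet

/-- The measure on the boundary of `K` obtained by projecting the volume of `slab u` along `u`. -/
def topMeasure (K : Set (Euc n)) (u : Sph n) : Measure (Euc n) :=
  ((volume.restrict (slab u)).restrict {y | Hits K u y}).map (topPoint K u)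

theorem topMeasure_apply {K : Set (Euc n)} (hK : IsCompact K) (u : Sph n) {A : Set (Euc n)}
    (hA : MeasurableSet A) :
    topMeasure K u A = volume (slab u ∩ {y | Hits K u y ∧ topPoint K u y ∈ A}) := by
  rw [topMeasure, Measure.map_apply (measurable_topPoint_right hK u) hA,
    Measure.restrict_apply (measurable_topPoint_right hK u hA),
    Measure.restrict_apply ((measurable_topPoint_right hK u hA).inter (measurableSet_hits hK u))]
  congr 1
  ext y
  simp only [mem_inter_iff, mem_preimage, mem_ofPred_eq]
  tauto

/-- The component of `y` orthogonal to `u` is that of a point of `K`, and the component along `u` is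
at most `1/2`. The radius does not depend on `u`, which makes the set of lines meeting `K` of finite
measure. -/
theorem norm_le_of_hits_of_mem_slab {K : Set (Euc n)} {R : ℝ} (hR : ∀ x ∈ K, ‖x‖ ≤ R) {u : Sph n}
    {y : Euc n} (hy : y ∈ slab u) (h : Hits K u y) : ‖y‖ ≤ 2 * R + 1 / 2 := by
  obtain ⟨τ, hτ⟩ := h
  set k := y + τ • (u : Euc n) with hk
  have h1 : y = k - ⟪(u : Euc n), k⟫ • (u : Euc n) + ⟪(u : Euc n), y⟫ • (u : Euc n) := by
    rw [hk, inner_add_right, inner_smul_right, inner_self_sphere, add_smul, mul_one]; abel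
  have h2 : |⟪(u : Euc n), k⟫| ≤ R := by
    refine (abs_real_inner_le_norm _ _).trans ?_
    rw [norm_eq_of_mem_sphere u, one_mul]; exact hR _ hτ
  have h3 : |⟪(u : Euc n), y⟫| ≤ 1 / 2 := abs_le.2 hy
  calc ‖y‖ ≤ ‖k‖ + ‖⟪(u : Euc n), k⟫ • (u : Euc n)‖ + ‖⟪(u : Euc n), y⟫ • (u : Euc n)‖ := by
        conv_lhs => rw [h1]
        exact (norm_add_le _ _).trans (add_le_add_left (norm_sub_le _ _) _)
    _ ≤ R + R + 1 / 2 := by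
        rw [norm_smul, norm_smul, norm_eq_of_mem_sphere u, mul_one, mul_one]
        exact add_le_add (add_le_add (hR _ hτ) h2) h3
    _ = 2 * R + 1 / 2 := by ring

theorem exists_volume_slab_inter_hits_le {K : Set (Euc n)} (hK : IsCompact K) :
    ∃ C : ℝ, 0 ≤ C ∧ ∀ u, volume (slab u ∩ {y | Hits K u y}) ≤ ENNReal.ofReal C := by
  obtain ⟨R, hR⟩ := hK.isBounded.exists_norm_le
  refine ⟨(volume (closedBall (0 : Euc n) (2 * R + 1 / 2))).toReal, ENNReal.toReal_nonneg, fun u => ?_⟩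
  rw [ENNReal.ofReal_toReal measure_closedBall_lt_top.ne]
  refine measure_mono fun y hy => ?_
  rw [mem_closedBall_zero_iff]
  exact norm_le_of_hits_of_mem_slab hR hy.1 hy.2

theorem topMeasure_lt_top {K : Set (Euc n)} (hK : IsCompact K) (u : Sph n) {A : Set (Euc n)}
    (hA : MeasurableSet A) : topMeasure K u A < ∞ := by
  obtain ⟨C, -, hC⟩ := exists_volume_slab_inter_hits_le hK
  rw [topMeasure_apply hK u hA]
  refine (measure_mono ?_).trans_lt ((hC u).trans_lt ENNReal.ofReal_lt_top)
  exact inter_subset_inter_right _ fun y hy => hy.1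

theorem IsNormal.topLine_eq_zero {K : Set (Euc n)} (hK : IsCompact K) {v u : Sph n} {z : Euc n}
    (h : IsNormal K v z) (hz : z ∈ K) (hvu : 0 < ⟪(v : Euc n), (u : Euc n)⟫) :
    topLine K u z = 0 := by
  refine le_antisymm ?_ (le_topLine hK (by simpa using hz))
  have h1 := inner_le_supportFun hK v (topLine_mem hK (hits_of_mem (u := u) hz))
  rw [inner_add_right, inner_smul_right, h] at h1
  by_contra! h2
  nlinarith

/-- If `A` consists of exit points, a line exits through `A` as soon as it meets `A`. The right-hand
side is visibly invariant under translation along `u`. -/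
theorem hits_topPoint_mem_iff {K : Set (Euc n)} (hK : IsCompact K) {u : Sph n} {A : Set (Euc n)}
    (hAK : A ⊆ K) (hA : ∀ z ∈ A, topLine K u z = 0) {y : Euc n} :
    (Hits K u y ∧ topPoint K u y ∈ A) ↔ ∃ τ : ℝ, y + τ • (u : Euc n) ∈ A := by
  constructor
  · rintro ⟨-, h⟩
    exact ⟨_, h⟩
  · rintro ⟨τ, hτ⟩
    have hy : Hits K u y := ⟨τ, hAK hτ⟩
    refine ⟨hy, ?_⟩
    have := topLine_add_smul hK hy τ
    rw [hA _ hτ] at this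
    rw [topPoint, show topLine K u y = τ by linarith]
    exact hτ

/-- A piece of the boundary of `K` whose normals are close to `v` is almost isometric to its
projection along `u` onto the hyperplane orthogonal to `v`. -/
theorem topMeasure_comparison {K : Set (Euc n)} (hK : IsCompact K) {u v₀ : Sph n} {ε : ℝ}
    (hε0 : 0 ≤ ε) (hε : ε < ⟪(v₀ : Euc n), (u : Euc n)⟫) {A : Set (Euc n)} (hAm : MeasurableSet A)
    (hAK : A ⊆ K) (hA : ∀ z ∈ A, ∃ v, IsNormal K v z ∧ dist v v₀ ≤ ε) :
    topMeasure K u A ≤ ENNReal.ofReal (⟪(v₀ : Euc n), (u : Euc n)⟫ *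
        (1 + ε / ⟪(v₀ : Euc n), (u : Euc n)⟫) ^ (n - 1)) * μHE[n - 1] A ∧
    ENNReal.ofReal (⟪(v₀ : Euc n), (u : Euc n)⟫) * μHE[n - 1] A ≤
      ENNReal.ofReal ((1 - ε / ⟪(v₀ : Euc n), (u : Euc n)⟫)⁻¹ ^ (n - 1)) * topMeasure K u A := by
  set c := ⟪(v₀ : Euc n), (u : Euc n)⟫
  have hc : 0 < c := hε0.trans_lt hε
  have hθ0 : 0 ≤ ε / c := by positivity
  have hθ1 : ε / c < 1 := (div_lt_one hc).2 hε
  set Q := obliqueProj (u : Euc n) v₀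
  have htop : ∀ z ∈ A, topLine K u z = 0 := by
    intro z hz
    obtain ⟨v, hv, hd⟩ := hA z hz
    refine hv.topLine_eq_zero hK (hAK hz) ?_
    have : |⟪(v : Euc n) - v₀, (u : Euc n)⟫| ≤ ε := by
      refine (abs_real_inner_le_norm _ _).trans ?_
      rw [norm_eq_of_mem_sphere u, mul_one, ← dist_eq_norm]; exact hd
    rw [inner_sub_left] at this
    linarith [(abs_le.1 this).1]
  have hdist : ∀ x ∈ A, ∀ y ∈ A, |dist (Q x) (Q y) - dist x y| ≤ ε / c * dist x y := by
    intro x hx y hy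
    obtain ⟨v, hv, hd⟩ := hA x hx
    obtain ⟨v', hv', hd'⟩ := hA y hy
    have := dist_obliqueProj (u := u) (v := v₀) x y
      (abs_inner_sub_le_of_isNormal hK (hAK hx) (hAK hy) hv hv' hd hd')
    rwa [abs_of_pos hc] at this
  set B := {y | Hits K u y ∧ topPoint K u y ∈ A}
  have hB : MeasurableSet B := (measurableSet_hits hK u).inter (measurable_topPoint_right hK u hAm)
  have hBmem : ∀ y, y ∈ B ↔ ∃ τ : ℝ, y + τ • (u : Euc n) ∈ A := fun y =>
    hits_topPoint_mem_iff hK hAK htop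
  -- `B` is a union of lines of direction `u`, and its section by the hyperplane orthogonal to `v₀`
  -- is `Q '' A`. Its volume in the slab is therefore `c` times the area of `Q '' A`.
  have hQB : Q ⁻¹' B = B := by
    ext y
    have e : ∀ τ : ℝ, Q y + τ • (u : Euc n) =
        y + (τ - ⟪(v₀ : Euc n), y⟫ / ⟪(v₀ : Euc n), (u : Euc n)⟫) • (u : Euc n) := by
      intro τ; simp only [Q, obliqueProj, sub_smul]; abel
    rw [mem_preimage, hBmem, hBmem]
    constructor
    · rintro ⟨τ, h⟩
      exact ⟨_, e τ ▸ h⟩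
    · rintro ⟨τ, h⟩
      refine ⟨τ + ⟪(v₀ : Euc n), y⟫ / ⟪(v₀ : Euc n), (u : Euc n)⟫, ?_⟩
      rwa [e, add_sub_cancel_right]
  have hQA : B ∩ {y | ⟪(v₀ : Euc n), y⟫ = 0} = Q '' A := by
    ext y
    constructor
    · rintro ⟨h1, h2⟩
      obtain ⟨τ, h1⟩ := (hBmem y).1 h1
      refine ⟨_, h1, ?_⟩
      simp only [Q]
      rw [obliqueProj_add_smul hc.ne', obliqueProj, show ⟪(v₀ : Euc n), y⟫ = 0 from h2]
      simp
    · rintro ⟨z, hz, rfl⟩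
      refine ⟨?_, inner_obliqueProj hc.ne' z⟩
      rw [← mem_preimage, hQB, hBmem]
      exact ⟨0, by simpa using hz⟩
  have hmeas : topMeasure K u A = ENNReal.ofReal c * μHE[n - 1] (Q '' A) := by
    rw [topMeasure_apply hK u hAm, ← hQA]
    change volume (slab u ∩ B) = _
    have := volume_slab_inter_preimage_obliqueProj (u := u) (v := v₀) hc.ne' hB
    rw [abs_of_pos (show 0 < ⟪(v₀ : Euc n), (u : Euc n)⟫ from hc)] at this
    change volume (slab u ∩ Q ⁻¹' B) = _ at this
    rwa [hQB] at this
  rw [hmeas]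
  constructor
  · have := euclideanHausdorffMeasure_image_le (d := n - 1) (A := A) (Q := Q) (c := 1 + ε / c)
      (by positivity) fun x hx y hy => by
        have := (abs_le.1 (hdist x hx y hy)).2
        linarith
    rw [ENNReal.ofReal_mul hc.le, mul_assoc]
    gcongr
  · have h1 : 0 < 1 - ε / c := by linarith
    have := le_euclideanHausdorffMeasure_image (d := n - 1) (A := A) (Q := Q)
      (c := (1 - ε / c)⁻¹) (by positivity) fun x hx y hy => by
        have := (abs_le.1 (hdist x hx y hy)).1
        rw [inv_mul_eq_div, le_div_iff₀ h1]
        linarith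
    rw [mul_left_comm]
    gcongr

/-- Finitely many balls of radius `1/2` cover the sphere of normals. The piece with normals near `v`
is projected along `v` itself, where the cosine is `1` and the comparison applies with `ε = 1/2`. -/
theorem euclideanHausdorffMeasure_frontier_lt_top {K : Set (Euc n)} (hK : IsConvexBody K) :
    μHE[n - 1] (frontier K) < ∞ := by
  obtain ⟨t, -, ht⟩ := (isCompact_univ (X := Sph n)).elim_nhds_subcover
    (fun v => closedBall v (1 / 2)) fun v _ => closedBall_mem_nhds v (by norm_num)
  have hsub : frontier K ⊆ ⋃ v ∈ t, {z | z ∈ frontier K ∧ ∃ w ∈ closedBall v (1 / 2),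
      IsNormal K w z} := by
    intro z hz
    obtain ⟨w, hw⟩ := exists_normal hK hz
    obtain ⟨v, hv, hwv⟩ := mem_iUnion₂.1 (ht (mem_univ w))
    exact mem_iUnion₂.2 ⟨v, hv, hz, w, hwv, hw⟩
  refine (measure_mono hsub).trans_lt ((measure_biUnion_finset_le _ _).trans_lt ?_)
  refine ENNReal.sum_lt_top.2 fun v _ => ?_
  have hm := (isClosed_exists_isNormal hK.isCompact
    (isClosed_closedBall (x := v) (ε := 1 / 2))).measurableSet
  have h := (topMeasure_comparison hK.isCompact (u := v) (v₀ := v) (ε := 1 / 2) (by norm_num)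
    (by rw [inner_self_sphere]; norm_num) hm
    (fun z hz => frontier_subset_of_isCompact hK.isCompact hz.1)
    (fun z hz => by
      obtain ⟨_, w, hw, hn⟩ := hz
      exact ⟨w, hn, hw⟩)).2
  rw [inner_self_sphere, ENNReal.ofReal_one, one_mul] at h
  exact h.trans_lt (ENNReal.mul_lt_top ENNReal.ofReal_lt_top (topMeasure_lt_top hK.isCompact v hm))

/-! ### Singular points have area zero -/

/-- The height above the supporting hyperplanes of `K` with normals making an angle with `u` whose
cosine is at least `c`, measured along `u`. -/
def capHeight (K : Set (Euc n)) (u : Sph n) (c : ℝ) (x : Euc n) : ℝ :=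
  sSup ((fun v : Sph n => (⟪(v : Euc n), x⟫ - supportFun K v) / ⟪(v : Euc n), (u : Euc n)⟫) ''
    {v | c ≤ ⟪(v : Euc n), (u : Euc n)⟫})

theorem bddAbove_capHeight {K : Set (Euc n)} (hK : IsCompact K) (u : Sph n) {c : ℝ} (hc : 0 < c)
    (x : Euc n) :
    BddAbove ((fun v : Sph n => (⟪(v : Euc n), x⟫ - supportFun K v) / ⟪(v : Euc n), (u : Euc n)⟫) ''
      {v | c ≤ ⟪(v : Euc n), (u : Euc n)⟫}) := by
  have hcl : IsClosed {v : Sph n | c ≤ ⟪(v : Euc n), (u : Euc n)⟫} :=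
    isClosed_le continuous_const (by fun_prop)
  refine (hcl.isCompact.image_of_continuousOn ?_).bddAbove
  have := continuous_supportFun hK
  exact ContinuousOn.div (by fun_prop) (by fun_prop) fun v hv => (hc.trans_le hv).ne'

theorem lipschitzWith_capHeight {K : Set (Euc n)} (hK : IsCompact K) (u : Sph n) {c : ℝ}
    (hc : 0 < c) (hc1 : c ≤ 1) : LipschitzWith ⟨c⁻¹, by positivity⟩ (capHeight K u c) := by
  refine LipschitzWith.of_le_add_mul _ fun x y => ?_
  -- The assumption `c ≤ 1` puts `u` itself in the index set, so the supremum is over a nonempty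
  -- set.
  refine csSup_le ⟨_, u, by simpa [inner_self_sphere] using hc1, rfl⟩ ?_
  rintro _ ⟨v, hv, rfl⟩
  have hv : c ≤ ⟪(v : Euc n), (u : Euc n)⟫ := hv
  have hv0 : 0 < ⟪(v : Euc n), (u : Euc n)⟫ := hc.trans_le hv
  have h1 : (⟪(v : Euc n), y⟫ - supportFun K v) / ⟪(v : Euc n), (u : Euc n)⟫ ≤ capHeight K u c y :=
    le_csSup (bddAbove_capHeight hK u hc y) ⟨v, hv, rfl⟩
  have h2 : (⟪(v : Euc n), x⟫ - supportFun K v) / ⟪(v : Euc n), (u : Euc n)⟫ =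
      (⟪(v : Euc n), y⟫ - supportFun K v) / ⟪(v : Euc n), (u : Euc n)⟫ +
        ⟪(v : Euc n), x - y⟫ / ⟪(v : Euc n), (u : Euc n)⟫ := by
    rw [inner_sub_right]; ring
  have h3 : ⟪(v : Euc n), x - y⟫ / ⟪(v : Euc n), (u : Euc n)⟫ ≤ c⁻¹ * dist x y := by
    rw [inv_mul_eq_div]
    have : ⟪(v : Euc n), x - y⟫ ≤ dist x y := by
      refine (real_inner_le_norm _ _).trans ?_
      rw [norm_eq_of_mem_sphere v, one_mul, dist_eq_norm]
    exact div_le_div₀ dist_nonneg this hc hv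
  change _ ≤ capHeight K u c y + c⁻¹ * dist x y
  simp only [h2]
  exact add_le_add h1 h3

/-- The affine functions belonging to `v` and to `w` both touch the supremum from below at `y`, with
common value `-τ`. A derivative would equal both gradients, making the unit vectors `v` and `w`
positive multiples of each other. -/
theorem not_differentiableAt_capHeight {K : Set (Euc n)} (hK : IsCompact K) {u : Sph n} {c : ℝ}
    (hc : 0 < c) {y : Euc n} {τ : ℝ} (hz : y + τ • (u : Euc n) ∈ K) {v w : Sph n}
    (hv : IsNormal K v (y + τ • (u : Euc n))) (hw : IsNormal K w (y + τ • (u : Euc n)))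
    (hvu : c ≤ ⟪(v : Euc n), (u : Euc n)⟫) (hwu : c ≤ ⟪(w : Euc n), (u : Euc n)⟫) (hne : v ≠ w) :
    ¬ DifferentiableAt ℝ (capHeight K u c) y := by
  intro hd
  have hval : ∀ v : Sph n, c ≤ ⟪(v : Euc n), (u : Euc n)⟫ →
      (⟪(v : Euc n), y⟫ - supportFun K v) / ⟪(v : Euc n), (u : Euc n)⟫ ≤ -τ := by
    intro v hv
    rw [div_le_iff₀ (hc.trans_le hv)]
    have := inner_le_supportFun hK v hz
    rw [inner_add_right, inner_smul_right] at this
    linarith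
  have hle : capHeight K u c y ≤ -τ := by
    refine csSup_le ⟨_, v, hvu, rfl⟩ ?_
    rintro _ ⟨v, hv, rfl⟩
    exact hval v hv
  have key : ∀ v : Sph n, IsNormal K v (y + τ • (u : Euc n)) → c ≤ ⟪(v : Euc n), (u : Euc n)⟫ →
      ∀ x, fderiv ℝ (capHeight K u c) y x = ⟪(v : Euc n), x⟫ / ⟪(v : Euc n), (u : Euc n)⟫ := by
    intro v hv hvu x
    have hv0 : 0 < ⟪(v : Euc n), (u : Euc n)⟫ := hc.trans_le hvu
    have hvy : (⟪(v : Euc n), y⟫ - supportFun K v) / ⟪(v : Euc n), (u : Euc n)⟫ = -τ := by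
      rw [div_eq_iff hv0.ne', ← hv, inner_add_right, inner_smul_right]; ring
    set a : Euc n → ℝ :=
      fun x => (⟪(v : Euc n), x⟫ - supportFun K v) / ⟪(v : Euc n), (u : Euc n)⟫
    have ha : HasFDerivAt a ((⟪(v : Euc n), (u : Euc n)⟫)⁻¹ • innerSL ℝ (v : Euc n)) y := by
      have h1 : HasFDerivAt (fun x : Euc n => ⟪(v : Euc n), x⟫ - supportFun K v)
        (innerSL ℝ (v : Euc n)) y := (innerSL ℝ (v : Euc n)).hasFDerivAt.sub_const _
      have h2 := h1.const_mul (⟪(v : Euc n), (u : Euc n)⟫)⁻¹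
      have h3 : a = fun x => (⟪(v : Euc n), (u : Euc n)⟫)⁻¹ * (⟪(v : Euc n), x⟫ - supportFun K v) := by
        ext x; simp only [a, div_eq_inv_mul]
      rw [h3]
      exact h2
    have hmin : IsLocalMin (fun x => capHeight K u c x - a x) y := by
      refine Eventually.of_forall fun x => ?_
      have h1 : a x ≤ capHeight K u c x := le_csSup (bddAbove_capHeight hK u hc x) ⟨v, hvu, rfl⟩
      change capHeight K u c y - a y ≤ capHeight K u c x - a x
      have : a y = -τ := hvy
      linarith
    have := hmin.hasFDerivAt_eq_zero (hd.hasFDerivAt.sub ha)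
    have h3 := congrArg (fun g : Euc n →L[ℝ] ℝ => g x) this
    simp only [sub_apply, smul_apply, innerSL_apply_apply, zero_apply, smul_eq_mul] at h3
    rw [div_eq_inv_mul]; linarith
  have hvpos : 0 < ⟪(v : Euc n), (u : Euc n)⟫ := hc.trans_le hvu
  have hwpos : 0 < ⟪(w : Euc n), (u : Euc n)⟫ := hc.trans_le hwu
  have heq : (⟪(v : Euc n), (u : Euc n)⟫)⁻¹ • (v : Euc n) =
      (⟪(w : Euc n), (u : Euc n)⟫)⁻¹ • (w : Euc n) := by
    refine ext_inner_right ℝ fun x => ?_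
    rw [inner_smul_left, inner_smul_left]
    have := (key v hv hvu x).symm.trans (key w hw hwu x)
    simpa [div_eq_inv_mul] using this
  have hnorm := congrArg norm heq
  rw [norm_smul, norm_smul, norm_eq_of_mem_sphere v, norm_eq_of_mem_sphere w, mul_one, mul_one,
    Real.norm_of_nonneg (inv_nonneg.2 hvpos.le), Real.norm_of_nonneg (inv_nonneg.2 hwpos.le)] at hnorm
  rw [hnorm] at heq
  exact hne (Subtype.ext (smul_right_injective _ (inv_ne_zero hwpos.ne') heq))

theorem dist_inner_sphere_le (v w u : Sph n) :
    |⟪(v : Euc n), (u : Euc n)⟫ - ⟪(w : Euc n), (u : Euc n)⟫| ≤ dist v w := by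
  rw [← inner_sub_left]
  refine (abs_real_inner_le_norm _ _).trans ?_
  rw [norm_eq_of_mem_sphere u, mul_one, ← dist_eq_norm]; exact le_rfl

/-- Two normals at one point are never opposite, so some direction makes acute angles with both.
Along it, singular points project into the set where a Lipschitz function is not differentiable,
which is null by Rademacher's theorem; `topMeasure_comparison` carries nullness back to area. -/
theorem euclideanHausdorffMeasure_singularPoints {K : Set (Euc n)} (hK : IsConvexBody K) :
    μHE[n - 1] (singularPoints K) = 0 := by
  rcases isEmpty_or_nonempty (Sph n) with hem | hne
  · convert measure_empty (μ := (μHE[n - 1] : Measure (Euc n)))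
    ext z
    simp only [mem_empty_iff_false, iff_false]
    rintro ⟨_, v, _⟩
    exact hem.elim v
  set D := TopologicalSpace.denseSeq (Sph n)
  have hD : DenseRange D := TopologicalSpace.denseRange_denseSeq _
  set ε : ℕ → ℝ := fun k => 1 / ((k : ℝ) + 1)
  have hε : ∀ k, 0 < ε k := fun k => Nat.one_div_pos_of_nat
  -- Countable reduction: `D i` approximates the first normal and `D j` is the direction of
  -- projection. The constant `3` leaves `⟨D i, D j⟩ ≥ 2 ε k`, more than the `ε k` required for the
  -- comparison.
  set C : ℕ → ℕ → ℕ → Set (Sph n × Sph n) := fun i j k =>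
    {p | dist p.1 (D i) ≤ ε k ∧ 3 * ε k ≤ ⟪(p.1 : Euc n), (D j : Euc n)⟫ ∧
      3 * ε k ≤ ⟪(p.2 : Euc n), (D j : Euc n)⟫ ∧ ε k ≤ dist p.1 p.2}
  have hC : ∀ i j k, IsClosed (C i j k) := fun i j k => by
    have h1 : IsClosed {p : Sph n × Sph n | dist p.1 (D i) ≤ ε k} :=
      isClosed_le (by fun_prop) continuous_const
    have h2 : IsClosed {p : Sph n × Sph n | 3 * ε k ≤ ⟪(p.1 : Euc n), (D j : Euc n)⟫} :=
      isClosed_le continuous_const (by fun_prop)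
    have h3 : IsClosed {p : Sph n × Sph n | 3 * ε k ≤ ⟪(p.2 : Euc n), (D j : Euc n)⟫} :=
      isClosed_le continuous_const (by fun_prop)
    have h4 : IsClosed {p : Sph n × Sph n | ε k ≤ dist p.1 p.2} :=
      isClosed_le continuous_const (by fun_prop)
    exact h1.inter (h2.inter (h3.inter h4))
  set A : ℕ → ℕ → ℕ → Set (Euc n) := fun i j k =>
    {z | z ∈ frontier K ∧ ∃ p ∈ C i j k, IsNormal K p.1 z ∧ IsNormal K p.2 z}
  have hsub : singularPoints K ⊆ ⋃ i, ⋃ j, ⋃ k, A i j k := by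
    rintro z ⟨hz, v, w, hv, hw, hvw⟩
    -- Opposite normals would confine `K` to a hyperplane, against the nonempty interior. Hence the
    -- bisector `m` below exists and makes acute angles with both.
    have hvw0 : (v : Euc n) + w ≠ 0 := by
      intro h0
      obtain ⟨x, hx⟩ := hK.interior_nonempty
      have h1 := inner_lt_supportFun_of_mem_interior hK.isCompact v hx
      have h2 := inner_lt_supportFun_of_mem_interior hK.isCompact w hx
      rw [← hv] at h1
      rw [← hw, eq_neg_of_add_eq_zero_right h0, inner_neg_left, inner_neg_left] at h2
      linarith
    have hnp : 0 < ‖(v : Euc n) + w‖ := norm_pos_iff.2 hvw0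
    let m : Sph n := ⟨‖(v : Euc n) + w‖⁻¹ • ((v : Euc n) + w), by
      rw [mem_sphere_zero_iff_norm, norm_smul, norm_inv, norm_norm, inv_mul_cancel₀ hnp.ne']⟩
    have hvw1 : ⟪(v : Euc n), (w : Euc n)⟫ ≠ -1 := by
      intro h
      have : ‖(v : Euc n) + w‖ ^ 2 = 0 := by
        rw [norm_add_sq_real, h, norm_eq_of_mem_sphere v, norm_eq_of_mem_sphere w]; norm_num
      exact hnp.ne' (pow_eq_zero_iff two_ne_zero |>.1 this)
    have hvw2 : -1 < ⟪(v : Euc n), (w : Euc n)⟫ := by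
      refine lt_of_le_of_ne ?_ (Ne.symm hvw1)
      have := (abs_le.1 (abs_real_inner_le_norm (v : Euc n) (w : Euc n))).1
      rwa [norm_eq_of_mem_sphere v, norm_eq_of_mem_sphere w, mul_one] at this
    have hvm : 0 < ⟪(v : Euc n), (m : Euc n)⟫ := by
      simp only [m, inner_smul_right, inner_add_right, inner_self_sphere]
      exact mul_pos (inv_pos.2 hnp) (by linarith)
    have hwm : 0 < ⟪(w : Euc n), (m : Euc n)⟫ := by
      simp only [m, inner_smul_right, inner_add_right, inner_self_sphere, real_inner_comm (v : Euc n)]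
      exact mul_pos (inv_pos.2 hnp) (by linarith)
    obtain ⟨j, hj1, hj2⟩ : ∃ j, 0 < ⟪(v : Euc n), (D j : Euc n)⟫ ∧
        0 < ⟪(w : Euc n), (D j : Euc n)⟫ := by
      have ho : IsOpen {x : Sph n | 0 < ⟪(v : Euc n), (x : Euc n)⟫ ∧ 0 < ⟪(w : Euc n), (x : Euc n)⟫} := by
        have h1 : IsOpen {x : Sph n | 0 < ⟪(v : Euc n), (x : Euc n)⟫} :=
          isOpen_lt continuous_const (by fun_prop)
        have h2 : IsOpen {x : Sph n | 0 < ⟪(w : Euc n), (x : Euc n)⟫} :=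
          isOpen_lt continuous_const (by fun_prop)
        exact h1.inter h2
      exact hD.exists_mem_open ho ⟨m, hvm, hwm⟩
    have hmin : 0 < min (dist v w) (min (⟪(v : Euc n), (D j : Euc n)⟫ / 3)
        (⟪(w : Euc n), (D j : Euc n)⟫ / 3)) :=
      lt_min (dist_pos.2 hvw) (lt_min (by linarith) (by linarith))
    obtain ⟨k, hk⟩ := exists_nat_one_div_lt hmin
    obtain ⟨hk1, hk2, hk3⟩ := by simpa only [lt_min_iff] using hk
    obtain ⟨i, hi⟩ := hD.exists_dist_lt v (hε k)
    simp only [mem_iUnion]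
    refine ⟨i, j, k, hz, (v, w), ⟨hi.le, ?_, ?_, hk1.le⟩, hv, hw⟩
    · have : ε k < ⟪(v : Euc n), (D j : Euc n)⟫ / 3 := hk2
      linarith
    · have : ε k < ⟪(w : Euc n), (D j : Euc n)⟫ / 3 := hk3
      linarith
  refine measure_mono_null hsub ?_
  refine measure_iUnion_null fun i => measure_iUnion_null fun j => measure_iUnion_null fun k => ?_
  rcases (A i j k).eq_empty_or_nonempty with he | ⟨z₀, hz₀, p₀, hp₀, -⟩
  · rw [he, measure_empty]
  have hAm : MeasurableSet (A i j k) :=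
    (isClosed_exists_isNormal_pair hK.isCompact (hC i j k)).measurableSet
  have hAK : A i j k ⊆ K := fun z hz => frontier_subset_of_isCompact hK.isCompact hz.1
  have hij : ε k < ⟪(D i : Euc n), (D j : Euc n)⟫ := by
    have h1 := (abs_le.1 (dist_inner_sphere_le p₀.1 (D i) (D j))).2
    have h2 := hp₀.1
    have h3 := hp₀.2.1
    have := hε k
    linarith
  have hle1 : 3 * ε k ≤ 1 := by
    refine hp₀.2.1.trans ((real_inner_le_norm _ _).trans ?_)
    rw [norm_eq_of_mem_sphere, norm_eq_of_mem_sphere, one_mul]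
  have h3 : 0 < 3 * ε k := by have := hε k; linarith
  have hcomp := (topMeasure_comparison hK.isCompact (hε k).le hij hAm hAK (fun z hz => by
    obtain ⟨_, p, hp, hn, _⟩ := hz
    exact ⟨p.1, hn, hp.1⟩)).2
  have hzero : topMeasure K (D j) (A i j k) = 0 := by
    rw [topMeasure_apply hK.isCompact _ hAm]
    have hae := (lipschitzWith_capHeight hK.isCompact (D j) h3 hle1).ae_differentiableAt
      (μ := (volume : Measure (Euc n)))
    refine measure_mono_null ?_ (ae_iff.1 hae)
    rintro y ⟨-, -, hy⟩
    obtain ⟨p, hp, hn1, hn2⟩ := hy.2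
    refine not_differentiableAt_capHeight hK.isCompact h3 (hAK hy) hn1 hn2 hp.2.1 hp.2.2.1 ?_
    intro he
    have := hp.2.2.2
    rw [he, dist_self] at this
    linarith [hε k]
  rw [hzero, mul_zero, nonpos_iff_eq_zero, mul_eq_zero] at hcomp
  refine hcomp.resolve_left ?_
  rw [ENNReal.ofReal_eq_zero, not_le]
  exact (hε k).trans hij

/-! ### The cosine formula for projections of the boundary -/

/-- Countably many of the neighbourhoods cover `V`, so `A` splits into countably many disjoint
pieces on which the inequality is known. It globalises comparisons valid only when the normal stays
in a small ball. -/
theorem measure_le_of_locally_le {X Y : Type*} [MeasurableSpace X] [TopologicalSpace Y]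
    [SecondCountableTopology Y] [MeasurableSpace Y] [OpensMeasurableSpace Y] {μ₁ μ₂ : Measure X}
    {g : X → Y} (hg : Measurable g) {Z : Set X} {V : Set Y} (hZV : ∀ z ∈ Z, g z ∈ V)
    (h : ∀ v ∈ V, ∃ U ∈ 𝓝 v, ∀ A, MeasurableSet A → A ⊆ Z → A ⊆ g ⁻¹' U → μ₁ A ≤ μ₂ A)
    {A : Set X} (hA : MeasurableSet A) (hAZ : A ⊆ Z) : μ₁ A ≤ μ₂ A := by
  choose! U hU hUA using h
  obtain ⟨t, htV, htc, ht⟩ := TopologicalSpace.countable_cover_nhdsWithin (s := V)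
    (f := fun v => interior (U v)) fun v hv => mem_nhdsWithin_of_mem_nhds (interior_mem_nhds.2 (hU v hv))
  rcases t.eq_empty_or_nonempty with rfl | htne
  · have : A = ∅ := by
      refine eq_empty_of_forall_notMem fun x hx => ?_
      simpa using ht (hZV x (hAZ hx))
    simp [this]
  obtain ⟨e, he⟩ := htc.exists_eq_range htne
  set B : ℕ → Set X := fun i => A ∩ g ⁻¹' interior (U (e i))
  have hB : ∀ i, MeasurableSet (B i) := fun i => hA.inter (hg isOpen_interior.measurableSet)
  have hAB : A = ⋃ i, disjointed B i := by
    rw [iUnion_disjointed]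
    refine Subset.antisymm (fun x hx => ?_) (iUnion_subset fun i => inter_subset_left)
    obtain ⟨v, hv, hxv⟩ := mem_iUnion₂.1 (ht (hZV x (hAZ hx)))
    rw [he] at hv
    obtain ⟨i, rfl⟩ := hv
    exact mem_iUnion.2 ⟨i, hx, hxv⟩
  have hdm : ∀ i, MeasurableSet (disjointed B i) := fun i => MeasurableSet.disjointed hB i
  rw [hAB, measure_iUnion (disjoint_disjointed B) hdm, measure_iUnion (disjoint_disjointed B) hdm]
  refine ENNReal.tsum_le_tsum fun i => ?_
  have hsub : disjointed B i ⊆ B i := disjointed_subset B i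
  have hei : e i ∈ V := htV (he ▸ mem_range_self i)
  exact hUA (e i) hei _ (hdm i) (hsub.trans (inter_subset_left.trans hAZ))
    (hsub.trans (inter_subset_right.trans (preimage_mono interior_subset)))

/-- The points whose line meets the interior form an open convex set. Grazing lines lie in its
frontier, and the frontier of a convex set is null. -/
theorem volume_hits_not_hits_interior {K : Set (Euc n)} (hK : IsConvexBody K) (u : Sph n) :
    volume {y | Hits K u y ∧ ¬ Hits (interior K) u y} = 0 := by
  set O : Set (Euc n) := {y | Hits (interior K) u y}
  have hO : IsOpen O := (isOpen_hits isOpen_interior).preimage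
    (f := fun y : Euc n => (u, y)) (by fun_prop)
  have hOc : Convex ℝ O := by
    rintro x ⟨τ, hτ⟩ y ⟨σ, hσ⟩ a b ha hb hab
    refine ⟨a * τ + b * σ, ?_⟩
    have := hK.convex.interior hτ hσ ha hb hab
    convert this using 1
    simp only [smul_add, add_smul, mul_smul]
    abel
  refine measure_mono_null ?_ (hOc.addHaar_frontier volume)
  rintro y ⟨⟨τ, hτ⟩, hy⟩
  refine ⟨?_, fun h => hy (interior_subset (s := O) h)⟩
  have hcl : y + τ • (u : Euc n) ∈ closure (interior K) := by
    rw [hK.convex.closure_interior_eq_closure_of_nonempty_interior hK.interior_nonempty]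
    exact subset_closure hτ
  have := map_mem_closure (f := fun x : Euc n => x - τ • (u : Euc n)) (by fun_prop) hcl
    (t := O) fun x hx => ⟨τ, by simpa using hx⟩
  simpa using this

theorem topPoint_mem_frontier {K : Set (Euc n)} (hK : IsCompact K) {u : Sph n} {y : Euc n}
    (h : Hits K u y) : topPoint K u y ∈ frontier K := by
  refine ⟨subset_closure (topLine_mem hK h), fun hi => ?_⟩
  have hc : Continuous fun τ : ℝ => y + τ • (u : Euc n) := by fun_prop
  have h1 : ∀ᶠ τ : ℝ in 𝓝 (topLine K u y), y + τ • (u : Euc n) ∈ interior K :=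
    hc.continuousAt.eventually_mem (isOpen_interior.mem_nhds hi)
  obtain ⟨ε, hε, h1⟩ := Metric.eventually_nhds_iff.1 h1
  have h2 : y + (topLine K u y + ε / 2) • (u : Euc n) ∈ interior K :=
    h1 (by rw [Real.dist_eq, add_sub_cancel_left, abs_of_pos (by linarith)]; linarith)
  linarith [le_topLine hK (interior_subset h2)]

theorem IsNormal.inner_pos_of_hits {K : Set (Euc n)} (hK : IsCompact K) {u : Sph n} {y : Euc n}
    (h : Hits (interior K) u y) {v : Sph n} (hv : IsNormal K v (topPoint K u y)) :
    0 < ⟪(v : Euc n), (u : Euc n)⟫ := by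
  have hy : Hits K u y := h.mono interior_subset
  obtain ⟨τ, hτ⟩ := h
  have h1 : τ ≤ topLine K u y := le_topLine hK (interior_subset hτ)
  have h2 : τ ≠ topLine K u y := by
    rintro rfl
    exact (topPoint_mem_frontier hK hy).2 hτ
  refine hv.inner_pos hK (τ := topLine K u y - τ) (sub_pos.2 (lt_of_le_of_ne h1 h2)) ?_
  convert hτ using 1
  simp only [topPoint, sub_smul]
  abel

/-- The other half of `topMeasure_comparison` transfers nullness from area to projected volume.
Passing through the interior forces an acute angle at the exit point, as the comparison demands. -/
theorem topMeasure_singularPoints {K : Set (Euc n)} (hK : IsConvexBody K) (u : Sph n) :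
    volume {y | y ∈ slab u ∧ Hits (interior K) u y ∧ topPoint K u y ∈ singularPoints K} = 0 := by
  have : Nonempty (Sph n) := ⟨u⟩
  set D := TopologicalSpace.denseSeq (Sph n)
  have hD : DenseRange D := TopologicalSpace.denseRange_denseSeq _
  set ε : ℕ → ℝ := fun k => 1 / ((k : ℝ) + 1)
  have hε : ∀ k, 0 < ε k := fun k => Nat.one_div_pos_of_nat
  set S : ℕ → ℕ → Set (Euc n) := fun i k =>
    singularPoints K ∩ {z | z ∈ frontier K ∧ ∃ v ∈ closedBall (D i) (ε k), IsNormal K v z}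
  have hS : ∀ i k, MeasurableSet (S i k) := fun i k =>
    (measurableSet_singularPoints hK.isCompact).inter
      (isClosed_exists_isNormal hK.isCompact isClosed_closedBall).measurableSet
  have hzero : ∀ i k, ε k < ⟪(D i : Euc n), (u : Euc n)⟫ → topMeasure K u (S i k) = 0 := by
    intro i k hik
    have h := (topMeasure_comparison hK.isCompact (hε k).le hik (hS i k)
      (fun z hz => frontier_subset_of_isCompact hK.isCompact hz.1.1) (fun z hz => by
        obtain ⟨_, _, v, hv, hn⟩ := hz
        exact ⟨v, hn, hv⟩)).1
    rwa [measure_mono_null inter_subset_left (euclideanHausdorffMeasure_singularPoints hK),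
      mul_zero, nonpos_iff_eq_zero] at h
  have hsub : {y | y ∈ slab u ∧ Hits (interior K) u y ∧ topPoint K u y ∈ singularPoints K} ⊆
      ⋃ i, ⋃ k, ⋃ (_ : ε k < ⟪(D i : Euc n), (u : Euc n)⟫),
        slab u ∩ {y | Hits K u y ∧ topPoint K u y ∈ S i k} := by
    rintro y ⟨hy, hi, hs⟩
    obtain ⟨hz, v, w, hv, hw, hne⟩ := id hs
    have hpos := hv.inner_pos_of_hits hK.isCompact hi
    obtain ⟨k, hk⟩ := exists_nat_one_div_lt (half_pos hpos)
    have hk : ε k < ⟪(v : Euc n), (u : Euc n)⟫ / 2 := hk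
    obtain ⟨i, hi'⟩ := hD.exists_dist_lt v (hε k)
    have h1 := (abs_le.1 (dist_inner_sphere_le v (D i) u)).2
    simp only [mem_iUnion]
    exact ⟨i, k, by linarith, hy, hi.mono interior_subset, hs, hz, v, hi'.le, hv⟩
  refine measure_mono_null hsub ?_
  refine measure_iUnion_null fun i => measure_iUnion_null fun k => measure_iUnion_null fun hik => ?_
  rw [← topMeasure_apply hK.isCompact u (hS i k)]
  exact hzero i k hik

/-- For almost every line in direction `u` which meets `K`, the last point of `K` on it is a regular
boundary point, and the line passes through the interior. -/
theorem ae_topPoint_mem_regularPoints {K : Set (Euc n)} (hK : IsConvexBody K) (u : Sph n) :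
    ∀ᵐ y ∂(volume.restrict (slab u)), Hits K u y →
      Hits (interior K) u y ∧ topPoint K u y ∈ regularPoints K := by
  rw [ae_restrict_iff' (measurableSet_slab u)]
  have h1 := volume_hits_not_hits_interior hK u
  have h2 := topMeasure_singularPoints hK u
  refine measure_mono_null ?_ (measure_union_null h1 h2)
  intro y hy
  simp only [mem_compl_iff, mem_ofPred_eq, not_forall, mem_union] at hy ⊢
  obtain ⟨hs, hK', hn⟩ := hy
  by_cases hi : Hits (interior K) u y
  · right
    refine ⟨hs, hi, ?_⟩
    by_contra hns
    refine hn ⟨hi, ?_⟩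
    rw [← frontier_diff_singularPoints hK]
    exact ⟨topPoint_mem_frontier hK.isCompact hK', hns⟩
  · exact Or.inl ⟨hK', hi⟩

theorem ENNReal_le_of_forall_ofReal_one_add_mul {a b : ℝ≥0∞}
    (h : ∀ δ : ℝ, 0 < δ → a ≤ ENNReal.ofReal (1 + δ) * b) : a ≤ b := by
  have h1 : Tendsto (fun δ : ℝ => ENNReal.ofReal (1 + δ)) (𝓝[>] 0) (𝓝 1) := by
    have : Tendsto (fun δ : ℝ => ENNReal.ofReal (1 + δ)) (𝓝 0) (𝓝 (ENNReal.ofReal (1 + 0))) :=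
      (ENNReal.continuous_ofReal.comp (continuous_const.add continuous_id)).tendsto 0
    rw [add_zero, ENNReal.ofReal_one] at this
    exact this.mono_left nhdsWithin_le_nhds
  have h2 := ENNReal.Tendsto.mul_const (b := b) h1 (Or.inl one_ne_zero)
  rw [one_mul] at h2
  exact ge_of_tendsto h2 (by filter_upwards [self_mem_nhdsWithin] with δ hδ using h δ hδ)

/-- Projecting the boundary of a convex body along `u` changes the area by the cosine of the angle
between the normal and `u`. -/
theorem topMeasure_eq [Nonempty (Sph n)] {K : Set (Euc n)} (hK : IsConvexBody K) (u : Sph n) :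
    topMeasure K u = (μHE[n - 1].restrict (frontier K)).withDensity
      fun z => ENNReal.ofReal ⟪(outerNormal K z : Euc n), (u : Euc n)⟫ := by
  set ν := outerNormal K
  have hν : Measurable ν := measurable_outerNormal hK
  have hdens : Measurable fun z => ENNReal.ofReal ⟪(ν z : Euc n), (u : Euc n)⟫ :=
    ((measurable_subtype_coe.comp hν).inner measurable_const).ennreal_ofReal
  set μ₂ := (μHE[n - 1].restrict (frontier K)).withDensity
      fun z => ENNReal.ofReal ⟪(ν z : Euc n), (u : Euc n)⟫
  set Z : Set (Euc n) := regularPoints K ∩ {z | 0 < ⟪(ν z : Euc n), (u : Euc n)⟫}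
  have hZ : MeasurableSet Z := (measurableSet_regularPoints hK).inter
    (measurableSet_lt measurable_const ((measurable_subtype_coe.comp hν).inner measurable_const))
  have hZK : Z ⊆ frontier K := fun z hz => hz.1.1
  -- neither measure charges the complement of `Z`
  have h1 : topMeasure K u Zᶜ = 0 := by
    have h := (ae_restrict_iff' (measurableSet_slab u)).1 (ae_topPoint_mem_regularPoints hK u)
    rw [topMeasure_apply hK.isCompact u hZ.compl]
    refine measure_mono_null ?_ h
    rintro y ⟨hs, hh, hz⟩ h
    obtain ⟨hi, hr⟩ := h hs hh
    exact hz ⟨hr, (isNormal_outerNormal hr).inner_pos_of_hits hK.isCompact hi⟩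
  have h2 : μ₂ Zᶜ = 0 := by
    have hne : MeasurableSet {x | ENNReal.ofReal ⟪(ν x : Euc n), (u : Euc n)⟫ ≠ 0} :=
      hdens (measurableSet_singleton 0).compl
    rw [withDensity_apply_eq_zero' hdens.aemeasurable, Measure.restrict_apply (hne.inter hZ.compl)]
    refine measure_mono_null ?_ (euclideanHausdorffMeasure_singularPoints hK)
    rintro z ⟨⟨h0, hz⟩, hf⟩
    by_contra hns
    have hr : z ∈ regularPoints K := by
      rw [← frontier_diff_singularPoints hK]; exact ⟨hf, hns⟩
    refine h0 (ENNReal.ofReal_eq_zero.2 (not_lt.1 fun hpos => hz ⟨hr, hpos⟩))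
  have hμ₂ : ∀ A, MeasurableSet A → A ⊆ Z →
      μ₂ A = ∫⁻ z in A, ENNReal.ofReal ⟪(ν z : Euc n), (u : Euc n)⟫ ∂μHE[n - 1] := by
    intro A hA hAZ
    rw [withDensity_apply _ hA, Measure.restrict_restrict hA, inter_eq_left.2 (hAZ.trans hZK)]
  have hloc : ∀ δ : ℝ, 0 < δ → ∀ v ∈ {v : Sph n | 0 < ⟪(v : Euc n), (u : Euc n)⟫}, ∃ U ∈ 𝓝 v, ∀ A,
      MeasurableSet A → A ⊆ Z → A ⊆ ν ⁻¹' U →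
        topMeasure K u A ≤ ENNReal.ofReal (1 + δ) * μ₂ A ∧
        μ₂ A ≤ ENNReal.ofReal (1 + δ) * topMeasure K u A := by
    intro δ hδ v hv
    set c := ⟪(v : Euc n), (u : Euc n)⟫
    have hc : 0 < c := hv
    -- The last two conditions say that the metric distortion of the projection, together with the
    -- oscillation of the cosine over the `ε`-ball, stays below the factor `1 + δ` in either
    -- direction.
    obtain ⟨ε, hε0, hεc, hε1, hε2⟩ : ∃ ε : ℝ, 0 < ε ∧ ε < c ∧
        c * (1 + ε / c) ^ (n - 1) ≤ (1 + δ) * (c - ε) ∧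
        c + ε ≤ (1 + δ) * (c * (1 - ε / c) ^ (n - 1)) := by
      have e1 : ∀ᶠ ε : ℝ in 𝓝 0, ε < c := eventually_lt_nhds hc
      have e2 : ∀ᶠ ε : ℝ in 𝓝 0, c * (1 + ε / c) ^ (n - 1) < (1 + δ) * (c - ε) := by
        refine ContinuousAt.eventually_lt (by fun_prop) (by fun_prop) ?_
        simp only [zero_div, add_zero, one_pow, mul_one, sub_zero]
        nlinarith
      have e3 : ∀ᶠ ε : ℝ in 𝓝 0, c + ε < (1 + δ) * (c * (1 - ε / c) ^ (n - 1)) := by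
        refine ContinuousAt.eventually_lt (by fun_prop) (by fun_prop) ?_
        simp only [zero_div, add_zero, one_pow, mul_one, sub_zero]
        nlinarith
      have e4 : ∀ᶠ ε : ℝ in 𝓝[>] 0, 0 < ε := self_mem_nhdsWithin
      obtain ⟨ε, h⟩ := (e4.and (((e1.and e2).and e3).filter_mono nhdsWithin_le_nhds)).exists
      exact ⟨ε, h.1, h.2.1.1, h.2.1.2.le, h.2.2.le⟩
    refine ⟨closedBall v ε, closedBall_mem_nhds v hε0, fun A hA hAZ hAν => ?_⟩
    obtain ⟨t1, t2⟩ := topMeasure_comparison hK.isCompact hε0.le hεc hA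
      (fun z hz => frontier_subset_of_isCompact hK.isCompact (hZK (hAZ hz)))
      (fun z hz => ⟨ν z, isNormal_outerNormal (hAZ hz).1, hAν hz⟩)
    change topMeasure K u A ≤ ENNReal.ofReal (c * (1 + ε / c) ^ (n - 1)) * μHE[n - 1] A at t1
    change ENNReal.ofReal c * μHE[n - 1] A ≤
      ENNReal.ofReal ((1 - ε / c)⁻¹ ^ (n - 1)) * topMeasure K u A at t2
    have hin : ∀ z ∈ A, c - ε ≤ ⟪(ν z : Euc n), (u : Euc n)⟫ ∧
        ⟪(ν z : Euc n), (u : Euc n)⟫ ≤ c + ε := by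
      intro z hz
      have h := abs_le.1 ((dist_inner_sphere_le (ν z) v u).trans (hAν hz))
      constructor <;> linarith [h.1, h.2]
    have b1 : ENNReal.ofReal (c - ε) * μHE[n - 1] A ≤ μ₂ A := by
      rw [hμ₂ A hA hAZ, ← setLIntegral_const]
      exact setLIntegral_mono' hA fun z hz => ENNReal.ofReal_le_ofReal (hin z hz).1
    have b2 : μ₂ A ≤ ENNReal.ofReal (c + ε) * μHE[n - 1] A := by
      rw [hμ₂ A hA hAZ, ← setLIntegral_const]
      exact setLIntegral_mono' hA fun z hz => ENNReal.ofReal_le_ofReal (hin z hz).2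
    have hδ1 : 0 ≤ 1 + δ := by linarith
    have hq : 0 < 1 - ε / c := sub_pos.2 ((div_lt_one hc).2 hεc)
    constructor
    · refine t1.trans ?_
      grw [← b1]
      rw [← mul_assoc, ← ENNReal.ofReal_mul hδ1]
      gcongr
    · refine b2.trans ?_
      calc ENNReal.ofReal (c + ε) * μHE[n - 1] A
          ≤ ENNReal.ofReal ((1 + δ) * (c * (1 - ε / c) ^ (n - 1))) * μHE[n - 1] A := by gcongr
        _ = ENNReal.ofReal ((1 + δ) * (1 - ε / c) ^ (n - 1)) *
              (ENNReal.ofReal c * μHE[n - 1] A) := by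
            rw [← mul_assoc (ENNReal.ofReal _), ← ENNReal.ofReal_mul (by positivity)]; congr 2; ring
        _ ≤ ENNReal.ofReal ((1 + δ) * (1 - ε / c) ^ (n - 1)) *
              (ENNReal.ofReal ((1 - ε / c)⁻¹ ^ (n - 1)) * topMeasure K u A) := by gcongr
        _ = ENNReal.ofReal (1 + δ) * topMeasure K u A := by
            rw [← mul_assoc, ← ENNReal.ofReal_mul (by positivity), mul_assoc, ← mul_pow,
              mul_inv_cancel₀ hq.ne', one_pow, mul_one]
  have hZV : ∀ z ∈ Z, ν z ∈ {v : Sph n | 0 < ⟪(v : Euc n), (u : Euc n)⟫} := fun z hz => hz.2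
  have hAle : ∀ A, MeasurableSet A → A ⊆ Z → topMeasure K u A = μ₂ A := by
    intro A hA hAZ
    refine le_antisymm (ENNReal_le_of_forall_ofReal_one_add_mul fun δ hδ => ?_)
      (ENNReal_le_of_forall_ofReal_one_add_mul fun δ hδ => ?_)
    · refine measure_le_of_locally_le (μ₂ := ENNReal.ofReal (1 + δ) • μ₂) hν hZV (fun v hv => ?_) hA hAZ
      obtain ⟨U, hU, h⟩ := hloc δ hδ v hv
      exact ⟨U, hU, fun A hA hAZ hAU => (h A hA hAZ hAU).1⟩
    · refine measure_le_of_locally_le (μ₂ := ENNReal.ofReal (1 + δ) • topMeasure K u) hν hZV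
        (fun v hv => ?_) hA hAZ
      obtain ⟨U, hU, h⟩ := hloc δ hδ v hv
      exact ⟨U, hU, fun A hA hAZ hAU => (h A hA hAZ hAU).2⟩
  ext A hA
  have d1 : topMeasure K u (A \ Z) = 0 := measure_mono_null (fun x hx => hx.2) h1
  have d2 : μ₂ (A \ Z) = 0 := measure_mono_null (fun x hx => hx.2) h2
  rw [← measure_inter_add_sdiff A hZ, ← measure_inter_add_sdiff (μ := μ₂) A hZ, d1, d2,
    hAle _ (hA.inter hZ) inter_subset_right]

/-! ### The fractional area measure -/

theorem toSphere_setOf_inner_eq_zero {v : Euc n} (hv : v ≠ 0) :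
    (volume : Measure (Euc n)).toSphere {u : Sph n | ⟪v, (u : Euc n)⟫ = 0} = 0 := by
  have hm : MeasurableSet {u : Sph n | ⟪v, (u : Euc n)⟫ = 0} :=
    (isClosed_eq (by fun_prop) continuous_const).measurableSet
  rw [Measure.toSphere_apply' _ hm]
  refine mul_eq_zero_of_right _ ?_
  have hne : (Submodule.span ℝ {v})ᗮ ≠ ⊤ := by
    intro h
    have : v ∈ (Submodule.span ℝ {v})ᗮ := h ▸ Submodule.mem_top
    rw [Submodule.mem_orthogonal_singleton_iff_inner_right] at this
    exact hv (inner_self_eq_zero.1 this)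
  refine measure_mono_null ?_ (Measure.addHaar_submodule volume _ hne)
  rintro _ ⟨r, -, _, ⟨u, hu, rfl⟩, rfl⟩
  change r • (u : Euc n) ∈ (Submodule.span ℝ {v})ᗮ
  rw [Submodule.mem_orthogonal_singleton_iff_inner_right, inner_smul_right]
  exact mul_eq_zero_of_right _ hu

theorem measurePreserving_neg_toSphere :
    MeasurePreserving (fun u : Sph n => -u) (volume : Measure (Euc n)).toSphere
      (volume : Measure (Euc n)).toSphere := by
  refine ⟨continuous_neg.measurable, ?_⟩
  ext S hS
  rw [Measure.map_apply continuous_neg.measurable hS, Measure.toSphere_apply' _ hS,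
    Measure.toSphere_apply' _ (continuous_neg.measurable hS)]
  congr 1
  rw [← Measure.measure_neg volume]
  congr 1
  ext x
  simp only [Set.mem_neg, Set.mem_smul, mem_image, mem_preimage]
  constructor
  · rintro ⟨r, hr, _, ⟨u, hu, rfl⟩, h⟩
    exact ⟨r, hr, _, ⟨-u, hu, rfl⟩, by rw [coe_neg_sphere, smul_neg, h, neg_neg]⟩
  · rintro ⟨r, hr, _, ⟨u, hu, rfl⟩, h⟩
    exact ⟨r, hr, _, ⟨-u, by simpa using hu, rfl⟩, by rw [coe_neg_sphere, smul_neg, h]⟩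

theorem radialWeight_neg (s : ℝ) {L : Set (Euc n)} (hL : IsSymmConvexBody L) (u : Sph n) :
    radialWeight s L (-u) = radialWeight s L u := by
  rw [radialWeight, radialWeight, radialFun_zero_eq hL, radialFun_zero_eq hL, coe_neg_sphere,
    gauge_neg hL.neg_mem]

/-- Symmetry of `L` makes the weight even, and `slab` does not see orientation. Hence the two ends
of the chords contribute equally in all integrals. -/
theorem lintegral_lineMeasure_neg (s : ℝ) {L : Set (Euc n)} (hL : IsSymmConvexBody L)
    {F : Sph n × Euc n → ℝ≥0∞} (hF : Measurable F) :
    ∫⁻ p, F (-p.1, p.2) ∂(lineMeasure s L) = ∫⁻ p, F p ∂(lineMeasure s L) := by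
  have hneg : Measurable fun p : Sph n × Euc n => (-p.1, p.2) :=
    ((continuous_neg.comp continuous_fst).prodMk continuous_snd).measurable
  have hFn : Measurable fun p : Sph n × Euc n => F (-p.1, p.2) := hF.comp hneg
  rw [lintegral_lineMeasure s hL hF, lintegral_lineMeasure s hL hFn]
  have hm : Measurable fun u : Sph n => radialWeight s L u * ∫⁻ y in slab u, F (u, y) := by
    have h1 : Measurable ({p : Sph n × Euc n | p.2 ∈ slab p.1}.indicator F) :=
      hF.indicator measurableSet_slab_prod
    have h2 := h1.lintegral_prod_right' (ν := (volume : Measure (Euc n)))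
    refine (measurable_radialWeight s hL).mul ?_
    convert h2 using 2 with u
    rw [← lintegral_indicator (measurableSet_slab u)]
    rfl
  rw [← measurePreserving_neg_toSphere.lintegral_comp hm]
  refine lintegral_congr fun u => ?_
  rw [radialWeight_neg s hL, slab_neg]

/-- The integral of `ρ_{K,z} ^ (-s) ρ_L ^ (n + s)` over the sphere. -/
def chordPotential (s : ℝ) (K L : Set (Euc n)) (z : Euc n) : ℝ≥0∞ :=
  ∫⁻ u, ENNReal.ofReal (topLine K u z ^ (-s)) * radialWeight s L u
    ∂((volume : Measure (Euc n)).toSphere)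

theorem measurable_chordPotential_integrand (s : ℝ) {K L : Set (Euc n)} (hK : IsCompact K)
    (hL : IsSymmConvexBody L) : Measurable fun p : Euc n × Sph n =>
      ENNReal.ofReal (topLine K p.2 p.1 ^ (-s)) * radialWeight s L p.2 := by
  have h := (measurable_topLine hK).comp (measurable_swap (α := Euc n) (β := Sph n))
  exact (h.pow_const (-s)).ennreal_ofReal.mul ((measurable_radialWeight s hL).comp measurable_snd)

theorem measurable_chordPotential (s : ℝ) {K L : Set (Euc n)} (hK : IsCompact K)
    (hL : IsSymmConvexBody L) : Measurable (chordPotential s K L) :=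
  (measurable_chordPotential_integrand s hK hL).lintegral_prod_right'

/-- The restriction to `ρ > 0` can be dropped because the real power `0 ^ (-s)` has the value `0`.
-/
theorem dualMixedVolume_eq {s : ℝ} (hs : 0 < s) {K L : Set (Euc n)} (hK : IsCompact K)
    {z : Euc n} (hz : z ∈ K) :
    dualMixedVolume ((n : ℝ) + s) K L z = ENNReal.ofReal (1 / (n : ℝ)) * chordPotential s K L z := by
  have hr : ∀ u, radialFun K z u = topLine K u z := radialFun_eq_topLine hK hz
  have hm : MeasurableSet {u : Sph n | 0 < topLine K u z} := by
    have h := (measurable_topLine hK).comp (measurable_prodMk_right (y := z))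
    exact measurableSet_lt measurable_const h
  rw [dualMixedVolume, chordPotential]
  simp_rw [hr]
  congr 1
  rw [← lintegral_indicator hm]
  refine lintegral_congr fun u => ?_
  have h0 : 0 ≤ topLine K u z := le_topLine hK (by simpa using hz)
  rw [show (n : ℝ) - (n + s) = -s by ring]
  by_cases hu : 0 < topLine K u z
  · rw [indicator_of_mem (by exact hu), ENNReal.ofReal_mul (Real.rpow_nonneg h0 _)]
    rfl
  · rw [indicator_of_notMem (by exact hu), le_antisymm (not_lt.1 hu) h0,
      Real.zero_rpow (by linarith), ENNReal.ofReal_zero, zero_mul]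

/-- The anisotropic fractional area measure. -/
def fracAreaMeasure [Nonempty (Sph n)] (s : ℝ) (K L : Set (Euc n)) : Measure (Sph n) :=
  ENNReal.ofReal (1 / s) • ((μHE[n - 1].restrict (frontier K)).withDensity
    (chordPotential s K L)).map (outerNormal K)

theorem ae_mem_regularPoints {K : Set (Euc n)} (hK : IsConvexBody K) :
    ∀ᵐ z ∂(μHE[n - 1].restrict (frontier K)), z ∈ regularPoints K := by
  rw [ae_restrict_iff' isClosed_frontier.measurableSet]
  refine measure_mono_null ?_ (euclideanHausdorffMeasure_singularPoints hK)
  intro z hz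
  simp only [mem_compl_iff, mem_ofPred_eq, not_forall] at hz
  obtain ⟨hf, hr⟩ := hz
  by_contra hs
  exact hr (by rw [← frontier_diff_singularPoints hK]; exact ⟨hf, hs⟩)

theorem isFracAreaMeasure_fracAreaMeasure [Nonempty (Sph n)] (hn : 1 ≤ n) {s : ℝ} (hs : 0 < s)
    {K L : Set (Euc n)} (hK : IsConvexBody K) (hL : IsSymmConvexBody L) :
    IsFracAreaMeasure s K L (fracAreaMeasure s K L) := by
  intro η hη
  have hν := measurable_outerNormal hK
  have hp := measurable_chordPotential s hK.isCompact hL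
  -- Off the singular points the normal is unique, so the inverse Gauss image is the preimage under
  -- `outerNormal`, up to an area-null set.
  have hae : inverseGauss K η =ᵐ[μHE[n - 1]] (outerNormal K ⁻¹' η ∩ frontier K : Set (Euc n)) := by
    have h := euclideanHausdorffMeasure_singularPoints hK
    have h' : ∀ᵐ z ∂(μHE[n - 1] : Measure (Euc n)), z ∉ singularPoints K := by
      rw [ae_iff]; simpa using h
    filter_upwards [h'] with z hz
    refine propext ?_
    constructor
    · rintro ⟨hf, v, hv, hn⟩
      have hr : z ∈ regularPoints K := by
        rw [← frontier_diff_singularPoints hK]; exact ⟨hf, hz⟩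
      refine ⟨?_, hf⟩
      have : v = outerNormal K z := IsNormal.eq_outerNormal hn hr
      rw [this] at hv
      exact hv
    · rintro ⟨hη, hf⟩
      have hr : z ∈ regularPoints K := by
        rw [← frontier_diff_singularPoints hK]; exact ⟨hf, hz⟩
      exact ⟨hf, _, hη, isNormal_outerNormal hr⟩
  have hn0 : (n : ℝ) ≠ 0 := by positivity
  rw [fracAreaMeasure, Measure.smul_apply, Measure.map_apply hν hη, withDensity_apply _ (hν hη),
    Measure.restrict_restrict (hν hη), fracAreaSetFun, setLIntegral_congr hae,
    setLIntegral_congr_fun (g := fun z => ENNReal.ofReal (1 / (n : ℝ)) * chordPotential s K L z)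
      ((hν hη).inter isClosed_frontier.measurableSet)
      (fun z hz => dualMixedVolume_eq hs hK.isCompact
        (frontier_subset_of_isCompact hK.isCompact hz.2)),
    lintegral_const_mul _ hp, ← mul_assoc, ← ENNReal.ofReal_mul (by positivity), smul_eq_mul]
  congr 2
  field_simp

theorem lintegral_fracAreaMeasure [Nonempty (Sph n)] {s : ℝ}
    {K L : Set (Euc n)} (hK : IsConvexBody K) (hL : IsSymmConvexBody L) {g : Sph n → ℝ≥0∞}
    (hg : Measurable g) :
    ∫⁻ v, g v ∂(fracAreaMeasure s K L) = ENNReal.ofReal (1 / s) *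
      ∫⁻ z in frontier K, g (outerNormal K z) * chordPotential s K L z ∂μHE[n - 1] := by
  have hν := measurable_outerNormal hK
  have hp := measurable_chordPotential s hK.isCompact hL
  have hgν : Measurable fun z => g (outerNormal K z) := hg.comp hν
  rw [fracAreaMeasure, lintegral_smul_measure, lintegral_map hg hν,
    lintegral_withDensity_eq_lintegral_mul _ hp hgν, smul_eq_mul]
  congr 1
  refine lintegral_congr fun z => ?_
  simp [mul_comm]

/-! ### Integrating endpoint rates over all lines -/

open Classical in
/-- The rate at which the last point of the chord through `y` of direction `u` moves when the
supporting hyperplanes of `K` move outwards with speed `g`, weighted by the power `-s` of the length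
of the chord. -/
def topRate [Nonempty (Sph n)] (s : ℝ) (K : Set (Euc n)) (g : Sph n → ℝ≥0∞) (p : Sph n × Euc n) :
    ℝ≥0∞ :=
  if Hits K p.1 p.2 then ENNReal.ofReal (chordLen K p.1 p.2 ^ (-s)) *
    (g (outerNormal K (topPoint K p.1 p.2)) /
      ENNReal.ofReal ⟪(outerNormal K (topPoint K p.1 p.2) : Euc n), (p.1 : Euc n)⟫) else 0

theorem measurable_topRate [Nonempty (Sph n)] (s : ℝ) {K : Set (Euc n)} (hK : IsConvexBody K)
    {g : Sph n → ℝ≥0∞} (hg : Measurable g) : Measurable (topRate s K g) := by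
  have hν := (measurable_outerNormal hK).comp (measurable_topPoint hK.isCompact)
  refine Measurable.ite (isClosed_hits hK.isCompact).measurableSet ?_ measurable_const
  refine ((measurable_chordLen hK.isCompact).pow_const _).ennreal_ofReal.mul ((hg.comp hν).div ?_)
  exact ((measurable_subtype_coe.comp hν).inner
    (measurable_subtype_coe.comp measurable_fst)).ennreal_ofReal

theorem topLine_topPoint {K : Set (Euc n)} (hK : IsCompact K) {u : Sph n} {y : Euc n}
    (h : Hits K u y) : topLine K (-u) (topPoint K u y) = chordLen K u y := by
  have e : topPoint K u y = y + (-topLine K u y) • ((-u : Sph n) : Euc n) := by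
    rw [add_smul_neg_sphere, neg_neg]; rfl
  rw [e, topLine_add_smul hK (hits_neg.2 h), chordLen]
  ring

/-- Change variables from the line to its exit point `z`. The cosine density of `topMeasure_eq`
cancels the denominator of the rate, and the chord length becomes the radial function at `z` in
direction `-u`. -/
theorem setLIntegral_slab_topRate [Nonempty (Sph n)] {s : ℝ} {K : Set (Euc n)}
    (hK : IsConvexBody K) {g : Sph n → ℝ≥0∞} (hg : Measurable g) (u : Sph n) :
    ∫⁻ y in slab u, topRate s K g (u, y) =
      ∫⁻ z in frontier K, {z | 0 < ⟪(outerNormal K z : Euc n), (u : Euc n)⟫}.indicator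
        (fun z => ENNReal.ofReal (topLine K (-u) z ^ (-s)) * g (outerNormal K z)) z ∂μHE[n - 1] := by
  have hν := measurable_outerNormal hK
  have htop : Measurable fun z => topLine K (-u) z :=
    (measurable_topLine hK.isCompact).comp measurable_prodMk_left
  have hin : Measurable fun z => ENNReal.ofReal ⟪(outerNormal K z : Euc n), (u : Euc n)⟫ :=
    ((measurable_subtype_coe.comp hν).inner measurable_const).ennreal_ofReal
  set Φ : Euc n → ℝ≥0∞ := fun z => ENNReal.ofReal (topLine K (-u) z ^ (-s)) *
    (g (outerNormal K z) / ENNReal.ofReal ⟪(outerNormal K z : Euc n), (u : Euc n)⟫)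
  have hΦ : Measurable Φ := (htop.pow_const _).ennreal_ofReal.mul ((hg.comp hν).div hin)
  have e1 : ∫⁻ y in slab u, topRate s K g (u, y) = ∫⁻ z, Φ z ∂(topMeasure K u) := by
    rw [topMeasure, lintegral_map hΦ (measurable_topPoint_right hK.isCompact u),
      ← lintegral_indicator (measurableSet_hits hK.isCompact u)]
    refine lintegral_congr fun y => ?_
    by_cases h : Hits K u y
    · rw [indicator_of_mem (by exact h), topRate, if_pos h]
      simp only [Φ, topLine_topPoint hK.isCompact h]
    · rw [indicator_of_notMem (by exact h), topRate, if_neg h]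
  rw [e1, topMeasure_eq hK u, lintegral_withDensity_eq_lintegral_mul _ hin hΦ]
  refine lintegral_congr fun z => ?_
  by_cases hz : 0 < ⟪(outerNormal K z : Euc n), (u : Euc n)⟫
  · rw [indicator_of_mem (by exact hz), Pi.mul_apply]
    simp only [Φ]
    rw [mul_left_comm, ENNReal.mul_div_cancel (ENNReal.ofReal_pos.2 hz).ne' ENNReal.ofReal_ne_top]
  · rw [indicator_of_notMem (by exact hz), Pi.mul_apply, ENNReal.ofReal_eq_zero.2 (not_lt.1 hz),
      zero_mul]

/-- The half-sphere restriction costs nothing: directions pointing outwards have `topLine = 0`,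
hence a zero integrand, and tangential directions form a null set. -/
theorem lintegral_sphere_indicator_inner_pos [Nonempty (Sph n)] {s : ℝ} (hs : 0 < s)
    {K L : Set (Euc n)} (hK : IsConvexBody K) (hL : IsSymmConvexBody L) (g : Sph n → ℝ≥0∞)
    {z : Euc n} (hz : z ∈ regularPoints K) :
    ∫⁻ u, radialWeight s L u * {z | 0 < ⟪(outerNormal K z : Euc n), ((-u : Sph n) : Euc n)⟫}.indicator
        (fun z => ENNReal.ofReal (topLine K u z ^ (-s)) * g (outerNormal K z)) z
          ∂((volume : Measure (Euc n)).toSphere) =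
      g (outerNormal K z) * chordPotential s K L z := by
  have hzK : z ∈ K := frontier_subset_of_isCompact hK.isCompact hz.1
  have htop : Measurable fun u : Sph n => topLine K u z :=
    (measurable_topLine hK.isCompact).comp (measurable_prodMk_right (y := z))
  have hpm : Measurable fun u : Sph n => ENNReal.ofReal (topLine K u z ^ (-s)) * radialWeight s L u :=
    (htop.pow_const _).ennreal_ofReal.mul (measurable_radialWeight s hL)
  rw [chordPotential, ← lintegral_const_mul _ hpm]
  refine lintegral_congr_ae ?_
  have hnull := toSphere_setOf_inner_eq_zero (ne_zero_of_mem_unit_sphere (outerNormal K z))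
  have hae : ∀ᵐ u : Sph n ∂((volume : Measure (Euc n)).toSphere),
      ⟪(outerNormal K z : Euc n), (u : Euc n)⟫ ≠ 0 := by
    rw [ae_iff]; simpa using hnull
  filter_upwards [hae] with u hu
  have hi : ⟪(outerNormal K z : Euc n), ((-u : Sph n) : Euc n)⟫ =
      -⟪(outerNormal K z : Euc n), (u : Euc n)⟫ := by rw [coe_neg_sphere, inner_neg_right]
  rcases lt_or_gt_of_ne hu with h | h
  · have hmem : z ∈ {z | 0 < ⟪(outerNormal K z : Euc n), ((-u : Sph n) : Euc n)⟫} := by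
      rw [mem_ofPred_eq, hi]; exact neg_pos.2 h
    rw [indicator_of_mem hmem, mul_comm (ENNReal.ofReal _) (g _), mul_left_comm,
      mul_comm (radialWeight s L u)]
  · have hmem : z ∉ {z | 0 < ⟪(outerNormal K z : Euc n), ((-u : Sph n) : Euc n)⟫} := by
      rw [mem_ofPred_eq, hi]; exact not_lt.2 (neg_nonpos.2 h.le)
    rw [indicator_of_notMem hmem,
      (isNormal_outerNormal hz).topLine_eq_zero hK.isCompact hzK h,
      Real.zero_rpow (neg_ne_zero.2 hs.ne'), ENNReal.ofReal_zero, zero_mul, mul_zero, mul_zero]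

/-- Tonelli in direction and exit point, after reversing orientation so that `-u` becomes `u`. This
identity links line integrals with the area measure; the factor `s` undoes the `1/s` in
`fracAreaMeasure`. -/
theorem lintegral_topRate [Nonempty (Sph n)] {s : ℝ} (hs : 0 < s) {K L : Set (Euc n)}
    (hK : IsConvexBody K) (hL : IsSymmConvexBody L) {g : Sph n → ℝ≥0∞} (hg : Measurable g) :
    ∫⁻ p, topRate s K g p ∂(lineMeasure s L) =
      ENNReal.ofReal s * ∫⁻ v, g v ∂(fracAreaMeasure s K L) := by
  have hν := measurable_outerNormal hK
  let N : Measure (Euc n) := μHE[n - 1].restrict (frontier K)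
  have hfin : IsFiniteMeasure N := ⟨by
    rw [Measure.restrict_apply_univ]; exact euclideanHausdorffMeasure_frontier_lt_top hK⟩
  have hnegm : Measurable fun p : Sph n × Euc n => (-p.1, p.2) :=
    ((continuous_neg.comp continuous_fst).prodMk continuous_snd).measurable
  have hcm : Measurable fun p : Sph n × Euc n => topRate s K g (-p.1, p.2) :=
    (measurable_topRate s hK hg).comp hnegm
  rw [← lintegral_lineMeasure_neg s hL (measurable_topRate s hK hg), lintegral_lineMeasure s hL hcm]
  let Ψ : Sph n → Euc n → ℝ≥0∞ := fun u z => radialWeight s L u *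
    {z | 0 < ⟪(outerNormal K z : Euc n), ((-u : Sph n) : Euc n)⟫}.indicator
        (fun z => ENNReal.ofReal (topLine K u z ^ (-s)) * g (outerNormal K z)) z
  have hΨ : Measurable (Function.uncurry Ψ) := by
    refine ((measurable_radialWeight s hL).comp measurable_fst).mul ?_
    have hset : MeasurableSet {p : Sph n × Euc n |
        0 < ⟪(outerNormal K p.2 : Euc n), ((-p.1 : Sph n) : Euc n)⟫} :=
      measurableSet_lt measurable_const ((measurable_subtype_coe.comp (hν.comp measurable_snd)).inner
        (measurable_subtype_coe.comp (continuous_neg.measurable.comp measurable_fst)))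
    exact Measurable.indicator (((measurable_topLine hK.isCompact).pow_const _).ennreal_ofReal.mul
      (hg.comp (hν.comp measurable_snd))) hset
  have e1 : ∀ u, radialWeight s L u * ∫⁻ y in slab u, topRate s K g (-u, y) = ∫⁻ z, Ψ u z ∂N := by
    intro u
    have hΨu : Measurable fun z => {z | 0 < ⟪(outerNormal K z : Euc n), ((-u : Sph n) : Euc n)⟫}.indicator
        (fun z => ENNReal.ofReal (topLine K u z ^ (-s)) * g (outerNormal K z)) z := by
      refine Measurable.indicator ?_ (measurableSet_lt measurable_const
        ((measurable_subtype_coe.comp hν).inner measurable_const))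
      exact (((measurable_topLine hK.isCompact).comp measurable_prodMk_left).pow_const
        _).ennreal_ofReal.mul (hg.comp hν)
    rw [← slab_neg, setLIntegral_slab_topRate hK hg (-u), neg_neg, lintegral_const_mul _ hΨu]
  simp only [e1]
  rw [lintegral_lintegral_swap hΨ.aemeasurable, lintegral_fracAreaMeasure hK hL hg, ← mul_assoc,
    ← ENNReal.ofReal_mul hs.le, mul_one_div_cancel hs.ne', ENNReal.ofReal_one, one_mul]
  refine lintegral_congr_ae ?_
  filter_upwards [ae_mem_regularPoints hK] with z hz
  exact lintegral_sphere_indicator_inner_pos hs hK hL g hz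

/-! ### Wulff shapes -/

theorem isClosed_wulffShape (g : Sph n → ℝ) : IsClosed (wulffShape g) := by
  have : wulffShape g = ⋂ v : Sph n, {x | ⟪(v : Euc n), x⟫ ≤ g v} := by
    ext x; simp [wulffShape]
  rw [this]
  exact isClosed_iInter fun v => isClosed_le (by fun_prop) continuous_const

theorem convex_wulffShape (g : Sph n → ℝ) : Convex ℝ (wulffShape g) := by
  intro x hx y hy a b ha hb hab v
  rw [inner_add_right, inner_smul_right, inner_smul_right]
  have h1 := mul_le_mul_of_nonneg_left (hx v) ha
  have h2 := mul_le_mul_of_nonneg_left (hy v) hb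
  have h3 : a * g v + b * g v = g v := by rw [← add_mul, hab, one_mul]
  linarith

theorem isCompact_wulffShape {g : Sph n → ℝ} (hg : Continuous g) : IsCompact (wulffShape g) := by
  obtain ⟨C, hC⟩ := (isCompact_range hg).bddAbove
  refine isCompact_of_isClosed_isBounded (isClosed_wulffShape g) ?_
  refine (isBounded_iff_forall_norm_le).2 ⟨max C 0, fun x hx => ?_⟩
  by_cases h0 : x = 0
  · simp [h0]
  have hnp : 0 < ‖x‖ := norm_pos_iff.2 h0
  let v : Sph n := ⟨‖x‖⁻¹ • x, by
    rw [mem_sphere_zero_iff_norm, norm_smul, norm_inv, norm_norm, inv_mul_cancel₀ hnp.ne']⟩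
  have h1 := (hx v).trans (hC (mem_range_self v))
  have h2 : ⟪(v : Euc n), x⟫ = ‖x‖ := by
    simp only [v, inner_smul_left, real_inner_self_eq_norm_sq]
    simp only [conj_trivial]
    field_simp
  rw [h2] at h1
  exact h1.trans (le_max_left _ _)

theorem wulffShape_mono {g g' : Sph n → ℝ} (h : ∀ v, g v ≤ g' v) : wulffShape g ⊆ wulffShape g' :=
  fun _ hx v => (hx v).trans (h v)

/-- A convex body is the Wulff shape of its support function. -/
theorem wulffShape_supportFun {K : Set (Euc n)} (hK : IsConvexBody K) :
    wulffShape (supportFun K) = K := by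
  refine Subset.antisymm (fun x hx => ?_) fun x hx v => inner_le_supportFun hK.isCompact v hx
  by_contra hxK
  obtain ⟨f, c, hfx, hfK⟩ := geometric_hahn_banach_point_closed hK.convex hK.isCompact.isClosed hxK
  set a := (InnerProductSpace.toDual ℝ (Euc n)).symm f
  have ha : ∀ x, f x = ⟪a, x⟫ := fun x => (InnerProductSpace.toDual_symm_apply).symm
  obtain ⟨k, hk⟩ := hK.interior_nonempty.mono interior_subset
  have ha0 : a ≠ 0 := by
    intro h0
    have h1 := hfK k hk
    rw [ha, h0, inner_zero_left] at h1 hfx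
    linarith
  have hnp : 0 < ‖a‖ := norm_pos_iff.2 ha0
  let v : Sph n := ⟨-(‖a‖⁻¹ • a), by
    rw [mem_sphere_zero_iff_norm, norm_neg, norm_smul, norm_inv, norm_norm,
      inv_mul_cancel₀ hnp.ne']⟩
  have hv : ∀ x, ⟪(v : Euc n), x⟫ = -(‖a‖⁻¹ * f x) := fun x => by
    simp only [v, inner_neg_left, inner_smul_left, ha, conj_trivial]
  have h1 : supportFun K v ≤ -(‖a‖⁻¹ * c) := supportFun_le ⟨k, hk⟩ v fun y hy => by
    rw [hv]
    have := mul_le_mul_of_nonneg_left (hfK y hy).le (inv_pos.2 hnp).le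
    linarith
  have h2 := (hx v).trans h1
  rw [hv] at h2
  have := mul_lt_mul_of_pos_left hfx (inv_pos.2 hnp)
  linarith

/-- The Wulff shape of the perturbed support function `h_K + t f`. -/
def wulffVar (K : Set (Euc n)) (f : Sph n → ℝ) (t : ℝ) : Set (Euc n) :=
  wulffShape fun v => supportFun K v + t * f v

theorem wulffVar_zero {K : Set (Euc n)} (hK : IsConvexBody K) (f : Sph n → ℝ) :
    wulffVar K f 0 = K := by
  simp only [wulffVar, zero_mul, add_zero, wulffShape_supportFun hK]

theorem isCompact_wulffVar {K : Set (Euc n)} (hK : IsCompact K) {f : Sph n → ℝ}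
    (hf : Continuous f) (t : ℝ) : IsCompact (wulffVar K f t) :=
  isCompact_wulffShape ((continuous_supportFun hK).add (continuous_const.mul hf))

/-! ### First variation of a single chord -/

/-- Only the constraint of the Wulff shape in the direction `v` is used. The bound holds for every
real `t` for which the line meets the shape, without error term. -/
theorem topLine_wulffVar_le {K : Set (Euc n)} (hK : IsCompact K) {f : Sph n → ℝ}
    (hf : Continuous f) {u v : Sph n} {y : Euc n} (hv : IsNormal K v (topPoint K u y))
    (hvu : 0 < ⟪(v : Euc n), (u : Euc n)⟫) {t : ℝ} (ht : Hits (wulffVar K f t) u y) :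
    topLine (wulffVar K f t) u y ≤ topLine K u y + t * (f v / ⟪(v : Euc n), (u : Euc n)⟫) := by
  have h1 := topLine_mem (isCompact_wulffVar hK hf t) ht v
  rw [IsNormal, topPoint, inner_add_right, inner_smul_right] at hv
  simp only [inner_add_right, inner_smul_right, ← hv] at h1
  rw [← mul_div_assoc, ← sub_le_iff_le_add', le_div_iff₀ hvu]
  linarith

/-- At a regular point every constraint except that of `ν` is strict at `t = 0` and survives small
changes of `t` and of the direction. For directions near `ν`, the margin `ε|t|` absorbs the
variation of `f` and of the cosine. Compactness of the sphere makes this uniform. -/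
theorem eventually_mem_wulffVar [Nonempty (Sph n)] {K : Set (Euc n)} (hK : IsConvexBody K)
    {f : Sph n → ℝ} (hf : Continuous f) {u : Sph n} {z : Euc n} (hz : z ∈ regularPoints K)
    (hu : 0 < ⟪(outerNormal K z : Euc n), (u : Euc n)⟫) {ε : ℝ} (hε : 0 < ε) :
    ∀ᶠ t : ℝ in 𝓝 0, z + (t * (f (outerNormal K z) / ⟪(outerNormal K z : Euc n), (u : Euc n)⟫) -
      ε * |t|) • (u : Euc n) ∈ wulffVar K f t := by
  set ν := outerNormal K z
  set c := f ν / ⟪(ν : Euc n), (u : Euc n)⟫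
  have hzK := frontier_subset_of_isCompact hK.isCompact hz.1
  have hh := continuous_supportFun hK.isCompact
  have key : ∀ v ∈ (univ : Set (Sph n)), ∀ᶠ q : ℝ × Sph n in 𝓝 ((0 : ℝ), v),
      ⟪(q.2 : Euc n), z⟫ + (q.1 * c - ε * |q.1|) * ⟪(q.2 : Euc n), (u : Euc n)⟫ ≤
        supportFun K q.2 + q.1 * f q.2 := by
    intro v _
    by_cases hvν : v = ν
    · rw [hvν]
      have hc : Continuous fun q : ℝ × Sph n =>
          ε * ⟪(q.2 : Euc n), (u : Euc n)⟫ - |c * ⟪(q.2 : Euc n), (u : Euc n)⟫ - f q.2| := by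
        fun_prop
      have h0 : 0 < ε * ⟪(ν : Euc n), (u : Euc n)⟫ - |c * ⟪(ν : Euc n), (u : Euc n)⟫ - f ν| := by
        simp only [c, div_mul_cancel₀ _ hu.ne', sub_self, abs_zero, sub_zero]
        exact mul_pos hε hu
      filter_upwards [hc.continuousAt.eventually (lt_mem_nhds h0)] with q hq
      have h1 := inner_le_supportFun hK.isCompact q.2 hzK
      have h2 : q.1 * (c * ⟪(q.2 : Euc n), (u : Euc n)⟫ - f q.2) ≤
          |q.1| * (ε * ⟪(q.2 : Euc n), (u : Euc n)⟫) := by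
        refine (le_abs_self _).trans ?_
        rw [abs_mul]
        exact mul_le_mul_of_nonneg_left (by linarith) (abs_nonneg _)
      nlinarith
    · have hc : Continuous fun q : ℝ × Sph n => supportFun K q.2 + q.1 * f q.2 -
          (⟪(q.2 : Euc n), z⟫ + (q.1 * c - ε * |q.1|) * ⟪(q.2 : Euc n), (u : Euc n)⟫) := by
        fun_prop
      have h0 : 0 < supportFun K v + 0 * f v -
          (⟪(v : Euc n), z⟫ + (0 * c - ε * |0|) * ⟪(v : Euc n), (u : Euc n)⟫) := by
        have h1 := inner_le_supportFun hK.isCompact v hzK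
        have h2 : ⟪(v : Euc n), z⟫ ≠ supportFun K v := fun h =>
          hvν (IsNormal.eq_outerNormal h hz)
        simp only [zero_mul, abs_zero, mul_zero, sub_zero, add_zero]
        exact sub_pos.2 (lt_of_le_of_ne h1 h2)
      filter_upwards [hc.continuousAt.eventually (lt_mem_nhds h0)] with q hq
      linarith
  have := isCompact_univ.eventually_forall_of_forall_eventually (x₀ := (0 : ℝ))
    (P := fun t v => ⟪((v : Sph n) : Euc n), z⟫ +
      (t * c - ε * |t|) * ⟪(v : Euc n), (u : Euc n)⟫ ≤ supportFun K v + t * f v) key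
  filter_upwards [this] with t ht v
  rw [inner_add_right, inner_smul_right]
  exact ht v (mem_univ v)

/-- First variation of the endpoint of a chord at a regular boundary point. -/
theorem hasDerivAt_topLine_wulffVar [Nonempty (Sph n)] {K : Set (Euc n)} (hK : IsConvexBody K)
    {f : Sph n → ℝ} (hf : Continuous f) {u : Sph n} {y : Euc n} (hy : Hits (interior K) u y)
    (hz : topPoint K u y ∈ regularPoints K) :
    HasDerivAt (fun t => topLine (wulffVar K f t) u y)
      (f (outerNormal K (topPoint K u y)) /
        ⟪(outerNormal K (topPoint K u y) : Euc n), (u : Euc n)⟫) 0 := by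
  have hν := isNormal_outerNormal hz
  have hu := hν.inner_pos_of_hits hK.isCompact hy
  rw [hasDerivAt_iff_isLittleO, Asymptotics.isLittleO_iff]
  intro ε hε
  filter_upwards [eventually_mem_wulffVar hK hf hz hu hε] with t ht
  rw [topPoint, add_assoc, ← add_smul] at ht
  have h1 := le_topLine (isCompact_wulffVar hK.isCompact hf t) ht
  have h2 := topLine_wulffVar_le hK.isCompact hf hν hu ⟨_, ht⟩
  simp only [wulffVar_zero hK, sub_zero, smul_eq_mul, Real.norm_eq_abs]
  have := mul_nonneg hε.le (abs_nonneg t)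
  rw [abs_le]
  constructor <;> linarith!

theorem chordLen_pos {K : Set (Euc n)} (hK : IsCompact K) {u : Sph n} {y : Euc n}
    (hy : Hits (interior K) u y) : 0 < chordLen K u y := by
  obtain ⟨τ, hτ⟩ := hy
  have hc : Continuous fun σ : ℝ => y + σ • (u : Euc n) := by fun_prop
  have h1 : ∀ᶠ σ : ℝ in 𝓝 τ, y + σ • (u : Euc n) ∈ interior K :=
    hc.continuousAt.eventually_mem (isOpen_interior.mem_nhds hτ)
  obtain ⟨ε, hε, h1⟩ := Metric.eventually_nhds_iff.1 h1
  have h2 := le_topLine hK (interior_subset (h1 (y := τ + ε / 2) (by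
    rw [Real.dist_eq, add_sub_cancel_left, abs_of_pos] <;> linarith)))
  have h3 := neg_topLine_neg_le hK (interior_subset hτ)
  rw [chordLen]
  linarith

open Classical in
/-- First variation of the power `ℓ ^ (1 - s)` of the length of a chord. -/
def chordRate [Nonempty (Sph n)] (s : ℝ) (K : Set (Euc n)) (f : Sph n → ℝ) (p : Sph n × Euc n) :
    ℝ :=
  if Hits K p.1 p.2 then (1 - s) * (chordLen K p.1 p.2 ^ (-s) *
    (f (outerNormal K (topPoint K p.1 p.2)) /
        ⟪(outerNormal K (topPoint K p.1 p.2) : Euc n), (p.1 : Euc n)⟫ +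
      f (outerNormal K (topPoint K (-p.1) p.2)) /
        ⟪(outerNormal K (topPoint K (-p.1) p.2) : Euc n), ((-p.1 : Sph n) : Euc n)⟫)) else 0

/-- The lines meeting the interior of `K` whose two endpoints are regular boundary points. -/
def RegularLine (K : Set (Euc n)) (p : Sph n × Euc n) : Prop :=
  Hits (interior K) p.1 p.2 ∧ topPoint K p.1 p.2 ∈ regularPoints K ∧
    topPoint K (-p.1) p.2 ∈ regularPoints K

theorem hasDerivAt_chordLen_rpow [Nonempty (Sph n)] {K : Set (Euc n)} (hK : IsConvexBody K)
    {f : Sph n → ℝ} (hf : Continuous f) (s : ℝ) {p : Sph n × Euc n} (hp : RegularLine K p) :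
    HasDerivAt (fun t => chordLen (wulffVar K f t) p.1 p.2 ^ (1 - s)) (chordRate s K f p) 0 := by
  obtain ⟨hi, h1, h2⟩ := hp
  have d := (hasDerivAt_topLine_wulffVar hK hf hi h1).add
    (hasDerivAt_topLine_wulffVar hK hf (hits_neg.2 hi) h2)
  have hpos := chordLen_pos hK.isCompact hi
  have d2 := d.rpow_const (p := 1 - s) (Or.inl (by
    simp only [Pi.add_apply, wulffVar_zero hK]; exact hpos.ne'))
  convert d2 using 1
  · rfl
  rw [chordRate, if_pos (hi.mono interior_subset)]
  simp only [Pi.add_apply, wulffVar_zero hK]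
  rw [show 1 - s - 1 = -s by ring, chordLen]
  ring

theorem ae_lineMeasure_of_forall {s : ℝ} {L : Set (Euc n)} (hL : IsSymmConvexBody L)
    {S : Set (Sph n × Euc n)} (hS : MeasurableSet S)
    (h : ∀ᵐ u ∂((volume : Measure (Euc n)).toSphere), ∀ᵐ y ∂(volume.restrict (slab u)), (u, y) ∈ S) :
    ∀ᵐ p ∂(lineMeasure s L), p ∈ S := by
  rw [ae_iff, show {p | p ∉ S} = Sᶜ from rfl, ← lintegral_indicator_one hS.compl,
    lintegral_lineMeasure s hL (measurable_one.indicator hS.compl)]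
  refine lintegral_eq_zero_of_ae_eq_zero ?_
  filter_upwards [h] with u hu
  rw [Pi.zero_apply, mul_eq_zero]
  right
  refine lintegral_eq_zero_of_ae_eq_zero ?_
  filter_upwards [hu] with y hy
  simp [hy]

theorem ae_regularLine {s : ℝ} {K L : Set (Euc n)} (hK : IsConvexBody K)
    (hL : IsSymmConvexBody L) :
    ∀ᵐ p ∂(lineMeasure s L), Hits K p.1 p.2 → RegularLine K p := by
  have hneg : Measurable fun p : Sph n × Euc n => (-p.1, p.2) :=
    ((continuous_neg.comp continuous_fst).prodMk continuous_snd).measurable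
  have ht := measurable_topPoint hK.isCompact
  have hR := measurableSet_regularPoints hK
  have hm : MeasurableSet {p : Sph n × Euc n | Hits K p.1 p.2 → RegularLine K p} := by
    refine MeasurableSet.imp (isClosed_hits hK.isCompact).measurableSet ?_
    exact (isOpen_hits isOpen_interior).measurableSet.inter
      ((ht hR).inter ((ht.comp hneg) hR))
  refine ae_lineMeasure_of_forall hL hm (ae_of_all _ fun u => ?_)
  have h2 := ae_topPoint_mem_regularPoints hK (-u)
  rw [slab_neg] at h2
  filter_upwards [ae_topPoint_mem_regularPoints hK u, h2] with y hy hy' h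
  exact ⟨(hy h).1, (hy h).2, (hy' (hits_neg.2 h)).2⟩

theorem ofReal_chordRate [Nonempty (Sph n)] {s : ℝ} (hs1 : s < 1) {K : Set (Euc n)}
    (hK : IsConvexBody K) {f : Sph n → ℝ} (hf : ∀ v, 0 ≤ f v) {p : Sph n × Euc n}
    (hp : Hits K p.1 p.2 → RegularLine K p) :
    ENNReal.ofReal (chordRate s K f p) = ENNReal.ofReal (1 - s) *
      (topRate s K (fun v => ENNReal.ofReal (f v)) p +
        topRate s K (fun v => ENNReal.ofReal (f v)) (-p.1, p.2)) := by
  by_cases h : Hits K p.1 p.2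
  swap
  · rw [chordRate, topRate, topRate, if_neg h, if_neg h, if_neg (mt hits_neg.1 h)]
    simp
  obtain ⟨hi, h1, h2⟩ := hp h
  have hp1 := (isNormal_outerNormal h1).inner_pos_of_hits hK.isCompact hi
  have hp2 := (isNormal_outerNormal h2).inner_pos_of_hits hK.isCompact (hits_neg.2 hi)
  have hl := Real.rpow_nonneg (chordLen_nonneg hK.isCompact p.1 p.2) (-s)
  rw [chordRate, topRate, topRate, if_pos h, if_pos h, if_pos (hits_neg.2 h)]
  dsimp only
  rw [chordLen_neg, ← ENNReal.ofReal_div_of_pos hp1, ← ENNReal.ofReal_div_of_pos hp2, ← mul_add,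
    ← ENNReal.ofReal_add (div_nonneg (hf _) hp1.le) (div_nonneg (hf _) hp2.le),
    ← ENNReal.ofReal_mul hl, ← ENNReal.ofReal_mul (by linarith)]

/-- The rate is the sum of the contributions of the two endpoints, which have the same integral by
reversal of orientation; hence the factor `2`. -/
theorem lintegral_chordRate [Nonempty (Sph n)] {s : ℝ} (hs : 0 < s) (hs1 : s < 1)
    {K L : Set (Euc n)} (hK : IsConvexBody K) (hL : IsSymmConvexBody L) {f : Sph n → ℝ}
    (hf : ∀ v, 0 ≤ f v) (hfm : Measurable f) :
    ∫⁻ p, ENNReal.ofReal (chordRate s K f p) ∂(lineMeasure s L) =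
      ENNReal.ofReal (s * (1 - s)) * (2 * ∫⁻ v, ENNReal.ofReal (f v) ∂(fracAreaMeasure s K L)) := by
  have hg : Measurable fun v => ENNReal.ofReal (f v) := hfm.ennreal_ofReal
  have hm := measurable_topRate s hK hg
  have hneg : Measurable fun p : Sph n × Euc n => (-p.1, p.2) :=
    ((continuous_neg.comp continuous_fst).prodMk continuous_snd).measurable
  have hm' : Measurable fun p : Sph n × Euc n =>
    topRate s K (fun v => ENNReal.ofReal (f v)) (-p.1, p.2) := hm.comp hneg
  have e : ∫⁻ p, ENNReal.ofReal (chordRate s K f p) ∂(lineMeasure s L) = ∫⁻ p,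
      ENNReal.ofReal (1 - s) * (topRate s K (fun v => ENNReal.ofReal (f v)) p +
        topRate s K (fun v => ENNReal.ofReal (f v)) (-p.1, p.2)) ∂(lineMeasure s L) := by
    refine lintegral_congr_ae ?_
    filter_upwards [ae_regularLine hK hL] with p hp
    exact ofReal_chordRate hs1 hK hf hp
  have hadd : Measurable fun p : Sph n × Euc n => topRate s K (fun v => ENNReal.ofReal (f v)) p +
      topRate s K (fun v => ENNReal.ofReal (f v)) (-p.1, p.2) := hm.add hm'
  rw [e, lintegral_const_mul _ hadd, lintegral_add_left hm,
    lintegral_lineMeasure_neg s hL hm, lintegral_topRate hs hK hL hg, ENNReal.ofReal_mul hs.le]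
  ring

/-! ### Scaling and finiteness -/

theorem lintegral_eq_mul_lintegral_comp_smul (f : Euc n → ℝ≥0∞) {r : ℝ} (hr : 0 < r) :
    ∫⁻ y, f y = ENNReal.ofReal (r ^ n) * ∫⁻ y, f (r • y) := by
  have h1 := lintegral_map_equiv (μ := (volume : Measure (Euc n))) f
    (Homeomorph.smulOfNeZero r hr.ne').toMeasurableEquiv
  have h2 := Measure.map_addHaar_smul (volume : Measure (Euc n)) hr.ne'
  simp only [finrank_euclideanSpace, Fintype.card_fin] at h2
  have hp : 0 < r ^ n := pow_pos hr n
  have h3 : ∫⁻ y, f (r • y) = ∫⁻ y, f y ∂(Measure.map (r • ·) volume) := h1.symm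
  rw [h3, h2, lintegral_smul_measure, smul_eq_mul, ← mul_assoc, ← ENNReal.ofReal_mul hp.le,
    abs_of_pos (inv_pos.2 hp), mul_inv_cancel₀ hp.ne', ENNReal.ofReal_one, one_mul]

theorem fracPerimeter_eq_lintegral_indicator (s : ℝ) {K : Set (Euc n)} (hK : MeasurableSet K)
    (L : Set (Euc n)) :
    fracPerimeter s K L = ∫⁻ y, K.indicator (fun y => ∫⁻ x, Kᶜ.indicator
      (fun x => ENNReal.ofReal (1 / gauge L (x - y) ^ ((n : ℝ) + s))) x) y := by
  rw [fracPerimeter, ← lintegral_indicator hK]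
  simp_rw [← lintegral_indicator hK.compl]

open scoped Pointwise in
theorem fracPerimeter_smul {s : ℝ} {K : Set (Euc n)} (hK : IsCompact K) (L : Set (Euc n)) {r : ℝ}
    (hr : 0 < r) :
    fracPerimeter s (r • K) L = ENNReal.ofReal (r ^ ((n : ℝ) - s)) * fracPerimeter s K L := by
  have hKm : MeasurableSet K := hK.isClosed.measurableSet
  have hm : ∀ x : Euc n, r • x ∈ r • K ↔ x ∈ K := fun x => smul_mem_smul_set_iff₀ hr.ne' _ _
  have hp : 0 < r ^ n := pow_pos hr n
  rw [fracPerimeter_eq_lintegral_indicator s (hK.smul r).isClosed.measurableSet,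
    fracPerimeter_eq_lintegral_indicator s hKm, lintegral_eq_mul_lintegral_comp_smul _ hr]
  have key : ∀ y : Euc n, (r • K).indicator (fun y => ∫⁻ x, (r • K)ᶜ.indicator
      (fun x => ENNReal.ofReal (1 / gauge L (x - y) ^ ((n : ℝ) + s))) x) (r • y) =
      ENNReal.ofReal (r ^ (-s)) * K.indicator (fun y => ∫⁻ x, Kᶜ.indicator
      (fun x => ENNReal.ofReal (1 / gauge L (x - y) ^ ((n : ℝ) + s))) x) y := by
    intro y
    by_cases hy : y ∈ K
    swap
    · rw [indicator_of_notMem hy, indicator_of_notMem (by rwa [hm]), mul_zero]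
    rw [indicator_of_mem hy, indicator_of_mem (by rwa [hm]),
      lintegral_eq_mul_lintegral_comp_smul _ hr, ← lintegral_const_mul' _ _ ENNReal.ofReal_ne_top,
      ← lintegral_const_mul' _ _ ENNReal.ofReal_ne_top]
    refine lintegral_congr fun x => ?_
    by_cases hx : x ∈ K
    · rw [indicator_of_notMem (by simpa [hm] using hx),
        indicator_of_notMem (by simpa using hx), mul_zero, mul_zero]
    · rw [indicator_of_mem (by simpa [hm] using hx), indicator_of_mem (by simpa using hx),
        ← ENNReal.ofReal_mul hp.le, ← ENNReal.ofReal_mul (Real.rpow_nonneg hr.le _), ← smul_sub,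
        gauge_smul_of_nonneg hr.le, smul_eq_mul, Real.mul_rpow hr.le (gauge_nonneg _),
        Real.rpow_neg hr.le, Real.rpow_add hr, Real.rpow_natCast]
      congr 1
      have := Real.rpow_pos_of_pos hr s
      rw [one_div, one_div, mul_inv, mul_inv]
      field_simp
  simp_rw [key]
  rw [lintegral_const_mul' _ _ ENNReal.ofReal_ne_top, ← mul_assoc, ← ENNReal.ofReal_mul hp.le,
    Real.rpow_sub hr, Real.rpow_natCast, Real.rpow_neg hr.le, div_eq_mul_inv]

/-- The `(1 - s)`-energy of the chords of `K`. -/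
def chordEnergy (s : ℝ) (K L : Set (Euc n)) : ℝ≥0∞ :=
  ∫⁻ p, ENNReal.ofReal (chordLen K p.1 p.2 ^ (1 - s)) ∂(lineMeasure s L)

theorem measurable_ofReal_chordLen_rpow (s : ℝ) {K : Set (Euc n)} (hK : IsCompact K) :
    Measurable fun p : Sph n × Euc n => ENNReal.ofReal (chordLen K p.1 p.2 ^ (1 - s)) :=
  ((measurable_chordLen hK).pow_const _).ennreal_ofReal

-- Deduced from the scaling of the perimeter rather than from `lineMeasure`, whose slabs have fixed
-- width.
open scoped Pointwise in
theorem chordEnergy_smul (hn : 1 ≤ n) {s : ℝ} (hs : 0 < s) (hs1 : s < 1) {K L : Set (Euc n)}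
    (hK : IsCompact K) (hc : Convex ℝ K) (hL : IsSymmConvexBody L) {r : ℝ} (hr : 0 < r) :
    chordEnergy s (r • K) L = ENNReal.ofReal (r ^ ((n : ℝ) - s)) * chordEnergy s K L := by
  have h := fracPerimeter_smul (s := s) hK L hr
  have hpos : 0 < 1 / (s * (1 - s)) := one_div_pos.2 (mul_pos hs (by linarith))
  rw [fracPerimeter_eq hn hs hs1 (hK.smul r) (hc.smul r) hL, fracPerimeter_eq hn hs hs1 hK hc hL,
    mul_left_comm, ENNReal.mul_right_inj (ENNReal.ofReal_pos.2 hpos).ne' ENNReal.ofReal_ne_top] at h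
  exact h

theorem lintegral_lineMeasure_hits_lt_top {s : ℝ} (hs : 0 < s) {K L : Set (Euc n)}
    (hK : IsCompact K) (hL : IsSymmConvexBody L) :
    lineMeasure s L {p | Hits K p.1 p.2} < ∞ := by
  obtain ⟨C, -, hC⟩ := exists_volume_slab_inter_hits_le hK
  obtain ⟨W, hW⟩ := exists_radialWeight_le hs hL
  have hm := (isClosed_hits hK).measurableSet
  rw [← lintegral_indicator_one hm, lintegral_lineMeasure s hL (measurable_one.indicator hm)]
  calc _ ≤ ∫⁻ _u : Sph n, ENNReal.ofReal W * ENNReal.ofReal C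
        ∂((volume : Measure (Euc n)).toSphere) := by
        refine lintegral_mono fun u => mul_le_mul' (hW u) ?_
        have e : (fun y => {p : Sph n × Euc n | Hits K p.1 p.2}.indicator (1 : Sph n × Euc n → ℝ≥0∞) (u, y)) =
          {y | Hits K u y}.indicator 1 := rfl
        rw [e, lintegral_indicator_one (measurableSet_hits hK u),
          Measure.restrict_apply (measurableSet_hits hK u), inter_comm]
        exact hC u
    _ < ∞ := by
        rw [lintegral_const]
        exact ENNReal.mul_lt_top (ENNReal.mul_lt_top ENNReal.ofReal_lt_top ENNReal.ofReal_lt_top)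
          (measure_lt_top _ _)

theorem exists_chordLen_le {K : Set (Euc n)} (hK : IsCompact K) :
    ∃ R : ℝ, ∀ u y, chordLen K u y ≤ R := by
  obtain ⟨R, hR⟩ := hK.isBounded.exists_norm_le
  refine ⟨|R| + |R|, fun u y => ?_⟩
  by_cases h : Hits K u y
  swap
  · rw [chordLen_of_not_hits h]; positivity
  have h1 := hR _ (topLine_mem hK h)
  have h2 := hR _ (topLine_mem hK (hits_neg.2 h))
  have e : chordLen K u y • (u : Euc n) = (y + topLine K u y • (u : Euc n)) -
      (y + topLine K (-u) y • ((-u : Sph n) : Euc n)) := by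
    rw [add_smul_neg_sphere, chordLen, add_smul, neg_smul]; abel
  have h3 : ‖chordLen K u y • (u : Euc n)‖ = chordLen K u y := by
    rw [norm_smul, norm_eq_of_mem_sphere u, mul_one, Real.norm_eq_abs,
      abs_of_nonneg (chordLen_nonneg hK u y)]
  rw [← h3, e]
  exact (norm_sub_le _ _).trans (add_le_add (h1.trans (le_abs_self R)) (h2.trans (le_abs_self R)))

theorem chordEnergy_lt_top {s : ℝ} (hs : 0 < s) (hs1 : s < 1) {K L : Set (Euc n)}
    (hK : IsCompact K) (hL : IsSymmConvexBody L) : chordEnergy s K L < ∞ := by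
  obtain ⟨R, hR⟩ := exists_chordLen_le hK
  have hm := (isClosed_hits hK).measurableSet
  calc chordEnergy s K L ≤ ∫⁻ p, {p : Sph n × Euc n | Hits K p.1 p.2}.indicator
        (fun _ => ENNReal.ofReal (R ^ (1 - s))) p ∂(lineMeasure s L) := by
        refine lintegral_mono fun p => ?_
        by_cases h : Hits K p.1 p.2
        · rw [indicator_of_mem (by exact h)]
          exact ENNReal.ofReal_le_ofReal
            (Real.rpow_le_rpow (chordLen_nonneg hK _ _) (hR _ _) (by linarith))
        · rw [chordLen_of_not_hits h, Real.zero_rpow (by linarith), ENNReal.ofReal_zero]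
          exact zero_le
    _ < ∞ := by
        rw [lintegral_indicator_const hm]
        exact ENNReal.mul_lt_top ENNReal.ofReal_lt_top (lintegral_lineMeasure_hits_lt_top hs hK hL)

theorem fracPerimeter_lt_top (hn : 1 ≤ n) {s : ℝ} (hs : 0 < s) (hs1 : s < 1) {K L : Set (Euc n)}
    (hK : IsCompact K) (hc : Convex ℝ K) (hL : IsSymmConvexBody L) : fracPerimeter s K L < ∞ := by
  rw [fracPerimeter_eq hn hs hs1 hK hc hL]
  exact ENNReal.mul_lt_top ENNReal.ofReal_lt_top (chordEnergy_lt_top hs hs1 hK hL)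

theorem wulffVar_mono {K : Set (Euc n)} {f g : Sph n → ℝ} (h : ∀ v, f v ≤ g v) {t : ℝ}
    (ht : 0 ≤ t) : wulffVar K f t ⊆ wulffVar K g t :=
  wulffShape_mono fun v => add_le_add le_rfl (mul_le_mul_of_nonneg_left (h v) ht)

theorem chordRate_sub [Nonempty (Sph n)] (s : ℝ) (K : Set (Euc n)) (f g : Sph n → ℝ)
    (p : Sph n × Euc n) :
    chordRate s K (fun v => g v - f v) p = chordRate s K g p - chordRate s K f p := by
  unfold chordRate
  split_ifs
  · ring
  · ring

/-! ### Lower bound by Fatou -/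

/-- Fatou's lemma for the difference of the chord energies of two monotone families. -/
theorem lintegral_le_liminf_chordEnergy_sub [Nonempty (Sph n)] {s : ℝ} (hs : 0 < s) (hs1 : s < 1)
    {K L : Set (Euc n)} (hK : IsConvexBody K) (hL : IsSymmConvexBody L) {f g : Sph n → ℝ}
    (hf : Continuous f) (hg : Continuous g) (hfg : ∀ v, f v ≤ g v) :
    ENNReal.ofReal (s * (1 - s)) *
        (2 * ∫⁻ v, ENNReal.ofReal (g v - f v) ∂(fracAreaMeasure s K L)) ≤
      liminf (fun t : ℝ => (ENNReal.ofReal t)⁻¹ *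
        (chordEnergy s (wulffVar K g t) L - chordEnergy s (wulffVar K f t) L)) (𝓝[>] 0) := by
  have hKf := isCompact_wulffVar hK.isCompact hf
  have hKg := isCompact_wulffVar hK.isCompact hg
  rw [← lintegral_chordRate hs hs1 hK hL (fun v => sub_nonneg.2 (hfg v)) (hg.sub hf).measurable]
  -- For `t > 0` the inclusion of the two Wulff shapes makes this truncated subtraction a genuine
  -- one, so the quotients are suited to Fatou.
  set Φ : ℝ → Sph n × Euc n → ℝ≥0∞ := fun t p => (ENNReal.ofReal t)⁻¹ *
    (ENNReal.ofReal (chordLen (wulffVar K g t) p.1 p.2 ^ (1 - s)) -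
      ENNReal.ofReal (chordLen (wulffVar K f t) p.1 p.2 ^ (1 - s)))
  have hΦm : ∀ t, Measurable (Φ t) := fun t =>
    ((measurable_ofReal_chordLen_rpow s (hKg t)).sub
      (measurable_ofReal_chordLen_rpow s (hKf t))).const_mul _
  have hint : ∀ᶠ t : ℝ in 𝓝[>] 0, ∫⁻ p, Φ t p ∂(lineMeasure s L) = (ENNReal.ofReal t)⁻¹ *
      (chordEnergy s (wulffVar K g t) L - chordEnergy s (wulffVar K f t) L) := by
    filter_upwards [self_mem_nhdsWithin] with t ht
    have hm : Measurable fun p : Sph n × Euc n =>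
      ENNReal.ofReal (chordLen (wulffVar K g t) p.1 p.2 ^ (1 - s)) -
        ENNReal.ofReal (chordLen (wulffVar K f t) p.1 p.2 ^ (1 - s)) :=
      (measurable_ofReal_chordLen_rpow s (hKg t)).sub (measurable_ofReal_chordLen_rpow s (hKf t))
    rw [lintegral_const_mul _ hm, lintegral_sub (measurable_ofReal_chordLen_rpow s (hKf t))]
    · rfl
    · exact (chordEnergy_lt_top hs hs1 (hKf t) hL).ne
    · refine ae_of_all _ fun p => ENNReal.ofReal_le_ofReal ?_
      exact Real.rpow_le_rpow (chordLen_nonneg (hKf t) _ _)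
        (chordLen_mono (hKf t) (hKg t) (wulffVar_mono hfg (le_of_lt ht)) _ _) (by linarith)
  calc _ ≤ ∫⁻ p, liminf (fun t => Φ t p) (𝓝[>] 0) ∂(lineMeasure s L) := by
        refine lintegral_mono_ae ?_
        filter_upwards [ae_regularLine hK hL] with p hp
        by_cases h : Hits K p.1 p.2
        swap
        · rw [chordRate, if_neg h, ENNReal.ofReal_zero]; exact zero_le
        have hd := (hasDerivAt_chordLen_rpow hK hg s (hp h)).sub
          (hasDerivAt_chordLen_rpow hK hf s (hp h))
        rw [← chordRate_sub] at hd
        have hd2 := (ENNReal.continuous_ofReal.tendsto _).comp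
          (hasDerivAt_iff_tendsto_slope_zero.1 hd |>.mono_left (nhdsGT_le_nhdsNE (0 : ℝ)))
        refine le_of_eq (Tendsto.liminf_eq ?_).symm
        refine hd2.congr' ?_
        filter_upwards [self_mem_nhdsWithin] with t ht
        have ht : 0 < t := ht
        simp only [Function.comp_apply, Pi.sub_apply, zero_add, wulffVar_zero hK, sub_self,
          sub_zero, smul_eq_mul, Φ]
        rw [ENNReal.ofReal_mul (inv_pos.2 ht).le, ENNReal.ofReal_inv_of_pos ht,
          ENNReal.ofReal_sub _ (Real.rpow_nonneg (chordLen_nonneg (hKf t) _ _) _)]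
    _ ≤ _ := lintegral_liminf_le' fun t => (hΦm t).aemeasurable
    _ = _ := liminf_congr hint

/-! ### Lines meeting a dilate of `K` but not `K` -/

section Layer

open scoped Pointwise

theorem wulffVar_supportFun {K : Set (Euc n)} (hK : IsConvexBody K) {t : ℝ} (ht : 0 < 1 + t) :
    wulffVar K (supportFun K) t = (1 + t) • K := by
  ext x
  have e : (1 + t)⁻¹ • x ∈ K ↔ (1 + t)⁻¹ • x ∈ wulffShape (supportFun K) := by
    rw [wulffShape_supportFun hK]
  rw [mem_smul_set_iff_inv_smul_mem₀ ht.ne', e]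
  refine forall_congr' fun v => ?_
  rw [inner_smul_right, inv_mul_le_iff₀ ht, add_mul, one_mul]

/-- Both ends obey `topLine_wulffVar_le`, and the concave function `x^(1-s)` lies below its tangent
(Bernoulli). The result is an upper bound linear in `t` with no remainder. -/
theorem chordLen_wulffVar_rpow_le [Nonempty (Sph n)] {s : ℝ} (hs : 0 < s) (hs1 : s < 1)
    {K : Set (Euc n)} (hK : IsConvexBody K) {f : Sph n → ℝ} (hf : Continuous f)
    {p : Sph n × Euc n} (hp : RegularLine K p) {t : ℝ} (ht : Hits (wulffVar K f t) p.1 p.2) :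
    chordLen (wulffVar K f t) p.1 p.2 ^ (1 - s) ≤
      chordLen K p.1 p.2 ^ (1 - s) + t * chordRate s K f p := by
  obtain ⟨hi, h1, h2⟩ := hp
  have hν1 := isNormal_outerNormal h1
  have hν2 := isNormal_outerNormal h2
  have a1 := topLine_wulffVar_le hK.isCompact hf hν1 (hν1.inner_pos_of_hits hK.isCompact hi) ht
  have a2 := topLine_wulffVar_le hK.isCompact hf hν2
    (hν2.inner_pos_of_hits hK.isCompact (hits_neg.2 hi)) (hits_neg.2 ht)
  have hpos := chordLen_pos hK.isCompact hi
  have hnn := chordLen_nonneg (isCompact_wulffVar hK.isCompact hf t) p.1 p.2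
  rw [chordRate, if_pos (hi.mono interior_subset)]
  set δ := f (outerNormal K (topPoint K p.1 p.2)) /
        ⟪(outerNormal K (topPoint K p.1 p.2) : Euc n), (p.1 : Euc n)⟫ +
      f (outerNormal K (topPoint K (-p.1) p.2)) /
        ⟪(outerNormal K (topPoint K (-p.1) p.2) : Euc n), ((-p.1 : Sph n) : Euc n)⟫ with hδ
  set l := chordLen K p.1 p.2 with hl
  have hle : chordLen (wulffVar K f t) p.1 p.2 ≤ l + t * δ := by
    rw [hl, hδ, chordLen, chordLen]
    linarith
  have e : l + t * δ = l * (1 + t * δ / l) := by field_simp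
  have h0 : -1 ≤ t * δ / l := by
    rw [le_div_iff₀ hpos]
    linarith
  calc _ ≤ (l + t * δ) ^ (1 - s) := Real.rpow_le_rpow hnn hle (by linarith)
    _ = l ^ (1 - s) * (1 + t * δ / l) ^ (1 - s) := by
        rw [e, Real.mul_rpow hpos.le (by linarith)]
    _ ≤ l ^ (1 - s) * (1 + (1 - s) * (t * δ / l)) :=
        mul_le_mul_of_nonneg_left
          (rpow_one_add_le_one_add_mul_self h0 (by linarith) (by linarith))
          (Real.rpow_nonneg hpos.le _)
    _ = _ := by
        rw [Real.rpow_sub hpos, Real.rpow_one, Real.rpow_neg hpos.le]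
        field_simp

theorem subset_smul_of_one_le {K : Set (Euc n)} (hc : Convex ℝ K) (h0 : (0 : Euc n) ∈ K) {r : ℝ}
    (hr : 1 ≤ r) : K ⊆ r • K := fun x hx => by
  rw [mem_smul_set_iff_inv_smul_mem₀ (by linarith)]
  exact hc.smul_mem_of_zero_mem h0 hx ⟨inv_nonneg.2 (by linarith), inv_le_one_of_one_le₀ hr⟩

theorem volume_sdiff_le_of_subset_smul {S T : Set (Euc n)} (hS : NullMeasurableSet S)
    (hfin : volume S ≠ ∞) (hST : S ⊆ T) {r : ℝ} (hr : 1 ≤ r) (hT : T ⊆ r • S) :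
    volume (T \ S) ≤ ENNReal.ofReal (r ^ n - 1) * volume S := by
  rw [measure_sdiff hST hS hfin, tsub_le_iff_right]
  calc volume T ≤ volume (r • S) := measure_mono hT
    _ = ENNReal.ofReal (r ^ n - 1 + 1) * volume S := by
        rw [Measure.addHaar_smul_of_nonneg _ (by linarith), finrank_euclideanSpace,
          Fintype.card_fin, sub_add_cancel]
    _ = _ := by
        rw [ENNReal.ofReal_add (sub_nonneg.2 (one_le_pow₀ hr)) zero_le_one, add_mul,
          ENNReal.ofReal_one, one_mul]

/-- Contraction by `r⁻¹` keeps the slab inside itself and sends lines meeting `r • K` to lines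
meeting `K`, so the larger set lies in the `r`-dilate of the smaller one. -/
theorem volume_slab_inter_hits_smul_sdiff_le {K : Set (Euc n)} (hK : IsCompact K)
    (hc : Convex ℝ K) (h0 : (0 : Euc n) ∈ K) (u : Sph n) {r : ℝ} (hr : 1 ≤ r) :
    volume ((slab u ∩ {y | Hits (r • K) u y}) \ (slab u ∩ {y | Hits K u y})) ≤
      ENNReal.ofReal (r ^ n - 1) * volume (slab u ∩ {y | Hits K u y}) := by
  have hr0 : 0 < r := by linarith
  refine volume_sdiff_le_of_subset_smul
    ((measurableSet_slab u).inter (measurableSet_hits hK u)).nullMeasurableSet ?_ ?_ hr ?_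
  · obtain ⟨C, -, hC⟩ := exists_volume_slab_inter_hits_le hK
    exact ((hC u).trans_lt ENNReal.ofReal_lt_top).ne
  · exact inter_subset_inter_right _ fun y hy => Hits.mono hy (subset_smul_of_one_le hc h0 hr)
  · rintro y ⟨hy, τ, hτ⟩
    rw [mem_smul_set_iff_inv_smul_mem₀ hr0.ne'] at hτ ⊢
    refine ⟨?_, r⁻¹ * τ, by rwa [smul_add, smul_smul] at hτ⟩
    have hy : |⟪(u : Euc n), y⟫| ≤ 1 / 2 := abs_le.2 hy
    refine abs_le.1 ?_
    rw [inner_smul_right, abs_mul, abs_of_pos (inv_pos.2 hr0)]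
    exact (mul_le_of_le_one_left (abs_nonneg _) (inv_le_one_of_one_le₀ hr)).trans hy

/-- Each line missing `K` contributes the length of its chord in `K'`; together these chords fill
the part of `K'` outside the cylinder over `K` of direction `u`. -/
theorem setLIntegral_slab_indicator_chordLen {K K' : Set (Euc n)} (hK : IsCompact K)
    (hK' : IsCompact K') (hc : Convex ℝ K') (u : Sph n) :
    ∫⁻ y in slab u, {y | Hits K u y}ᶜ.indicator
        (fun y => ENNReal.ofReal (chordLen K' u y)) y =
      volume (K' \ {y | Hits K u y}) := by
  have hm : MeasurableSet (K' \ {y | Hits K u y}) :=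
    hK'.isClosed.measurableSet.diff (measurableSet_hits hK u)
  rw [← lintegral_indicator_one hm,
    ← setLIntegral_slab_lintegral_line u (measurable_one.indicator hm)]
  refine lintegral_congr fun y => ?_
  have hm2 : MeasurableSet {τ : ℝ | y + τ • (u : Euc n) ∈ K' \ {y | Hits K u y}} :=
    hm.preimage (by fun_prop)
  have e : (fun τ : ℝ => (K' \ {y | Hits K u y}).indicator (1 : Euc n → ℝ≥0∞)
      (y + τ • (u : Euc n))) =
        {τ : ℝ | y + τ • (u : Euc n) ∈ K' \ {y | Hits K u y}}.indicator 1 := rfl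
  rw [e, lintegral_indicator_one hm2]
  by_cases h : Hits K u y
  · rw [indicator_of_notMem (by simpa using h)]
    symm
    convert measure_empty (μ := (volume : Measure ℝ))
    ext τ
    simpa [hits_add_smul] using fun _ => h
  · rw [indicator_of_mem (by simpa using h), ← volume_line hK' hc]
    congr 1
    ext τ
    simpa [hits_add_smul] using fun _ => h

/-- The pairs `(u, w)` such that the gauge of `K` nearly attains at `w` its minimum on the line
through `w` of direction `u`. -/
def shadeCone (K : Set (Euc n)) (t : ℝ) : Set (Sph n × Euc n) :=
  {p | ∀ τ : ℝ, gauge K p.2 ≤ (1 + t) * gauge K (p.2 + τ • (p.1 : Euc n))}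

theorem measurableSet_shadeCone {K : Set (Euc n)} (hc : Convex ℝ K)
    (h0 : (0 : Euc n) ∈ interior K) (t : ℝ) : MeasurableSet (shadeCone K t) := by
  have hg := continuous_gauge' hc h0
  have : shadeCone K t = ⋂ τ : ℝ,
      {p : Sph n × Euc n | gauge K p.2 ≤ (1 + t) * gauge K (p.2 + τ • (p.1 : Euc n))} := by
    ext p
    simp [shadeCone]
  rw [this]
  exact (isClosed_iInter fun τ => isClosed_le (by fun_prop)
    (continuous_const.mul (hg.comp (by fun_prop)))).measurableSet

/-- A point `w` of the dilate whose line misses `K` has gauge at most `1 + t`, while the gauge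
exceeds `1` on the whole line, so `w` is in the shade cone and outside `K`. The cone is invariant
under dilation, whence its part in this layer is at most `(1+t)^n - 1` times its part in `K`. -/
theorem volume_smul_sdiff_hits_le {K : Set (Euc n)} (hK : IsCompact K)
    (hc : Convex ℝ K) (h0 : (0 : Euc n) ∈ interior K) (u : Sph n) {t : ℝ} (ht : 0 ≤ t) :
    volume (((1 + t) • K) \ {y | Hits K u y}) ≤
      ENNReal.ofReal ((1 + t) ^ n - 1) * volume.restrict K (Prod.mk u ⁻¹' shadeCone K t) := by
  have hr : 1 ≤ 1 + t := by linarith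
  have hr0 : 0 < 1 + t := by linarith
  have hcone : MeasurableSet (Prod.mk u ⁻¹' shadeCone K t) :=
    measurable_prodMk_left (measurableSet_shadeCone hc h0 t)
  have hsub := subset_smul_of_one_le hc (interior_subset h0) hr
  set C := Prod.mk u ⁻¹' shadeCone K t
  rw [Measure.restrict_apply hcone]
  refine le_trans (measure_mono (t := (C ∩ (1 + t) • K) \ (C ∩ K)) ?_)
    (volume_sdiff_le_of_subset_smul (hcone.inter hK.isClosed.measurableSet).nullMeasurableSet
      ((measure_mono inter_subset_right).trans_lt hK.measure_lt_top).ne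
      (inter_subset_inter_right _ hsub) hr ?_)
  · rintro w ⟨hw, hmiss⟩
    refine ⟨⟨fun τ => ?_, hw⟩, fun h => hmiss (hits_of_mem h.2)⟩
    have h1 : gauge K w ≤ 1 + t := gauge_le_of_mem hr0.le hw
    have h2 : 1 < gauge K (w + τ • (u : Euc n)) := by
      by_contra! h
      exact hmiss ⟨τ, (gauge_le_one_iff hK hc h0).1 h⟩
    exact h1.trans (le_mul_of_one_le_right hr0.le h2.le)
  · rintro w ⟨hw, hwK⟩
    rw [mem_smul_set_iff_inv_smul_mem₀ hr0.ne'] at hwK ⊢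
    refine ⟨fun τ => ?_, hwK⟩
    have h1 := mul_le_mul_of_nonneg_left (hw ((1 + t) * τ)) (inv_pos.2 hr0).le
    have e : (1 + t)⁻¹ • w + τ • (u : Euc n) = (1 + t)⁻¹ • (w + ((1 + t) * τ) • (u : Euc n)) := by
      rw [smul_add, smul_smul, inv_mul_cancel_left₀ hr0.ne']
    dsimp only
    rw [e, gauge_smul_of_nonneg (inv_pos.2 hr0).le, gauge_smul_of_nonneg (inv_pos.2 hr0).le,
      smul_eq_mul, smul_eq_mul]
    linarith

/-- At almost every point the gauge of `K` is differentiable with nonzero differential, so that it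
is minimal only along a null set of directions. -/
theorem measure_shadeCone_zero (hn : 1 ≤ n) {K : Set (Euc n)} (hK : IsCompact K)
    (hc : Convex ℝ K) (h0 : (0 : Euc n) ∈ interior K) :
    ((volume : Measure (Euc n)).toSphere.prod (volume.restrict K)) (shadeCone K 0) = 0 := by
  have : NeZero n := ⟨by omega⟩
  have hm := measurableSet_shadeCone hc h0 0
  rw [Measure.prod_apply_symm hm]
  refine lintegral_eq_zero_of_ae_eq_zero ?_
  obtain ⟨C, hC⟩ := hc.lipschitz_gauge (mem_interior_iff_mem_nhds.1 h0)
  have hne : ∀ᵐ w : Euc n, w ≠ 0 := by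
    rw [ae_iff]
    simp
  refine ae_restrict_of_ae ?_
  filter_upwards [hC.ae_differentiableAt (μ := volume), hne] with w hd hw
  have hpos := gauge_pos_of_ne hK h0 hw
  set a := (InnerProductSpace.toDual ℝ (Euc n)).symm (fderiv ℝ (gauge K) w)
  have ha : ∀ x, fderiv ℝ (gauge K) w x = ⟪a, x⟫ := fun x =>
    (InnerProductSpace.toDual_symm_apply).symm
  have hline : ∀ x, HasDerivAt (fun τ : ℝ => gauge K (w + τ • x)) ⟪a, x⟫ 0 := by
    intro x
    have h1 : HasDerivAt (fun τ : ℝ => w + τ • x) x 0 := by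
      simpa using ((hasDerivAt_id (0 : ℝ)).smul_const x).const_add w
    rw [← ha]
    exact HasFDerivAt.comp_hasDerivAt (f := fun τ : ℝ => w + τ • x) 0
      (by simpa using hd.hasFDerivAt) h1
  -- Euler's relation for the 1-homogeneous gauge: its gradient at `w` pairs with `w` to a positive
  -- number and hence is nonzero.
  have haw : ⟪a, w⟫ = gauge K w := by
    refine (hline w).unique ?_
    have h1 : HasDerivAt (fun τ : ℝ => (1 + τ) * gauge K w) (gauge K w) 0 := by
      simpa using ((hasDerivAt_id (0 : ℝ)).const_add 1).mul_const (gauge K w)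
    refine h1.congr_of_eventuallyEq ?_
    filter_upwards [lt_mem_nhds (show (-1 : ℝ) < 0 by norm_num)] with τ hτ
    rw [show w + τ • w = (1 + τ) • w by rw [add_smul, one_smul],
      gauge_smul_of_nonneg (by linarith), smul_eq_mul]
  have ha0 : a ≠ 0 := by
    intro h
    rw [h, inner_zero_left] at haw
    exact hpos.ne haw
  refine measure_mono_null (fun u hu => ?_) (toSphere_setOf_inner_eq_zero ha0)
  have hmin : IsLocalMin (fun τ : ℝ => gauge K (w + τ • (u : Euc n))) 0 :=
    Eventually.of_forall fun τ => by simpa [shadeCone] using hu τ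
  exact hmin.hasDerivAt_eq_zero (hline u)

/-- The cones decrease to `shadeCone K 0` as `t ↓ 0`, and the measure is finite, so continuity from
above applies. -/
theorem tendsto_measure_shadeCone (hn : 1 ≤ n) {K : Set (Euc n)} (hK : IsCompact K)
    (hc : Convex ℝ K) (h0 : (0 : Euc n) ∈ interior K) :
    Tendsto (fun t => ((volume : Measure (Euc n)).toSphere.prod (volume.restrict K))
      (shadeCone K t)) (𝓝[>] 0) (𝓝 0) := by
  have : IsFiniteMeasure (volume.restrict K) := ⟨by
    rw [Measure.restrict_apply_univ]; exact hK.measure_lt_top⟩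
  have h := tendsto_measure_biInter_gt
    (μ := (volume : Measure (Euc n)).toSphere.prod (volume.restrict K)) (s := shadeCone K) (a := 0)
    (fun t _ => (measurableSet_shadeCone hc h0 t).nullMeasurableSet)
    (fun t t' _ htt p hp τ => (hp τ).trans
      (mul_le_mul_of_nonneg_right (by linarith) (gauge_nonneg _)))
    ⟨1, one_pos, measure_ne_top _ _⟩
  suffices h1 : ((volume : Measure (Euc n)).toSphere.prod (volume.restrict K))
      (⋂ t > (0 : ℝ), shadeCone K t) = 0 by rwa [h1] at h
  refine measure_mono_null (fun p hp => ?_) (measure_shadeCone_zero hn hK hc h0)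
  intro τ
  simp only [gt_iff_lt, mem_iInter] at hp
  have hlim : Tendsto (fun t : ℝ => (1 + t) * gauge K (p.2 + τ • (p.1 : Euc n))) (𝓝[>] 0)
      (𝓝 ((1 + 0) * gauge K (p.2 + τ • (p.1 : Euc n)))) :=
    (((continuous_const.add continuous_id).mul continuous_const).tendsto 0).mono_left
      nhdsWithin_le_nhds
  refine ge_of_tendsto hlim ?_
  filter_upwards [self_mem_nhdsWithin] with t ht
  exact hp t ht τ

end Layer

/-! ### Upper bound for the energy of a dilate -/

section Dilation

open scoped Pointwise

theorem lineMeasure_apply (s : ℝ) {L : Set (Euc n)} (hL : IsSymmConvexBody L)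
    {S : Set (Sph n × Euc n)} (hS : MeasurableSet S) :
    lineMeasure s L S = ∫⁻ u, radialWeight s L u * volume (slab u ∩ Prod.mk u ⁻¹' S)
      ∂((volume : Measure (Euc n)).toSphere) := by
  rw [← lintegral_indicator_one hS, lintegral_lineMeasure s hL (measurable_one.indicator hS)]
  refine lintegral_congr fun u => ?_
  have e : (fun y => S.indicator (1 : Sph n × Euc n → ℝ≥0∞) (u, y)) =
    (Prod.mk u ⁻¹' S).indicator 1 := rfl
  have hm : MeasurableSet (Prod.mk u ⁻¹' S) := measurable_prodMk_left hS
  rw [e, lintegral_indicator_one hm, Measure.restrict_apply hm, inter_comm]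

theorem lineMeasure_hits_smul_sdiff_le (s : ℝ) {K L : Set (Euc n)} (hK : IsCompact K)
    (hc : Convex ℝ K) (h0 : (0 : Euc n) ∈ K) (hL : IsSymmConvexBody L) {r : ℝ} (hr : 1 ≤ r) :
    lineMeasure s L ({p | Hits (r • K) p.1 p.2} \ {p | Hits K p.1 p.2}) ≤
      ENNReal.ofReal (r ^ n - 1) * lineMeasure s L {p | Hits K p.1 p.2} := by
  have hm := (isClosed_hits hK).measurableSet
  rw [lineMeasure_apply s hL ((isClosed_hits (hK.smul r)).measurableSet.diff hm),
    lineMeasure_apply s hL hm, ← lintegral_const_mul' _ _ ENNReal.ofReal_ne_top]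
  refine lintegral_mono fun u => ?_
  rw [mul_left_comm]
  refine mul_le_mul_right ?_ _
  refine le_trans (measure_mono ?_) (volume_slab_inter_hits_smul_sdiff_le hK hc h0 u hr)
  rintro y ⟨hy, h1, h2⟩
  exact ⟨⟨hy, h1⟩, fun h => h2 h.2⟩

theorem lintegral_indicator_not_hits_le {s : ℝ} {K L : Set (Euc n)} (hK : IsCompact K)
    (hc : Convex ℝ K) (h0 : (0 : Euc n) ∈ interior K) (hL : IsSymmConvexBody L) {W : ℝ}
    (hW : ∀ u, radialWeight s L u ≤ ENNReal.ofReal W) {t : ℝ} (ht : 0 ≤ t) :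
    ∫⁻ p, {p | Hits K p.1 p.2}ᶜ.indicator
        (fun p => ENNReal.ofReal (chordLen ((1 + t) • K) p.1 p.2)) p ∂(lineMeasure s L) ≤
      ENNReal.ofReal ((1 + t) ^ n - 1) * (ENNReal.ofReal W *
        ((volume : Measure (Euc n)).toSphere.prod (volume.restrict K)) (shadeCone K t)) := by
  have hm := (isClosed_hits hK).measurableSet
  rw [lintegral_lineMeasure s hL
    ((measurable_chordLen (hK.smul (1 + t))).ennreal_ofReal.indicator hm.compl),
    Measure.prod_apply (measurableSet_shadeCone hc h0 t),
    ← lintegral_const_mul' _ _ ENNReal.ofReal_ne_top, ← lintegral_const_mul' _ _ ENNReal.ofReal_ne_top]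
  refine lintegral_mono fun u => ?_
  rw [mul_left_comm]
  refine mul_le_mul' (hW u) ?_
  refine le_trans (le_of_eq ?_) (volume_smul_sdiff_hits_le hK hc h0 u ht)
  exact setLIntegral_slab_indicator_chordLen hK (hK.smul (1 + t)) (hc.smul (1 + t)) u

/-- Distinguish `l ≤ ε` from `l ≥ ε`. Only the first power of the length is controlled by a volume;
the price is a constant term, small with `ε`. -/
theorem rpow_one_sub_le {s : ℝ} (hs : 0 < s) (hs1 : s < 1) {ε l : ℝ} (hε : 0 < ε) (hl : 0 ≤ l) :
    l ^ (1 - s) ≤ ε ^ (1 - s) + ε ^ (-s) * l := by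
  rcases le_total l ε with h | h
  · have h1 := Real.rpow_le_rpow hl h (show 0 ≤ 1 - s by linarith)
    have := mul_nonneg (Real.rpow_nonneg hε.le (-s)) hl
    linarith
  · have hl0 := hε.trans_le h
    have h1 := Real.rpow_le_rpow_of_nonpos hε h (show -s ≤ 0 by linarith)
    have h2 : l ^ (1 - s) = l ^ (-s) * l := by
      rw [Real.rpow_sub hl0, Real.rpow_neg hl, Real.rpow_one]; field_simp
    have h3 := mul_le_mul_of_nonneg_right h1 hl
    have := Real.rpow_nonneg hε.le (1 - s)
    linarith

/-- The contribution to the chord energy of a dilate of `K` of the lines missing `K`. -/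
theorem lintegral_indicator_not_hits_rpow_le {s : ℝ} (hs : 0 < s) (hs1 : s < 1) {K L : Set (Euc n)}
    (hK : IsCompact K) (hc : Convex ℝ K) (h0 : (0 : Euc n) ∈ interior K) (hL : IsSymmConvexBody L)
    {W : ℝ} (hW : ∀ u, radialWeight s L u ≤ ENNReal.ofReal W) {t : ℝ} (ht : 0 ≤ t) {ε : ℝ}
    (hε : 0 < ε) :
    ∫⁻ p, {p | Hits K p.1 p.2}ᶜ.indicator
        (fun p => ENNReal.ofReal (chordLen ((1 + t) • K) p.1 p.2 ^ (1 - s))) p ∂(lineMeasure s L) ≤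
      ENNReal.ofReal ((1 + t) ^ n - 1) *
        (ENNReal.ofReal (ε ^ (1 - s)) * lineMeasure s L {p | Hits K p.1 p.2} +
          ENNReal.ofReal (ε ^ (-s)) * (ENNReal.ofReal W *
        ((volume : Measure (Euc n)).toSphere.prod (volume.restrict K)) (shadeCone K t))) := by
  have hm := (isClosed_hits hK).measurableSet
  have hKt := hK.smul (1 + t)
  have hmt := (isClosed_hits hKt).measurableSet
  calc _ ≤ ∫⁻ p, (({p | Hits ((1 + t) • K) p.1 p.2} \ {p | Hits K p.1 p.2}).indicator
        (fun _ => ENNReal.ofReal (ε ^ (1 - s))) p + ENNReal.ofReal (ε ^ (-s)) *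
          {p | Hits K p.1 p.2}ᶜ.indicator
            (fun p => ENNReal.ofReal (chordLen ((1 + t) • K) p.1 p.2)) p) ∂(lineMeasure s L) := by
        refine lintegral_mono fun p => ?_
        by_cases h : Hits K p.1 p.2
        · rw [indicator_of_notMem (by simpa using h)]
          exact zero_le
        have hmem : p ∈ {p : Sph n × Euc n | Hits K p.1 p.2}ᶜ := h
        rw [indicator_of_mem hmem, indicator_of_mem hmem]
        by_cases h2 : Hits ((1 + t) • K) p.1 p.2
        · have hl := chordLen_nonneg hKt p.1 p.2
          rw [indicator_of_mem (by exact ⟨h2, h⟩),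
            ← ENNReal.ofReal_mul (Real.rpow_nonneg hε.le _), ← ENNReal.ofReal_add
              (Real.rpow_nonneg hε.le _) (mul_nonneg (Real.rpow_nonneg hε.le _) hl)]
          exact ENNReal.ofReal_le_ofReal (rpow_one_sub_le hs hs1 hε hl)
        · rw [chordLen_of_not_hits h2, Real.zero_rpow (by linarith), ENNReal.ofReal_zero]
          exact zero_le
    _ ≤ _ := by
        have hmm : Measurable fun p : Sph n × Euc n => {p | Hits K p.1 p.2}ᶜ.indicator
            (fun p => ENNReal.ofReal (chordLen ((1 + t) • K) p.1 p.2)) p :=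
          (measurable_chordLen hKt).ennreal_ofReal.indicator hm.compl
        rw [lintegral_add_right _ (hmm.const_mul _), lintegral_indicator_const (hmt.diff hm),
          lintegral_const_mul _ hmm, mul_add, mul_left_comm, mul_left_comm (ENNReal.ofReal (_ - 1))]
        exact add_le_add
          (mul_le_mul_right (lineMeasure_hits_smul_sdiff_le s hK hc (interior_subset h0) hL
            (by linarith)) _)
          (mul_le_mul_right (lintegral_indicator_not_hits_le hK hc h0 hL hW ht) _)

/-- Lines meeting `K` obey the tangent bound `chordLen_wulffVar_rpow_le` for `f = h_K`; the
remaining lines are put into the last integral. -/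
theorem chordEnergy_smul_le [Nonempty (Sph n)] {s : ℝ} (hs : 0 < s) (hs1 : s < 1)
    {K L : Set (Euc n)} (hK : IsConvexBody K) (h0 : (0 : Euc n) ∈ interior K)
    (hL : IsSymmConvexBody L) {t : ℝ} (ht : 0 ≤ t) :
    chordEnergy s ((1 + t) • K) L ≤ chordEnergy s K L +
      ENNReal.ofReal t * (∫⁻ p, ENNReal.ofReal (chordRate s K (supportFun K) p) ∂(lineMeasure s L)) +
      ∫⁻ p, {p | Hits K p.1 p.2}ᶜ.indicator
        (fun p => ENNReal.ofReal (chordLen ((1 + t) • K) p.1 p.2 ^ (1 - s))) p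
          ∂(lineMeasure s L) := by
  have hm := (isClosed_hits hK.isCompact).measurableSet
  have hmm : Measurable fun p : Sph n × Euc n => {p | Hits K p.1 p.2}ᶜ.indicator
      (fun p => ENNReal.ofReal (chordLen ((1 + t) • K) p.1 p.2 ^ (1 - s))) p :=
    (measurable_ofReal_chordLen_rpow s (hK.isCompact.smul (1 + t))).indicator hm.compl
  rw [chordEnergy, chordEnergy, ← lintegral_const_mul' _ _ ENNReal.ofReal_ne_top,
    ← lintegral_add_left (measurable_ofReal_chordLen_rpow s hK.isCompact),
    ← lintegral_add_right _ hmm]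
  refine lintegral_mono_ae ?_
  filter_upwards [ae_regularLine hK hL] with p hp
  by_cases h : Hits K p.1 p.2
  · rw [indicator_of_notMem (by simpa using h), add_zero, ← ENNReal.ofReal_mul ht]
    have e := wulffVar_supportFun hK (show 0 < 1 + t by linarith)
    have hle := chordLen_wulffVar_rpow_le hs hs1 hK (continuous_supportFun hK.isCompact) (hp h)
      (t := t) (by
        rw [e]
        exact h.mono (subset_smul_of_one_le hK.convex (interior_subset h0) (by linarith)))
    rw [e] at hle
    exact (ENNReal.ofReal_le_ofReal hle).trans ENNReal.ofReal_add_le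
  · rw [indicator_of_mem (by simpa using h)]
    exact le_add_self

theorem hasDerivAt_one_add_rpow (a : ℝ) : HasDerivAt (fun t : ℝ => (1 + t) ^ a) a 0 := by
  have h := ((hasDerivAt_id (0 : ℝ)).const_add 1).rpow_const (p := a) (Or.inl (by simp))
  simpa using h

theorem tendsto_ofReal_slope_one_add_rpow (a : ℝ) :
    Tendsto (fun t : ℝ => ENNReal.ofReal (((1 + t) ^ a - 1) / t)) (𝓝[>] 0) (𝓝 (ENNReal.ofReal a)) := by
  refine (ENNReal.continuous_ofReal.tendsto _).comp ?_
  refine ((hasDerivAt_iff_tendsto_slope_zero.1 (hasDerivAt_one_add_rpow a)).mono_left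
    (nhdsGT_le_nhdsNE (0 : ℝ))).congr fun t => ?_
  simp [div_eq_inv_mul]

/-- The dilation derivative of the chord energy is at most the integral of the chord rates. -/
theorem mul_chordEnergy_le [Nonempty (Sph n)] (hn : 1 ≤ n) {s : ℝ} (hs : 0 < s) (hs1 : s < 1)
    {K L : Set (Euc n)} (hK : IsConvexBody K) (h0 : (0 : Euc n) ∈ interior K)
    (hL : IsSymmConvexBody L) :
    ENNReal.ofReal ((n : ℝ) - s) * chordEnergy s K L ≤
      ∫⁻ p, ENNReal.ofReal (chordRate s K (supportFun K) p) ∂(lineMeasure s L) := by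
  obtain ⟨W, hW⟩ := exists_radialWeight_le hs hL
  set J := chordEnergy s K L
  have hJ : J ≠ ∞ := (chordEnergy_lt_top hs hs1 hK.isCompact hL).ne
  set D := ∫⁻ p, ENNReal.ofReal (chordRate s K (supportFun K) p) ∂(lineMeasure s L)
  set A := lineMeasure s L {p | Hits K p.1 p.2}
  have hA : A ≠ ∞ := (lintegral_lineMeasure_hits_lt_top hs hK.isCompact hL).ne
  set Ψ : ℝ → ℝ≥0∞ := fun t =>
    ((volume : Measure (Euc n)).toSphere.prod (volume.restrict K)) (shadeCone K t)
  have hΨ : Tendsto Ψ (𝓝[>] 0) (𝓝 0) := tendsto_measure_shadeCone hn hK.isCompact hK.convex h0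
  have hns : (1 : ℝ) ≤ n := by exact_mod_cast hn
  have slope_le : ∀ ε : ℝ, 0 < ε → ∀ t : ℝ, 0 < t →
      ENNReal.ofReal (((1 + t) ^ ((n : ℝ) - s) - 1) / t) * J ≤
        D + ENNReal.ofReal (((1 + t) ^ (n : ℝ) - 1) / t) * (ENNReal.ofReal (ε ^ (1 - s)) * A +
          ENNReal.ofReal (ε ^ (-s)) * (ENNReal.ofReal W * Ψ t)) := by
    intro ε hε t ht
    have h1 := chordEnergy_smul_le hs hs1 hK h0 hL ht.le
    rw [chordEnergy_smul hn hs hs1 hK.isCompact hK.convex hL (by linarith), add_assoc] at h1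
    have hr1 : 1 ≤ (1 + t) ^ ((n : ℝ) - s) := Real.one_le_rpow (by linarith) (by linarith)
    have e1 : ENNReal.ofReal ((1 + t) ^ ((n : ℝ) - s)) =
        1 + ENNReal.ofReal ((1 + t) ^ ((n : ℝ) - s) - 1) := by
      rw [← ENNReal.ofReal_one, ← ENNReal.ofReal_add zero_le_one (by linarith), add_sub_cancel]
    rw [e1, add_mul, one_mul, ENNReal.add_le_add_iff_left hJ] at h1
    have h2 := h1.trans (add_le_add le_rfl (lintegral_indicator_not_hits_rpow_le hs hs1
      hK.isCompact hK.convex h0 hL hW ht.le hε))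
    have h3 := mul_le_mul_right h2 (ENNReal.ofReal t⁻¹)
    rw [← mul_assoc, ← ENNReal.ofReal_mul (inv_pos.2 ht).le, mul_add, ← mul_assoc, ← mul_assoc,
      ← ENNReal.ofReal_mul (inv_pos.2 ht).le, ← ENNReal.ofReal_mul (inv_pos.2 ht).le,
      inv_mul_cancel₀ ht.ne', ENNReal.ofReal_one, one_mul, ← div_eq_inv_mul, ← div_eq_inv_mul] at h3
    rw [Real.rpow_natCast]
    exact h3
  -- The order of limits matters. With `ε` fixed, `t → 0` removes the shade cone term despite its
  -- factor `ε^(-s)`; the surviving error carries `ε^(1-s)` and vanishes only afterwards.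
  have dilation_le_add : ∀ ε : ℝ, 0 < ε → ENNReal.ofReal ((n : ℝ) - s) * J ≤
      D + ENNReal.ofReal n * (ENNReal.ofReal (ε ^ (1 - s)) * A) := by
    intro ε hε
    have hl := ENNReal.Tendsto.mul_const (b := J) (tendsto_ofReal_slope_one_add_rpow ((n : ℝ) - s))
      (Or.inr hJ)
    have hB : Tendsto (fun t => ENNReal.ofReal (ε ^ (1 - s)) * A +
        ENNReal.ofReal (ε ^ (-s)) * (ENNReal.ofReal W * Ψ t)) (𝓝[>] 0)
          (𝓝 (ENNReal.ofReal (ε ^ (1 - s)) * A +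
            ENNReal.ofReal (ε ^ (-s)) * (ENNReal.ofReal W * 0))) :=
      tendsto_const_nhds.add (ENNReal.Tendsto.const_mul
        (ENNReal.Tendsto.const_mul hΨ (Or.inr ENNReal.ofReal_ne_top)) (Or.inr ENNReal.ofReal_ne_top))
    rw [mul_zero, mul_zero, add_zero] at hB
    have hr := tendsto_const_nhds (x := D) |>.add (ENNReal.Tendsto.mul
      (tendsto_ofReal_slope_one_add_rpow (n : ℝ))
      (Or.inr (ENNReal.mul_ne_top ENNReal.ofReal_ne_top hA)) hB (Or.inr ENNReal.ofReal_ne_top))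
    refine le_of_tendsto_of_tendsto hl hr ?_
    filter_upwards [self_mem_nhdsWithin] with t ht
    exact slope_le ε hε t ht
  have hε : Tendsto (fun ε : ℝ => D + ENNReal.ofReal n * (ENNReal.ofReal (ε ^ (1 - s)) * A))
      (𝓝[>] 0) (𝓝 (D + ENNReal.ofReal n * (ENNReal.ofReal (0 ^ (1 - s)) * A))) := by
    have hc : Tendsto (fun ε : ℝ => ENNReal.ofReal (ε ^ (1 - s))) (𝓝[>] 0)
        (𝓝 (ENNReal.ofReal (0 ^ (1 - s)))) :=
      (ENNReal.continuous_ofReal.comp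
        (Real.continuous_rpow_const (by linarith))).continuousAt.tendsto.mono_left
          nhdsWithin_le_nhds
    exact tendsto_const_nhds.add (ENNReal.Tendsto.const_mul
      (ENNReal.Tendsto.mul_const hc (Or.inr hA)) (Or.inr ENNReal.ofReal_ne_top))
  rw [Real.zero_rpow (by linarith), ENNReal.ofReal_zero, zero_mul, mul_zero, add_zero] at hε
  refine ge_of_tendsto hε ?_
  filter_upwards [self_mem_nhdsWithin] with ε h
  exact dilation_le_add ε h

end Dilation

/-! ### Dilations and the squeeze -/

section FirstVariation

open scoped Pointwise

theorem chordEnergy_mono {s : ℝ} (hs1 : s < 1) {K K' : Set (Euc n)} (hK : IsCompact K)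
    (hK' : IsCompact K') (h : K ⊆ K') (L : Set (Euc n)) :
    chordEnergy s K L ≤ chordEnergy s K' L :=
  lintegral_mono fun _ => ENNReal.ofReal_le_ofReal (Real.rpow_le_rpow (chordLen_nonneg hK _ _)
    (chordLen_mono hK hK' h _ _) (by linarith))

theorem supportFun_pos {K : Set (Euc n)} (hK : IsCompact K) (h0 : (0 : Euc n) ∈ interior K)
    (v : Sph n) : 0 < supportFun K v := by
  simpa using inner_lt_supportFun_of_mem_interior hK v h0

theorem wulffVar_const_mul (K : Set (Euc n)) (f : Sph n → ℝ) (c t : ℝ) :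
    wulffVar K (fun v => c * f v) t = wulffVar K f (t * c) := by
  simp only [wulffVar, mul_assoc]

theorem two_mul_ofReal (x : ℝ) : 2 * ENNReal.ofReal x = ENNReal.ofReal (2 * x) := by
  rw [ENNReal.ofReal_mul zero_le_two, ENNReal.ofReal_ofNat]

/-- The total mass formula `2 ∫ h_K d𝒜 = (n - s) P`, in terms of chord energies. -/
theorem lintegral_supportFun_fracAreaMeasure [Nonempty (Sph n)] (hn : 1 ≤ n) {s : ℝ} (hs : 0 < s)
    (hs1 : s < 1) {K L : Set (Euc n)} (hK : IsConvexBody K) (h0 : (0 : Euc n) ∈ interior K)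
    (hL : IsSymmConvexBody L) :
    ENNReal.ofReal (s * (1 - s)) *
        (2 * ∫⁻ v, ENNReal.ofReal (supportFun K v) ∂(fracAreaMeasure s K L)) =
      ENNReal.ofReal ((n : ℝ) - s) * chordEnergy s K L := by
  have hh := continuous_supportFun hK.isCompact
  have hpos := supportFun_pos hK.isCompact h0
  have hJ : chordEnergy s K L ≠ ∞ := (chordEnergy_lt_top hs hs1 hK.isCompact hL).ne
  refine le_antisymm ?_ ?_
  · have h := lintegral_le_liminf_chordEnergy_sub hs hs1 hK hL
      (continuous_const (y := (0 : ℝ))) hh (fun v => (hpos v).le)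
    simp only [sub_zero] at h
    refine h.trans (le_of_eq (Tendsto.liminf_eq ?_))
    refine (ENNReal.Tendsto.mul_const (tendsto_ofReal_slope_one_add_rpow ((n : ℝ) - s))
      (Or.inr hJ)).congr' ?_
    filter_upwards [self_mem_nhdsWithin] with t ht
    have ht : 0 < t := ht
    have e0 : wulffVar K (fun _ => (0 : ℝ)) t = K := by
      simp only [wulffVar, mul_zero, add_zero, wulffShape_supportFun hK]
    have hp := Real.rpow_nonneg (show 0 ≤ 1 + t by linarith) ((n : ℝ) - s)
    rw [wulffVar_supportFun hK (by linarith), e0,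
      chordEnergy_smul hn hs hs1 hK.isCompact hK.convex hL (by linarith), div_eq_inv_mul,
      ENNReal.ofReal_mul (inv_pos.2 ht).le, ENNReal.ofReal_inv_of_pos ht,
      ENNReal.ofReal_sub _ zero_le_one, ENNReal.ofReal_one, mul_assoc,
      ENNReal.sub_mul fun _ _ => hJ, one_mul]
  · rw [← lintegral_chordRate hs hs1 hK hL (fun v => (hpos v).le) hh.measurable]
    exact mul_chordEnergy_le hn hs hs1 hK h0 hL

/-- By the total mass formula `h_K` has finite integral, and it is bounded below by a positive
constant because the origin is interior. -/
theorem isFiniteMeasure_fracAreaMeasure [Nonempty (Sph n)] (hn : 1 ≤ n) {s : ℝ} (hs : 0 < s)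
    (hs1 : s < 1) {K L : Set (Euc n)} (hK : IsConvexBody K) (h0 : (0 : Euc n) ∈ interior K)
    (hL : IsSymmConvexBody L) : IsFiniteMeasure (fracAreaMeasure s K L) := by
  have h := lintegral_supportFun_fracAreaMeasure hn hs hs1 hK h0 hL
  have hlt : ENNReal.ofReal (s * (1 - s)) *
      (2 * ∫⁻ v, ENNReal.ofReal (supportFun K v) ∂(fracAreaMeasure s K L)) < ∞ := by
    rw [h]
    exact ENNReal.mul_lt_top ENNReal.ofReal_lt_top (chordEnergy_lt_top hs hs1 hK.isCompact hL)
  have hc : ENNReal.ofReal (s * (1 - s)) ≠ 0 :=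
    (ENNReal.ofReal_pos.2 (mul_pos hs (by linarith))).ne'
  have h2 : ∫⁻ v, ENNReal.ofReal (supportFun K v) ∂(fracAreaMeasure s K L) ≠ ∞ := by
    intro h3
    rw [h3, ENNReal.mul_top two_ne_zero, ENNReal.mul_top hc] at hlt
    exact lt_irrefl _ hlt
  obtain ⟨v₀, -, hv₀⟩ := isCompact_univ.exists_isMinOn (univ_nonempty (α := Sph n))
    (continuous_supportFun hK.isCompact).continuousOn
  have hm := supportFun_pos hK.isCompact h0 v₀
  refine ⟨lt_top_iff_ne_top.2 fun htop => h2 (top_unique ?_)⟩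
  calc ∞ = ∫⁻ _v : Sph n, ENNReal.ofReal (supportFun K v₀) ∂(fracAreaMeasure s K L) := by
        rw [lintegral_const, htop, ENNReal.mul_top (ENNReal.ofReal_pos.2 hm).ne']
    _ ≤ _ := lintegral_mono fun v => ENNReal.ofReal_le_ofReal (hv₀ (mem_univ v))

theorem integrable_of_continuous_sphere {A : Measure (Sph n)} [IsFiniteMeasure A] {f : Sph n → ℝ}
    (hf : Continuous f) : Integrable f A :=
  hf.integrable_of_hasCompactSupport (HasCompactSupport.of_compactSpace f)

theorem eventually_mul_le_chordEnergy_sub [Nonempty (Sph n)] {s : ℝ} (hs : 0 < s) (hs1 : s < 1)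
    {K L : Set (Euc n)} (hK : IsConvexBody K) (hL : IsSymmConvexBody L)
    [IsFiniteMeasure (fracAreaMeasure s K L)] {f g : Sph n → ℝ}
    (hf : Continuous f) (hg : Continuous g) (hfg : ∀ v, f v ≤ g v) {ε : ℝ} (hε : 0 < ε) :
    ∀ᶠ t : ℝ in 𝓝[>] 0, t * (s * (1 - s) * (2 * ∫ v, g v ∂(fracAreaMeasure s K L)) -
        s * (1 - s) * (2 * ∫ v, f v ∂(fracAreaMeasure s K L)) - ε) ≤
      (chordEnergy s (wulffVar K g t) L).toReal - (chordEnergy s (wulffVar K f t) L).toReal := by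
  have hKf := isCompact_wulffVar hK.isCompact hf
  have hKg := isCompact_wulffVar hK.isCompact hg
  have hint : Integrable (fun v => g v - f v) (fracAreaMeasure s K L) :=
    integrable_of_continuous_sphere (hg.sub hf)
  have hss : 0 < s * (1 - s) := mul_pos hs (by linarith)
  have h := lintegral_le_liminf_chordEnergy_sub hs hs1 hK hL hf hg hfg
  have e : s * (1 - s) * (2 * ∫ v, g v ∂(fracAreaMeasure s K L)) -
        s * (1 - s) * (2 * ∫ v, f v ∂(fracAreaMeasure s K L)) =
      s * (1 - s) * (2 * ∫ v, g v - f v ∂(fracAreaMeasure s K L)) := by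
    rw [integral_sub (integrable_of_continuous_sphere hg) (integrable_of_continuous_sphere hf)]
    ring
  rw [e]
  rw [← ofReal_integral_eq_lintegral_ofReal hint (ae_of_all _ fun v => sub_nonneg.2 (hfg v)),
    two_mul_ofReal, ← ENNReal.ofReal_mul hss.le] at h
  set X := s * (1 - s) * (2 * ∫ v, g v - f v ∂(fracAreaMeasure s K L))
  have hmono : ∀ t : ℝ, 0 < t →
      chordEnergy s (wulffVar K f t) L ≤ chordEnergy s (wulffVar K g t) L := fun t ht =>
    chordEnergy_mono hs1 (hKf t) (hKg t) (wulffVar_mono hfg ht.le) L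
  have hfin : ∀ t : ℝ, chordEnergy s (wulffVar K g t) L ≠ ∞ := fun t =>
    (chordEnergy_lt_top hs hs1 (hKg t) hL).ne
  -- For `X ≤ 0` monotonicity of the energy suffices; for `X > 0` the strict inequality survives
  -- `ENNReal.ofReal` and lies below the liminf.
  rcases le_or_gt X 0 with hX | hX
  · filter_upwards [self_mem_nhdsWithin] with t ht
    have h1 := ENNReal.toReal_mono (hfin t) (hmono t ht)
    have h2 : t * (X - ε) ≤ 0 := mul_nonpos_of_nonneg_of_nonpos (le_of_lt ht) (by linarith)
    linarith
  · have hlt : ENNReal.ofReal (X - ε) < ENNReal.ofReal X :=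
      (ENNReal.ofReal_lt_ofReal_iff hX).2 (by linarith)
    filter_upwards [self_mem_nhdsWithin, eventually_lt_of_lt_liminf (hlt.trans_le h)] with t ht hlt
    have ht : 0 < t := ht
    rw [← ENNReal.toReal_sub_of_le (hmono t ht) (hfin t)]
    have h1 : ENNReal.ofReal (t * (X - ε)) ≤
        chordEnergy s (wulffVar K g t) L - chordEnergy s (wulffVar K f t) L := by
      rw [ENNReal.ofReal_mul ht.le]
      calc _ ≤ ENNReal.ofReal t * _ := mul_le_mul_right hlt.le _
        _ = _ := by
          rw [← mul_assoc, ENNReal.mul_inv_cancel (ENNReal.ofReal_pos.2 ht).ne'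
            ENNReal.ofReal_ne_top, one_mul]
    exact (ENNReal.ofReal_le_iff_le_toReal (ENNReal.sub_ne_top (hfin t))).1 h1

/-- The energy is `(1 + tc)^(n-s) J(K)` near `t = 0`, for either sign of `c`; the total mass formula
rewrites its derivative as an integral against the area measure. -/
theorem hasDerivAt_chordEnergy_dilation [Nonempty (Sph n)] (hn : 1 ≤ n) {s : ℝ} (hs : 0 < s)
    (hs1 : s < 1) {K L : Set (Euc n)} (hK : IsConvexBody K) (h0 : (0 : Euc n) ∈ interior K)
    (hL : IsSymmConvexBody L) [IsFiniteMeasure (fracAreaMeasure s K L)] (c : ℝ) :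
    HasDerivAt (fun t => (chordEnergy s (wulffVar K (fun v => c * supportFun K v) t) L).toReal)
      (s * (1 - s) * (2 * ∫ v, c * supportFun K v ∂(fracAreaMeasure s K L))) 0 := by
  have hh := continuous_supportFun hK.isCompact
  have hint := integrable_of_continuous_sphere (A := fracAreaMeasure s K L) hh
  have hss : 0 < s * (1 - s) := mul_pos hs (by linarith)
  have hn1 : (1 : ℝ) ≤ n := by exact_mod_cast hn
  have h := lintegral_supportFun_fracAreaMeasure hn hs hs1 hK h0 hL
  have hnn : 0 ≤ ∫ v, supportFun K v ∂(fracAreaMeasure s K L) :=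
    integral_nonneg fun v => (supportFun_pos hK.isCompact h0 v).le
  rw [← ofReal_integral_eq_lintegral_ofReal hint
    (ae_of_all _ fun v => (supportFun_pos hK.isCompact h0 v).le),
    two_mul_ofReal, ← ENNReal.ofReal_mul hss.le] at h
  have h' := congrArg ENNReal.toReal h
  rw [ENNReal.toReal_ofReal (by positivity), ENNReal.toReal_mul,
    ENNReal.toReal_ofReal (by linarith)] at h'
  have e : s * (1 - s) * (2 * ∫ v, c * supportFun K v ∂(fracAreaMeasure s K L)) =
      ((n : ℝ) - s) * c * (chordEnergy s K L).toReal := by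
    rw [integral_const_mul]
    linear_combination c * h'
  rw [e]
  have h1 : HasDerivAt (fun t : ℝ => 1 + t * c) c 0 := by
    simpa using ((hasDerivAt_id (0 : ℝ)).mul_const c).const_add 1
  have h2 := (h1.rpow_const (p := (n : ℝ) - s) (Or.inl (by simp))).mul_const
    (chordEnergy s K L).toReal
  have h3 : HasDerivAt (fun t : ℝ => (1 + t * c) ^ ((n : ℝ) - s) * (chordEnergy s K L).toReal)
      (((n : ℝ) - s) * c * (chordEnergy s K L).toReal) 0 := by
    refine h2.congr_deriv ?_
    rw [zero_mul, add_zero, Real.one_rpow]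
    ring
  refine h3.congr_of_eventuallyEq ?_
  have hcont : Continuous fun t : ℝ => 1 + t * c := by fun_prop
  filter_upwards [hcont.continuousAt.eventually (lt_mem_nhds (show 0 < 1 + 0 * c by simp))] with t ht
  rw [wulffVar_const_mul, wulffVar_supportFun hK ht,
    chordEnergy_smul hn hs hs1 hK.isCompact hK.convex hL ht, ENNReal.toReal_mul,
    ENNReal.toReal_ofReal (Real.rpow_nonneg ht.le _)]

/-- The pair `(-C h_K, f)` bounds the energy for `f` from below, the pair `(f, C h_K)` from above.
As the expansions for `±C h_K` are exact to first order, both bounds have the same slope; each of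
the two errors takes `ε/2`. -/
theorem eventually_abs_chordEnergy_sub_le [Nonempty (Sph n)] (hn : 1 ≤ n) {s : ℝ} (hs : 0 < s)
    (hs1 : s < 1) {K L : Set (Euc n)} (hK : IsConvexBody K) (h0 : (0 : Euc n) ∈ interior K)
    (hL : IsSymmConvexBody L) [IsFiniteMeasure (fracAreaMeasure s K L)] {f : Sph n → ℝ}
    (hf : Continuous f) {ε : ℝ} (hε : 0 < ε) :
    ∀ᶠ t : ℝ in 𝓝[>] 0, |(chordEnergy s (wulffVar K f t) L).toReal - (chordEnergy s K L).toReal -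
      t * (s * (1 - s) * (2 * ∫ v, f v ∂(fracAreaMeasure s K L)))| ≤ ε * t := by
  have hh := continuous_supportFun hK.isCompact
  have hpos := supportFun_pos hK.isCompact h0
  obtain ⟨C, hC⟩ := (isCompact_range ((hf.abs).div hh fun v => (hpos v).ne')).bddAbove
  have hfC : ∀ v, |f v| ≤ C * supportFun K v := fun v => by
    rw [← div_le_iff₀ (hpos v)]
    exact hC (mem_range_self v)
  have hdil : ∀ c : ℝ, ∀ᶠ t : ℝ in 𝓝[>] 0,
      |(chordEnergy s (wulffVar K (fun v => c * supportFun K v) t) L).toReal -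
        (chordEnergy s K L).toReal -
        t * (s * (1 - s) * (2 * ∫ v, c * supportFun K v ∂(fracAreaMeasure s K L)))| ≤
          ε / 2 * t := by
    intro c
    have h := hasDerivAt_chordEnergy_dilation hn hs hs1 hK h0 hL c
    rw [hasDerivAt_iff_isLittleO, Asymptotics.isLittleO_iff] at h
    filter_upwards [self_mem_nhdsWithin, (h (half_pos hε)).filter_mono nhdsWithin_le_nhds]
      with t ht h1
    simpa only [wulffVar_zero hK, sub_zero, smul_eq_mul, Real.norm_eq_abs,
      abs_of_pos (show 0 < t from ht)] using h1
  have hlow := eventually_mul_le_chordEnergy_sub hs hs1 hK hL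
    (f := fun v => -C * supportFun K v) (by fun_prop) hf
    (fun v => by linarith [(abs_le.1 (hfC v)).1]) (half_pos hε)
  have hup := eventually_mul_le_chordEnergy_sub hs hs1 hK hL
    (g := fun v => C * supportFun K v) hf (by fun_prop)
    (fun v => (abs_le.1 (hfC v)).2) (half_pos hε)
  filter_upwards [hlow, hup, hdil C, hdil (-C)] with t h1 h2 h3 h4
  rw [abs_le] at *
  constructor <;> linarith [h3.1, h3.2, h4.1, h4.2]

theorem hasDerivAt_chordEnergy [Nonempty (Sph n)] (hn : 1 ≤ n) {s : ℝ} (hs : 0 < s)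
    (hs1 : s < 1) {K L : Set (Euc n)} (hK : IsConvexBody K) (h0 : (0 : Euc n) ∈ interior K)
    (hL : IsSymmConvexBody L) [IsFiniteMeasure (fracAreaMeasure s K L)] {f : Sph n → ℝ}
    (hf : Continuous f) :
    HasDerivAt (fun t => (chordEnergy s (wulffVar K f t) L).toReal)
      (s * (1 - s) * (2 * ∫ v, f v ∂(fracAreaMeasure s K L))) 0 := by
  rw [hasDerivAt_iff_isLittleO, Asymptotics.isLittleO_iff]
  intro ε hε
  have h1 := eventually_nhdsWithin_iff.1
    (eventually_abs_chordEnergy_sub_le hn hs hs1 hK h0 hL hf hε)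
  have h2 := eventually_nhdsWithin_iff.1
    (eventually_abs_chordEnergy_sub_le hn hs hs1 hK h0 hL hf.fun_neg hε)
  have hneg : Tendsto (fun t : ℝ => -t) (𝓝 0) (𝓝 0) := by simpa using tendsto_neg (0 : ℝ)
  filter_upwards [h1, hneg.eventually h2] with t h1 h2
  simp only [wulffVar_zero hK, sub_zero, smul_eq_mul, Real.norm_eq_abs]
  rcases lt_trichotomy t 0 with ht | rfl | ht
  · have h3 := h2 (show (0 : ℝ) < -t by linarith)
    -- Negative `t` are reached from the right by replacing `f` with `-f`, because only the product
    -- `t f` enters the Wulff shape.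
    have e : wulffVar K (fun v => -f v) (-t) = wulffVar K f t := by
      simp only [wulffVar, neg_mul_neg]
    rw [e, integral_neg, ← abs_of_neg ht] at h3
    convert h3 using 2
    rw [abs_of_neg ht]
    ring
  · simp [wulffVar_zero hK]
  · rw [abs_of_pos ht]
    exact h1 ht

end FirstVariation

/-! ### Invariance under translations -/

section Translation

theorem isConvexBody_preimage_add {K : Set (Euc n)} (hK : IsConvexBody K) (a : Euc n) :
    IsConvexBody ((· + a) ⁻¹' K) where
  isCompact := (Homeomorph.addRight a).isCompact_preimage.2 hK.isCompact
  convex := hK.convex.translate_preimage_left a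
  interior_nonempty := by
    obtain ⟨x, hx⟩ := hK.interior_nonempty
    refine ⟨x - a, ?_⟩
    have h := (Homeomorph.addRight a).preimage_interior K
    rw [Homeomorph.coe_addRight] at h
    rw [← h]
    simpa using hx

theorem frontier_preimage_add (K : Set (Euc n)) (a : Euc n) :
    frontier ((· + a) ⁻¹' K) = (· + a) ⁻¹' frontier K :=
  ((Homeomorph.addRight a).preimage_frontier K).symm

theorem supportFun_preimage_add {K : Set (Euc n)} (hK : IsConvexBody K) (a : Euc n) (v : Sph n) :
    supportFun ((· + a) ⁻¹' K) v = supportFun K v - ⟪(v : Euc n), a⟫ := by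
  have hK' := isConvexBody_preimage_add hK a
  refine le_antisymm (supportFun_le (hK'.interior_nonempty.mono interior_subset) v fun x hx => ?_) ?_
  · have := inner_le_supportFun hK.isCompact v hx
    rw [inner_add_right] at this
    linarith
  · rw [sub_le_iff_le_add]
    refine supportFun_le (hK.interior_nonempty.mono interior_subset) v fun x hx => ?_
    have := inner_le_supportFun hK'.isCompact v (x := x - a) (by simpa using hx)
    rw [inner_sub_right] at this
    linarith

theorem wulffVar_preimage_add {K : Set (Euc n)} (hK : IsConvexBody K) (a : Euc n) (f : Sph n → ℝ)
    (t : ℝ) : wulffVar ((· + a) ⁻¹' K) f t = (· + a) ⁻¹' wulffVar K f t := by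
  ext x
  refine forall_congr' fun v => ?_
  simp only [supportFun_preimage_add hK, inner_add_right]
  constructor <;> intro h <;> linarith

theorem fracPerimeter_preimage_add (s : ℝ) (E L : Set (Euc n)) (a : Euc n) :
    fracPerimeter s ((· + a) ⁻¹' E) L = fracPerimeter s E L := by
  have hmp : MeasurePreserving (· + a) (volume : Measure (Euc n)) volume :=
    measurePreserving_add_right volume a
  have hme : MeasurableEmbedding (· + a : Euc n → Euc n) := measurableEmbedding_addRight a
  rw [fracPerimeter, fracPerimeter, ← hmp.setLIntegral_comp_preimage_emb hme _ E]
  refine lintegral_congr fun y => ?_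
  rw [← preimage_compl, ← hmp.setLIntegral_comp_preimage_emb hme _ Eᶜ]
  simp only [add_sub_add_right_eq_sub]

theorem fracAreaSetFun_preimage_add {s : ℝ} {K : Set (Euc n)} (hK : IsConvexBody K)
    (L : Set (Euc n)) (a : Euc n) (η : Set (Sph n)) :
    fracAreaSetFun s ((· + a) ⁻¹' K) L η = fracAreaSetFun s K L η := by
  have hmp := (IsometryEquiv.addRight a).measurePreserving_euclideanHausdorffMeasure
    (X := Euc n) (n - 1)
  have hme := (IsometryEquiv.addRight a).toHomeomorph.measurableEmbedding
  have h1 : inverseGauss ((· + a) ⁻¹' K) η = IsometryEquiv.addRight a ⁻¹' inverseGauss K η := by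
    ext z
    simp only [inverseGauss, frontier_preimage_add, supportFun_preimage_add hK, mem_ofPred_eq,
      mem_preimage, IsometryEquiv.addRight_apply, inner_add_right, eq_sub_iff_add_eq]
  have h2 : ∀ z, dualMixedVolume ((n : ℝ) + s) ((· + a) ⁻¹' K) L z =
      dualMixedVolume ((n : ℝ) + s) K L (IsometryEquiv.addRight a z) := by
    intro z
    have : ∀ u, radialFun ((· + a) ⁻¹' K) z u = radialFun K (z + a) u := by
      intro u
      simp only [radialFun, mem_preimage, add_right_comm z _ a]
    simp only [dualMixedVolume, this, IsometryEquiv.addRight_apply]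
  rw [fracAreaSetFun, fracAreaSetFun, h1,
    ← hmp.setLIntegral_comp_preimage_emb hme _ (inverseGauss K η)]
  simp only [h2]

end Translation

/-- The first variation formula when the origin is an interior point. -/
theorem hasDerivAt_fracPerimeter [Nonempty (Sph n)] (hn : 1 ≤ n) {s : ℝ} (hs : 0 < s)
    (hs1 : s < 1) {K L : Set (Euc n)} (hK : IsConvexBody K) (h0 : (0 : Euc n) ∈ interior K)
    (hL : IsSymmConvexBody L) {f : Sph n → ℝ} (hf : Continuous f) :
    HasDerivAt (fun t => (fracPerimeter s (wulffVar K f t) L).toReal)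
      (2 * ∫ v, f v ∂(fracAreaMeasure s K L)) 0 := by
  have := isFiniteMeasure_fracAreaMeasure hn hs hs1 hK h0 hL
  have hss : 0 < s * (1 - s) := mul_pos hs (by linarith)
  have h := (hasDerivAt_chordEnergy hn hs hs1 hK h0 hL hf).const_mul (1 / (s * (1 - s)))
  have e : ∀ t, (fracPerimeter s (wulffVar K f t) L).toReal =
      1 / (s * (1 - s)) * (chordEnergy s (wulffVar K f t) L).toReal := fun t => by
    rw [fracPerimeter_eq hn hs hs1 (isCompact_wulffVar hK.isCompact hf t) (convex_wulffShape _) hL,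
      ENNReal.toReal_mul, ENNReal.toReal_ofReal (one_div_nonneg.2 hss.le)]
    rfl
  simp only [e]
  refine h.congr_deriv ?_
  rw [← mul_assoc, one_div, inv_mul_cancel₀ hss.ne', one_mul]

end AnisoPerimeter

end

theorem theorem3p2 (n : ℕ) (hn : 1 ≤ n) (s : ℝ) (hs0 : 0 < s) (hs1 : s < 1)
    (K L : Set (AnisoPerimeter.Euc n))
    (hK : AnisoPerimeter.IsConvexBody K) (hL : AnisoPerimeter.IsSymmConvexBody L) :
    ∃ A : Measure (AnisoPerimeter.Sph n),
      AnisoPerimeter.IsFracAreaMeasure s K L A ∧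
      IsFiniteMeasure A ∧
      ∀ f : AnisoPerimeter.Sph n → ℝ, Continuous f →
        (∀ᶠ t : ℝ in 𝓝 0,
          AnisoPerimeter.fracPerimeter s
            (AnisoPerimeter.wulffShape
              (fun v => AnisoPerimeter.supportFun K v + t * f v)) L < ∞) ∧
        HasDerivAt
          (fun t : ℝ =>
            (AnisoPerimeter.fracPerimeter s
              (AnisoPerimeter.wulffShape
                (fun v => AnisoPerimeter.supportFun K v + t * f v)) L).toReal)
          (2 * ∫ v, f v ∂A) 0 := by
  have hne : Nontrivial (AnisoPerimeter.Euc n) := by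
    have : NeZero n := ⟨by omega⟩
    infer_instance
  have : Nonempty (AnisoPerimeter.Sph n) := (NormedSpace.sphere_nonempty.2 zero_le_one).to_subtype
  -- The variational argument needs `h_K > 0`. Translating an interior point to the origin achieves
  -- this and changes neither the perimeters nor the area measure.
  obtain ⟨a, ha⟩ := hK.interior_nonempty
  have hK' := AnisoPerimeter.isConvexBody_preimage_add hK a
  have h0 : (0 : AnisoPerimeter.Euc n) ∈ interior ((· + a) ⁻¹' K) := by
    have h := (Homeomorph.addRight a).preimage_interior K
    rw [Homeomorph.coe_addRight] at h
    rw [← h]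
    simpa using ha
  refine ⟨AnisoPerimeter.fracAreaMeasure s ((· + a) ⁻¹' K) L, fun η hη => ?_,
    AnisoPerimeter.isFiniteMeasure_fracAreaMeasure hn hs0 hs1 hK' h0 hL, fun f hf => ⟨?_, ?_⟩⟩
  · rw [AnisoPerimeter.isFracAreaMeasure_fracAreaMeasure hn hs0 hK' hL η hη,
      AnisoPerimeter.fracAreaSetFun_preimage_add hK]
  · exact Eventually.of_forall fun t => AnisoPerimeter.fracPerimeter_lt_top hn hs0 hs1
      (AnisoPerimeter.isCompact_wulffVar hK.isCompact hf t) (AnisoPerimeter.convex_wulffShape _) hL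
  · have h := AnisoPerimeter.hasDerivAt_fracPerimeter hn hs0 hs1 hK' h0 hL hf
    simp only [AnisoPerimeter.wulffVar_preimage_add hK,
      AnisoPerimeter.fracPerimeter_preimage_add] at h
    exact h
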